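/- All graphs are finite, nonempty and simple, and are drawn in the Euclidean plane with straight edges. A drawing is a \emph{planar unit-distance graph} (matchstick graph) if distinct vertices are distinct points, every edge is a segment of length $1$, no vertex lies on an edge of which it is not an endpoint, and two different edges meet at most in a common endpoint. It \emph{consists only of unit triangles} $\mathcal T$ if $\mathcal T$ is a set of triangles ($3$-cycles) of the graph such that every edge is a side of exactly one triangle in $\mathcal T$. It has \emph{no additional triangles} if every nondegenerate triangle, of any size, with corners at vertices and with its sides covered by edges of the drawing, is a member of $\mathcal T$. A drawing is \emph{rigid} if every drawing (crossings being allowed) of the same graph with the same edge lengths whose vertices are sufficiently close to the original ones is congruent to the original drawing, and \emph{flexible} otherwise. Let $G_2$ be the graph with vertices $0,\dots,65$ whose edges are the sides of the $38$ triangles $\{0,1,2\}$, $\{0,3,4\}$, $\{1,15,16\}$, $\{2,37,38\}$, $\{3,37,39\}$, $\{4,5,6\}$, $\{5,39,40\}$, $\{6,7,8\}$, $\{7,40,41\}$, $\{8,9,10\}$, $\{9,41,42\}$, $\{10,11,12\}$, $\{11,42,43\}$, $\{12,13,14\}$, $\{13,43,44\}$, $\{14,28,29\}$, $\{15,17,18\}$,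 $\{18,19,20\}$, $\{20,21,22\}$, $\{22,23,24\}$, $\{24,25,26\}$, $\{26,27,28\}$, $\{29,30,31\}$, $\{30,32,33\}$, $\{31,34,36\}$, $\{33,34,35\}$, $\{36,61,64\}$, $\{38,45,46\}$, $\{44,58,59\}$, $\{45,47,48\}$, $\{48,49,50\}$, $\{50,51,52\}$, $\{52,53,54\}$, $\{54,55,56\}$, $\{56,57,58\}$, $\{59,60,61\}$, $\{60,62,63\}$, $\{63,64,65\}$, and write $A=16$, $F=35$, $C=46$, $D=65$. \textbf{Theorem.} There exist $4$-regular planar unit-distance graphs consisting only of unit triangles without additional triangles, and the smallest number of unit triangles in such a graph is at most $6422$. More precisely, there is such a graph with exactly $6422=169\cdot 38$ unit triangles which is connected and rigid and for which there is a point $c$ such that: (i) the rotations about $c$ that carry the drawing to itself are exactly those by the multiples of $2\pi/169$; (ii) it is a ring of $169$ copies of $G_2$: it contains a copy of $G_2$ such that its unit triangles are exactly the images of the $38$ triangles of this copy under the rotations by $2\pi k/169$ about $c$, $0\le k<169$, and the rotation by $2\pi/169$ carries the vertices $A$ and $F$ of this copy to its vertices $C$ and $D$, respectively; (iii) this copy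 of $G_2$, drawn as a part of the whole, is flexible, and it is mirror-symmetric about a line through $c$. -/

import Mathlib

/-- A straight-line drawing of the graph `G` in the Euclidean plane, identified with `ℂ`, that puts
the vertex `v` at the point `p v`, is a planar unit-distance drawing (a matchstick drawing):
distinct vertices are distinct points, every edge is a segment of length one, no vertex lies on an
edge of which it is not an end, and two different edges meet at most in a common end. -/
structure IsPlanarUnitDistance {V : Type*} (G : SimpleGraph V) (p : V → ℂ) : Prop where
  injective : Function.Injective p
  dist_eq_one : ∀ x y, G.Adj x y → dist (p x) (p y) = 1
  vertex_on_edge : ∀ v x y, G.Adj x y → p v ∈ segment ℝ (p x) (p y) → v = x ∨ v = y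
  edge_inter : ∀ x y x' y', G.Adj x y → G.Adj x' y' → s(x, y) ≠ s(x', y') →
    ∀ z ∈ segment ℝ (p x) (p y) ∩ segment ℝ (p x') (p y'),
      ∃ v, v ∈ s(x, y) ∧ v ∈ s(x', y') ∧ p v = z

/-- The set of points of the plane that lie on some edge of the drawing. -/
def drawing {V : Type*} (G : SimpleGraph V) (p : V → ℂ) : Set ℂ :=
  {z | ∃ x y, G.Adj x y ∧ z ∈ segment ℝ (p x) (p y)}

/-- `x`, `y`, `z` are the corners of a nondegenerate triangle, of any size and shape, all of whose
sides are covered by edges of the drawing. -/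
def FormsTriangle {V : Type*} (G : SimpleGraph V) (p : V → ℂ) (x y z : V) : Prop :=
  ¬ Collinear ℝ {p x, p y, p z} ∧
    segment ℝ (p x) (p y) ⊆ drawing G p ∧
    segment ℝ (p y) (p z) ⊆ drawing G p ∧
    segment ℝ (p z) (p x) ⊆ drawing G p

/-- The drawing `p` of the finite nonempty graph `G` is a 4-regular planar unit-distance graph that
consists only of the unit triangles in `𝒯`, without additional triangles. -/
structure IsUnitTriangleGraph {V : Type*} [Fintype V] [DecidableEq V]
    (G : SimpleGraph V) (p : V → ℂ) (𝒯 : Finset (Finset V)) : Prop where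
  nonempty : Nonempty V
  planar : IsPlanarUnitDistance G p
  regular : ∀ v, (G.neighborSet v).ncard = 4
  /-- Every member of `𝒯` is a triangle of the graph, that is, three pairwise adjacent vertices. -/
  triangles : ∀ t ∈ 𝒯, G.IsNClique 3 t
  /-- Every edge is a side of exactly one member of `𝒯`. -/
  edges : ∀ x y, G.Adj x y → ∃! t, t ∈ 𝒯 ∧ x ∈ t ∧ y ∈ t
  /-- The drawing contains no triangle, small or large, apart from the members of `𝒯`. -/
  no_additional : ∀ x y z, FormsTriangle G p x y z → {x, y, z} ∈ 𝒯

/-- The possible numbers of unit triangles in 4-regular planar unit-distance graphs that consist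
only of unit triangles without additional triangles. -/
def unitTriangleCounts : Set ℕ :=
  {n | ∃ (N : ℕ) (G : SimpleGraph (Fin N)) (p : Fin N → ℂ) (𝒯 : Finset (Finset (Fin N))),
    IsUnitTriangleGraph G p 𝒯 ∧ 𝒯.card = n}

/-- The bar framework `(G, p)` in the plane is (locally) rigid: every realization with the same edge
lengths that is close enough to `p` is congruent to `p`. -/
def IsRigid {V : Type*} (G : SimpleGraph V) (p : V → ℂ) : Prop :=
  ∃ ε > 0, ∀ q : V → ℂ,
    (∀ x y, G.Adj x y → dist (q x) (q y) = dist (p x) (p y)) →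
    (∀ v, dist (q v) (p v) < ε) →
    ∀ x y, dist (q x) (q y) = dist (p x) (p y)

/-- A framework is flexible if it is not rigid. -/
def IsFlexible {V : Type*} (G : SimpleGraph V) (p : V → ℂ) : Prop := ¬ IsRigid G p

/-- For `‖u‖ = 1`, the rotation of the plane about `c` that multiplies by `u`. -/
def rotateAbout (c u z : ℂ) : ℂ := c + u * (z - c)

/-- For `‖u‖ = 1`, the reflection of the plane in a line through `c`; as `u` varies over the unit
circle, every line through `c` occurs. -/
def reflectAbout (c u z : ℂ) : ℂ := c + u * (starRingEnd ℂ) (z - c)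

/-- The map `f` of the plane carries the drawing `p` of `G` to itself, vertices to vertices and
edges to edges. -/
def IsSymmetry {V : Type*} (G : SimpleGraph V) (p : V → ℂ) (f : ℂ → ℂ) : Prop :=
  ∃ σ : G ≃g G, ∀ v, p (σ v) = f (p v)

/-- The 38 triangles of the graph `G₂`, whose 66 vertices are numbered from 0 to 65. -/
def G₂Triangles : Finset (Finset (Fin 66)) :=
  { {0, 1, 2}, {0, 3, 4}, {1, 15, 16}, {2, 37, 38}, {3, 37, 39}, {4, 5, 6},
    {5, 39, 40}, {6, 7, 8}, {7, 40, 41}, {8, 9, 10}, {9, 41, 42}, {10, 11, 12},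
    {11, 42, 43}, {12, 13, 14}, {13, 43, 44}, {14, 28, 29}, {15, 17, 18}, {18, 19, 20},
    {20, 21, 22}, {22, 23, 24}, {24, 25, 26}, {26, 27, 28}, {29, 30, 31}, {30, 32, 33},
    {31, 34, 36}, {33, 34, 35}, {36, 61, 64}, {38, 45, 46}, {44, 58, 59}, {45, 47, 48},
    {48, 49, 50}, {50, 51, 52}, {52, 53, 54}, {54, 55, 56}, {56, 57, 58}, {59, 60, 61},
    {60, 62, 63}, {63, 64, 65} }

/-- The graph `G₂`. Its outer corners `A`, `F`, `C`, `D` are the vertices 16, 35, 46, 65. -/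
def G₂ : SimpleGraph (Fin 66) where
  Adj a b := a ≠ b ∧ ∃ t ∈ G₂Triangles, a ∈ t ∧ b ∈ t
  symm := ⟨fun _ _ h => ⟨h.1.symm, h.2.imp fun _ ht => ⟨ht.1, ht.2.2, ht.2.1⟩⟩⟩
  loopless := ⟨fun _ h => h.1 rfl⟩

/-- The drawing `p` of `G`, with its unit triangles `𝒯`, is a ring about the point `c` made of `n`
copies of `G₂`, each of them flexible and mirror-symmetric. Here `φ` is one of the copies and `σ` is
the effect of the rotation by the angle `2π / n` about `c`; the other copies are the images of `φ`
under the powers of `σ`, and consecutive copies are joined so that `A` coincides with `C` and `F`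
with `D`. -/
def IsRingOfG₂ {V : Type*} [DecidableEq V] (n : ℕ) (G : SimpleGraph V) (p : V → ℂ)
    (𝒯 : Finset (Finset V)) (c : ℂ) : Prop :=
  ∃ (φ : SimpleGraph.Copy G₂ G) (σ : G ≃g G),
    (∀ v, p (σ v) = rotateAbout c (Complex.exp (2 * Real.pi * Complex.I / n)) (p v)) ∧
    (∀ t, t ∈ 𝒯 ↔ ∃ k < n, ∃ s ∈ G₂Triangles, t = s.image fun a => (σ ^ k) (φ a)) ∧
    σ (φ 16) = φ 46 ∧ σ (φ 35) = φ 65 ∧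
    IsFlexible G₂ (fun a => p (φ a)) ∧
    ∃ u : ℂ, ‖u‖ = 1 ∧ IsSymmetry G₂ (fun a => p (φ a)) (reflectAbout c u)

open Complex in
/-- The unit complex number whose argument is half the angle of a sector, `π / 169`. -/
noncomputable def halfTurn : ℂ := exp ((Real.pi / 169 : ℝ) * I)

theorem norm_halfTurn : ‖halfTurn‖ = 1 := Complex.norm_exp_ofReal_mul_I _

theorem abs_angle_sub_le :
    |Real.pi / 169 - 1858930564254315526 / 100000000000000000000| ≤ 1 / 10 ^ 20 / 2 := by
  have h1 := Real.pi_gt_d20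
  have h2 := Real.pi_lt_d20
  rw [abs_le]
  constructor <;> linarith

theorem norm_exp_mul_I_sub_le (x y : ℝ) :
    ‖Complex.exp (x * Complex.I) - Complex.exp (y * Complex.I)‖ ≤ |x - y| := by
  have h : Complex.exp (x * Complex.I) - Complex.exp (y * Complex.I) =
      Complex.exp (y * Complex.I) * (Complex.exp (Complex.I * ((x - y : ℝ) : ℂ)) - 1) := by
    rw [mul_sub, ← Complex.exp_add]
    push_cast
    ring_nf
  rw [h, norm_mul, Complex.norm_exp_ofReal_mul_I, one_mul]
  simpa using Real.norm_exp_I_mul_ofReal_sub_one_le (x := x - y)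

theorem norm_halfTurn_sub_le :
    ‖halfTurn - ⟨99982722383336059113 / 10 ^ 20, 1858823503388794372 / 10 ^ 20⟩‖ ≤ 3 / 10 ^ 20 := by
  set d : ℝ := 1858930564254315526 / 100000000000000000000 with hd
  have h1 : ‖halfTurn - Complex.exp (d * Complex.I)‖ ≤ 1 / 10 ^ 20 / 2 :=
    (norm_exp_mul_I_sub_le _ _).trans abs_angle_sub_le
  have hn : ‖(d : ℂ) * Complex.I‖ = d := by
    rw [norm_mul, Complex.norm_I, mul_one, Complex.norm_real, Real.norm_of_nonneg]
    rw [hd]; norm_num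
  have h2 := Complex.exp_bound (x := d * Complex.I) (by rw [hn, hd]; norm_num) (n := 10)
    (by norm_num)
  rw [hn] at h2
  have h3 : d ^ 10 * ((Nat.succ 10 : ℝ) * ((Nat.factorial 10 : ℝ) * (10 : ℕ))⁻¹) ≤ 1 / 10 ^ 20 / 2 := by
    rw [hd]
    norm_num [Nat.factorial]
  have h4 : ∑ m ∈ Finset.range 10, ((d : ℂ) * Complex.I) ^ m / (m.factorial : ℂ) =
      ⟨1 - d ^ 2 / 2 + d ^ 4 / 24 - d ^ 6 / 720 + d ^ 8 / 40320,
        d - d ^ 3 / 6 + d ^ 5 / 120 - d ^ 7 / 5040 + d ^ 9 / 362880⟩ := by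
    have e2 : Complex.I ^ 2 = -1 := Complex.I_sq
    have e3 : Complex.I ^ 3 = -Complex.I := Complex.I_pow_three
    have e4 : Complex.I ^ 4 = 1 := Complex.I_pow_four
    have e5 : Complex.I ^ 5 = Complex.I := by rw [pow_succ, e4, one_mul]
    have e6 : Complex.I ^ 6 = -1 := by rw [pow_succ, e5, Complex.I_mul_I]
    have e7 : Complex.I ^ 7 = -Complex.I := by rw [pow_succ, e6, neg_one_mul]
    have e8 : Complex.I ^ 8 = 1 := by rw [pow_succ, e7]; simp
    have e9 : Complex.I ^ 9 = Complex.I := by rw [pow_succ, e8, one_mul]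
    rw [Complex.mk_eq_add_mul_I]
    simp only [Finset.sum_range_succ, Finset.sum_range_zero, mul_pow, e2, e3, e4, e5, e6, e7, e8, e9,
      Nat.factorial]
    push_cast
    ring
  rw [h4] at h2
  have h5 : ‖(⟨1 - d ^ 2 / 2 + d ^ 4 / 24 - d ^ 6 / 720 + d ^ 8 / 40320,
        d - d ^ 3 / 6 + d ^ 5 / 120 - d ^ 7 / 5040 + d ^ 9 / 362880⟩ : ℂ) -
      ⟨99982722383336059113 / 10 ^ 20, 1858823503388794372 / 10 ^ 20⟩‖ ≤ 2 / 10 ^ 20 := by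
    refine (Complex.norm_le_abs_re_add_abs_im _).trans ?_
    simp only [Complex.sub_re, Complex.sub_im]
    have a1 : |1 - d ^ 2 / 2 + d ^ 4 / 24 - d ^ 6 / 720 + d ^ 8 / 40320 -
        99982722383336059113 / 10 ^ 20| ≤ 1 / 10 ^ 20 := by
      rw [hd, abs_le]; constructor <;> norm_num
    have a2 : |d - d ^ 3 / 6 + d ^ 5 / 120 - d ^ 7 / 5040 + d ^ 9 / 362880 -
        1858823503388794372 / 10 ^ 20| ≤ 1 / 10 ^ 20 := by
      rw [hd, abs_le]; constructor <;> norm_num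
    linarith
  have h6 := norm_sub_le_norm_sub_add_norm_sub halfTurn (Complex.exp (d * Complex.I))
    ⟨99982722383336059113 / 10 ^ 20, 1858823503388794372 / 10 ^ 20⟩
  have h7 := norm_sub_le_norm_sub_add_norm_sub (Complex.exp (d * Complex.I))
    ⟨1 - d ^ 2 / 2 + d ^ 4 / 24 - d ^ 6 / 720 + d ^ 8 / 40320,
        d - d ^ 3 / 6 + d ^ 5 / 120 - d ^ 7 / 5040 + d ^ 9 / 362880⟩
    ⟨99982722383336059113 / 10 ^ 20, 1858823503388794372 / 10 ^ 20⟩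
  linarith [h2.trans h3]

/-- If every row of the square matrix `A` differs from that of the identity matrix by at most a half
in the `ℓ¹` norm, then `A` has trivial kernel. -/
theorem Matrix.mulVec_injective_of_near_one {n : ℕ} (A : Matrix (Fin n) (Fin n) ℝ)
    (hA : ∀ i, ∑ k, |(1 : Matrix (Fin n) (Fin n) ℝ) i k - A i k| ≤ 1 / 2) (v : Fin n → ℝ)
    (hv : A.mulVec v = 0) : v = 0 := by
  have key : ∀ i, |v i| ≤ 1 / 2 * ‖v‖ := by
    intro i
    have h1 : v i = ∑ k, ((1 : Matrix (Fin n) (Fin n) ℝ) i k - A i k) * v k := by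
      have h2 : ∑ k, A i k * v k = 0 := congrFun hv i
      simp only [sub_mul, Finset.sum_sub_distrib, h2, sub_zero, Matrix.one_apply, ite_mul, one_mul,
        zero_mul, Finset.sum_ite_eq, Finset.mem_univ, if_true]
    calc |v i| ≤ ∑ k, |((1 : Matrix (Fin n) (Fin n) ℝ) i k - A i k) * v k| := by
          conv_lhs => rw [h1]
          exact Finset.abs_sum_le_sum_abs _ _
      _ ≤ ∑ k, |(1 : Matrix (Fin n) (Fin n) ℝ) i k - A i k| * ‖v‖ := by
          refine Finset.sum_le_sum fun k _ => ?_
          rw [abs_mul]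
          exact mul_le_mul_of_nonneg_left (norm_le_pi_norm v k) (abs_nonneg _)
      _ ≤ 1 / 2 * ‖v‖ := by
          rw [← Finset.sum_mul]
          exact mul_le_mul_of_nonneg_right (hA i) (norm_nonneg _)
  have h : ‖v‖ ≤ 1 / 2 * ‖v‖ := (pi_norm_le_iff_of_nonneg (by positivity)).2 key
  exact norm_eq_zero.1 (le_antisymm (by linarith) (norm_nonneg v))

/-- A simplified Newton iteration with a fixed approximate inverse `B` of the Jacobian matrix `J`. -/
theorem exists_zero_of_approximate_inverse {n : ℕ} (F : (Fin n → ℝ) → Fin n → ℝ)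
    (B J : Matrix (Fin n) (Fin n) ℝ) (x₀ : Fin n → ℝ) (r b e f : ℝ) (hr : 0 ≤ r)
    (hBJ : ∀ i, ∑ k, |(1 : Matrix (Fin n) (Fin n) ℝ) i k - (B * J) i k| ≤ 1 / 4)
    (hB : ∀ i, ∑ j, |B i j| ≤ b) (hbe : b * e ≤ 1 / 4) (hbf : b * f ≤ r / 2) (he : 0 ≤ e)
    (hF : ∀ x y, (∀ k, |x k - x₀ k| ≤ r) → (∀ k, |y k - x₀ k| ≤ r) →
      ∀ E, (∀ k, |x k - y k| ≤ E) → ∀ j, |F x j - F y j - ∑ k, J j k * (x k - y k)| ≤ e * E)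
    (h0 : ∀ j, |F x₀ j| ≤ f) :
    ∃ x, (∀ k, |x k - x₀ k| ≤ r) ∧ ∀ j, F x j = 0 := by
  set T : (Fin n → ℝ) → (Fin n → ℝ) := fun x => x - B.mulVec (F x) with hT
  have memball : ∀ x : Fin n → ℝ, x ∈ Metric.closedBall x₀ r ↔ ∀ k, |x k - x₀ k| ≤ r := by
    intro x
    rw [mem_closedBall_iff_norm, pi_norm_le_iff_of_nonneg hr]
    simp [Real.norm_eq_abs]
  have contr : ∀ x y, x ∈ Metric.closedBall x₀ r → y ∈ Metric.closedBall x₀ r →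
      ‖T x - T y‖ ≤ 1 / 2 * ‖x - y‖ := by
    intro x y hx hy
    refine (pi_norm_le_iff_of_nonneg (by positivity)).2 fun i => ?_
    have hE : ∀ k, |x k - y k| ≤ ‖x - y‖ := fun k => norm_le_pi_norm (x - y) k
    have h1 := hF x y ((memball x).1 hx) ((memball y).1 hy) _ hE
    have h2 : (T x - T y) i = ∑ k, ((1 : Matrix (Fin n) (Fin n) ℝ) i k - (B * J) i k) * (x k - y k)
        - ∑ j, B i j * (F x j - F y j - ∑ k, J j k * (x k - y k)) := by
      have h3 : ∑ k, (B * J) i k * (x k - y k) = ∑ j, B i j * ∑ k, J j k * (x k - y k) := by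
        simp only [Matrix.mul_apply, Finset.sum_mul, Finset.mul_sum]
        rw [Finset.sum_comm]
        exact Finset.sum_congr rfl fun _ _ => Finset.sum_congr rfl fun _ _ => by ring
      have h4 : ∑ k, (1 : Matrix (Fin n) (Fin n) ℝ) i k * (x k - y k) = x i - y i := by
        simp [Matrix.one_apply]
      simp only [sub_mul, mul_sub, Finset.sum_sub_distrib] at h3 h4 ⊢
      simp only [hT, Pi.sub_apply, Matrix.mulVec, dotProduct]
      linarith
    rw [h2, Real.norm_eq_abs]
    refine (abs_sub _ _).trans ?_
    have h5 : |∑ k, ((1 : Matrix (Fin n) (Fin n) ℝ) i k - (B * J) i k) * (x k - y k)| ≤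
        1 / 4 * ‖x - y‖ := by
      refine (Finset.abs_sum_le_sum_abs _ _).trans ?_
      refine le_trans ?_ (mul_le_mul_of_nonneg_right (hBJ i) (norm_nonneg _))
      rw [Finset.sum_mul]
      refine Finset.sum_le_sum fun k _ => ?_
      rw [abs_mul]
      exact mul_le_mul_of_nonneg_left (hE k) (abs_nonneg _)
    have h6 : |∑ j, B i j * (F x j - F y j - ∑ k, J j k * (x k - y k))| ≤ 1 / 4 * ‖x - y‖ := by
      refine (Finset.abs_sum_le_sum_abs _ _).trans ?_
      calc ∑ j, |B i j * (F x j - F y j - ∑ k, J j k * (x k - y k))|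
          ≤ ∑ j, |B i j| * (e * ‖x - y‖) := by
            refine Finset.sum_le_sum fun j _ => ?_
            rw [abs_mul]
            exact mul_le_mul_of_nonneg_left (h1 j) (abs_nonneg _)
        _ ≤ b * (e * ‖x - y‖) := by
            rw [← Finset.sum_mul]
            exact mul_le_mul_of_nonneg_right (hB i) (by positivity)
        _ ≤ 1 / 4 * ‖x - y‖ := by
            rw [← mul_assoc]
            exact mul_le_mul_of_nonneg_right hbe (norm_nonneg _)
    linarith
  have hx0 : x₀ ∈ Metric.closedBall x₀ r := Metric.mem_closedBall_self hr
  have hT0 : ‖T x₀ - x₀‖ ≤ r / 2 := by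
    refine (pi_norm_le_iff_of_nonneg (by positivity)).2 fun i => ?_
    have h1 : (T x₀ - x₀) i = -∑ j, B i j * F x₀ j := by
      simp [hT, Matrix.mulVec, dotProduct]
    rw [h1, norm_neg, Real.norm_eq_abs]
    refine (Finset.abs_sum_le_sum_abs _ _).trans ?_
    have hf : 0 ≤ f := (abs_nonneg _).trans (h0 i)
    calc ∑ j, |B i j * F x₀ j| ≤ ∑ j, |B i j| * f := by
          refine Finset.sum_le_sum fun j _ => ?_
          rw [abs_mul]
          exact mul_le_mul_of_nonneg_left (h0 j) (abs_nonneg _)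
      _ ≤ b * f := by
          rw [← Finset.sum_mul]
          exact mul_le_mul_of_nonneg_right (hB i) hf
      _ ≤ r / 2 := hbf
  have maps : Set.MapsTo T (Metric.closedBall x₀ r) (Metric.closedBall x₀ r) := by
    intro x hx
    rw [mem_closedBall_iff_norm] at hx ⊢
    have h1 := contr x x₀ (by rwa [mem_closedBall_iff_norm]) hx0
    have h2 : T x - x₀ = (T x - T x₀) + (T x₀ - x₀) := by abel
    rw [h2]
    refine (norm_add_le _ _).trans ?_
    linarith
  have hcontr : ContractingWith (1 / 2) (maps.restrict T _ _) := by
    refine ⟨by norm_num [← NNReal.coe_lt_coe], LipschitzWith.of_dist_le_mul fun x y => ?_⟩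
    have := contr x.1 y.1 x.2 y.2
    simpa [Subtype.dist_eq, dist_eq_norm] using this
  obtain ⟨x, hx, hfix, -⟩ := hcontr.exists_fixedPoint' Metric.isClosed_closedBall.isComplete maps
    hx0 (edist_ne_top _ _)
  refine ⟨x, (memball x).1 hx, ?_⟩
  have hBF : B.mulVec (F x) = 0 := by
    have h1 : x - B.mulVec (F x) = x := hfix
    exact sub_eq_self.1 h1
  have injBJ : Function.Injective (B * J).mulVec := by
    intro v w hvw
    have h1 : (B * J).mulVec (v - w) = 0 := by rw [Matrix.mulVec_sub, hvw, sub_self]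
    exact sub_eq_zero.1 (Matrix.mulVec_injective_of_near_one _
      (fun i => (hBJ i).trans (by norm_num)) _ h1)
  have unitBJ : IsUnit (B * J) := Matrix.mulVec_injective_iff_isUnit.1 injBJ
  have unitB : IsUnit B := by
    rw [Matrix.isUnit_iff_isUnit_det] at unitBJ ⊢
    rw [Matrix.det_mul] at unitBJ
    exact isUnit_of_mul_isUnit_left unitBJ
  have := Matrix.mulVec_injective_iff_isUnit.2 unitB (hBF.trans (Matrix.mulVec_zero B).symm)
  exact fun j => congrFun this j

/-- Approximate coordinates, in units of `10⁻²⁰`, of the vertices `0, …, 36` of `G₂`. -/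
def coordTable : List (ℤ × ℤ) :=
  [
    (10330458437550548398999, -50002738939140562275),
    (10417062559227367440058, -99999999949987169331), (10417059396543992323544, 0),
    (10243857478557104474453, 0), (10243854315873729357940, -99999999949987169331),
    (10243851153190354241427, 0), (10157250194196910316881, -50002738939140562275),
    (10070649235203466392336, 0), (10070646072520091275822, -99999999949987169331),
    (10070642909836716159309, 0), (9984041950843272234764, -50002738939140562275),
    (9897440991849828310218, 0), (9897437829166453193705, -99999999949987169331),
    (9897434666483078077191, 0), (9810833707489634152646, -50002738939140562275),
    (10318137919298290976881, -114625854280677417614),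
    (10380266600665257611386, -192984178354140939590),
    (10253139589065997445033, -190620703231206404544),
    (10219825284434224921516, -96333073571205619336),
    (10183029325872115092844, -189317251975359389595),
    (10120900644505148458340, -110958927901895867619),
    (10055902314272854926491, -186953776852424854549),
    (10022588009641082402975, -92666147192424069341),
    (9985792051078972574303, -185650325596577839600),
    (9923663369712005939799, -107292001523114317624),
    (9858665039479712407950, -183286850473643304553),
    (9825350734847939884434, -88999220813642519346),
    (9788554776285830055762, -181983399217796289605),
    (9726426094918863421257, -103625075144332767629),
    (9722191595840282283769, -3714770282654482899),
    (9673999482099810903508, -91336229830104784373),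
    (9622213129085284089527, -5789905295062312648),
    (9718901399165506954262, -180688442135259007451),
    (9619069154892054855362, -174898536840196694802),
    (9567282801877528041380, -89352212305154223077),
    (9519090688137056661119, -176973671852604524552), (9522380884811831990626, 0)]

/-- The vertex to which each of the 57 real parameters belongs, with the direction in which the
parameter moves it: `0` along the real axis, `1` along the imaginary axis, `2` along the lower
boundary of the sector. -/
def paramTable : List (ℕ × ℕ) :=
  [
    (0, 0), (0, 1), (1, 0), (1, 1), (2, 0), (3, 0), (4, 0), (4, 1), (5, 0), (6, 0), (6, 1),
    (7, 0), (8, 0), (8, 1), (9, 0), (10, 0), (10, 1), (11, 0), (12, 0), (12, 1), (13, 0),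
    (14, 0), (14, 1), (15, 0), (15, 1), (16, 2), (17, 2), (18, 0), (18, 1), (19, 2), (20, 0),
    (20, 1), (21, 2), (22, 0), (22, 1), (23, 2), (24, 0), (24, 1), (25, 2), (26, 0), (26, 1),
    (27, 2), (28, 0), (28, 1), (29, 0), (29, 1), (30, 0), (30, 1), (31, 0), (31, 1), (32, 2),
    (33, 0), (33, 1), (34, 0), (34, 1), (35, 2), (36, 0)]

/-- Approximate values of the parameters, in units of `10⁻²⁰`. -/
def paramValueTable : List ℤ :=
  [
    10330458437550548398999, -50002738939140562275, 10417062559227367440058,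
    -99999999949987169331, 10417059396543992323544, 10243857478557104474453,
    10243854315873729357940, -99999999949987169331, 10243851153190354241427,
    10157250194196910316881, -50002738939140562275, 10070649235203466392336,
    10070646072520091275822, -99999999949987169331, 10070642909836716159309,
    9984041950843272234764, -50002738939140562275, 9897440991849828310218,
    9897437829166453193705, -99999999949987169331, 9897434666483078077191,
    9810833707489634152646, -50002738939140562275, 10318137919298290976881,
    -114625854280677417614, 10382060373258368102608, 10254911393345766525754,
    10219825284434224921516, -96333073571205619336, 10184789014676101991877,
    10120900644505148458340, -110958927901895867619, 10057640034763500415023,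
    10022588009641082402975, -92666147192424069341, 9987517656093835881146,
    9923663369712005939799, -107292001523114317624, 9860368676181234304292,
    9825350734847939884434, -88999220813642519346, 9790246297511569770414,
    9726426094918863421257, -103625075144332767629, 9722191595840282283769,
    -3714770282654482899, 9673999482099810903508, -91336229830104784373,
    9622213129085284089527, -5789905295062312648, 9720580883868130006618,
    9619069154892054855362, -174898536840196694802, 9567282801877528041380,
    -89352212305154223077, 9520735644345273819896, 9522380884811831990626]

/-- The 57 edges in the lower half of `G₂`. -/
def halfEdgeTable : List (ℕ × ℕ) :=
  [
    (0, 1), (0, 2), (1, 2), (0, 3), (0, 4), (3, 4), (1, 15), (1, 16), (15, 16), (4, 5), (4, 6),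
    (5, 6), (6, 7), (6, 8), (7, 8), (8, 9), (8, 10), (9, 10), (10, 11), (10, 12), (11, 12),
    (12, 13), (12, 14), (13, 14), (14, 28), (14, 29), (28, 29), (15, 17), (15, 18), (17, 18),
    (18, 19), (18, 20), (19, 20), (20, 21), (20, 22), (21, 22), (22, 23), (22, 24), (23, 24),
    (24, 25), (24, 26), (25, 26), (26, 27), (26, 28), (27, 28), (29, 30), (29, 31), (30, 31),
    (30, 32), (30, 33), (32, 33), (31, 34), (31, 36), (34, 36), (33, 34), (33, 35), (34, 35)]

/-- An approximate inverse, in units of `10⁻³`, of the Jacobian matrix of the squared edge lengths. The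
entries of each row, increased by `5 * 10 ^ 7`, are the digits of a number in base `10 ^ 8`. -/
def inverseTable : List ℕ :=
  [
    500102754999521350008956500102674999538250008964500047804999104449989742499910525000494949989734500106484999334650019308499806135000710149989308500107704999326850019529499803925000718049989186500108924999318950019751499801715000725849989064500091024999956550000417500004054999955661096116389039235000036749999595500003674999959560038069399619705000032849999633500003284999963358980021500110145001997249993111410200175000028949999672500178715000000149999383,
    500000574999997350000050500000574999997450000050500000274999995049999943499999505000002849999943500001194999981850000215499998244999995749999903500000574999985750000104499999364999991749999965499999964999989749999993500000474999987850000026500000514999999850000129500001314999999153600419463994585000025449999869500002544999986956963988430358895000037749999746500003774999974660327557499999344999988149999937396723205000050049999623499998195000000050000123,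
    500102414999522850008927500102344999539750008935500047644999107349989775499910815000493349989767500105804999345250019184499807155000712649989364500107374999335050019469499804295000722749989207500108954999324950019755499801445000732949989049500090724999956750000342500003294999956159017489409826215000022049999671500002204999967156017555439825545000011049999780500001104999978053017621500110525002004149993147469824885000000149999890500176875000000149999890,
    500000005000000050000000500000005000000050000000500000005000000050000000500000005000000050000000500000005000000050000000500000005000000050000000500000005000000050000000500000005000000050000000500000005000000050000000500000005000000050000000500000005000000050000000500000005000000049999869500001315000000050000000500000005000000049999746500002545000000050000000500000005000000049999623500000005000000050000000500003775000000050000000499995005000000050000000,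
    500103084999519850008985500103004999536750008993500047954999101549989709499910235000496549989701500107174999324150019432499805125000707649989252500108034999318650019589499803555000713249989166500108904999313050019746499801985000718849989079500091314999956450000491500004814999955163174970368249975000051349999519500005134999951964059022359409455000054649999487500005464999948764943075500109775001990349993074350568935000057849999454500177675000057849999454,
    500102414999522850008927500102344999539750008935500047644999107349989775499910815000493349989767500105804999345250019184499807155000712649989364500107374999335050019469499804295000722749989207500108954999324950019755499801445000732949989049500090724999956750000342500003294999956159017261409828485000022049999671500002204999967156017115439829955000011049999780500001104999978053016968500110525002004149993147469831425000000149999312500179765000000149999312,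
    500103084999519850008985500103004999536750008992500047954999101549989709499910235000496549989701500107174999324150019432499805125000707649989252500108034999318650019589499803555000713249989166500108904999313050019746499801985000718849989079500091314999956450000491500004814999955163174743368252255000051349999519500005134999951964058582359413865000054649999487500005464999948764942421500109775001990349993074350578355000000149999454500177675000000149999454,
    500000005000000050000000500000005000000050000000500000005000000050000000500000005000000050000000500000005000000050000000500000005000000050000000500000005000000050000000500000005000000050000000500000005000000050000000500000005000000050000000500000005000000050000000500000005000000049999869500001315000000050000000500000005000000049999746500002545000000050000000500000005000000049999623500000005000000050000000499998775000000050000000500000005000000050000000,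
    500103744999516750009042500103664999533850009050500048264999095749989642499909655000499749989635500108544999303150019681499803095000702649989140500108704999302150019709499802815000703649989125500108854999301150019738499802525000704649989109500091904999956150000639500006334999954167332224326676025000080749999367500008074999936772100049278997775000098149999193500009814999919361058515500109015001976649993001389418885000000149999596500175585000000149999596,
    500103414999518250009013500103334999535250009021500048104999098649989676499909945000498149989668500107854999313650019557499804105000705149989196500108374999310350019649499803185000708449989145500108884999307050019742499802255000711749989094500091604999956350000565500005574999954665253369347465275000066049999443500006604999944368079095319208015000076349999340500004754999905163000719500109395001983549993037369997555000000149999525500176625000000149999525,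
    500000574999997350000050500000574999997450000050500000274999995049999943499999505000002849999943500001194999981850000215499998244999995749999903500000574999985750000104499999364999991749999965499999964999989749999993500000474999987850000026500000514999999850000129500001314999999153600419463994585000025449999869500002544999986956963988430358895000037749999746499998775000024646636250499999344999988149999937533636285000000050000123499998195000000050000123,
    500103084999519850008985500103004999536750008992500047954999101549989709499910235000496549989701500107174999324150019432499805125000707649989252500108034999318650019589499803555000713249989166500108904999313050019746499801985000718849989079500091314999956450000491500004814999955163174515368254535000051349999519500005134999951964058141359418265000054649998909500005464999890964942923500109775001990349993074350576225000000149999454500177675000000149999454,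
    500103744999516750009042500103664999533850009050500048264999095749989642499909655000499749989635500108544999303150019681499803095000702649989140500108704999302150019709499802815000703649989125500108854999301150019738499802525000704749989109500091904999956150000639500006334999954167331996326678305000080749999367500008074999936772099609279005065000040449999193500004044999919361058728500109015001976649993001389416765000000149999596500175585000000149999596,
    500000005000000050000000500000005000000050000000500000005000000050000000500000005000000050000000500000005000000050000000500000005000000050000000500000005000000050000000500000005000000050000000500000005000000050000000500000005000000050000000500000005000000050000000500000005000000049999869500001315000000050000000500000005000000049999746499997545000000050000000500000005000000050000123500000005000000050000000499998775000000050000000500000005000000050000000,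
    500104404999513650009100500104324999530850009108500048564999090049989576499909085000502849989569500109914999282150019930499801065000697749989029500109364999285650019829499802065000694149989084500108814999289250019729499803065000690549989139500092484999955850000788500007854999953171489477285102075000110149999215500011014999921564331716356685455000026249999477500002624999947757174532500108255001962949992928428257295000000149999738500173485000000149999738,
    500104074999515150009071500103994999532350009079500048414999092949989609499909365000501249989602500109234999292650019805499802075000700149989084500109034999293950019769499802435000698949989104500108834999295150019733499802795000697649989124500092194999956050000714500007094999953669410623305891325000095449999291500006654999900268216020317843135000033349999335500003334999933559116736500108635001969849992964408835965000000149999667500174535000000149999667,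
    500000574999997350000050500000574999997450000050500000274999995049999943499999505000002849999943500001194999981850000215499998244999995749999903500000574999985750000104499999364999991749999965499999964999989749999993500000474999987850000026500000514999999850000129500001314999999153600419463994585000025449999869499997545000036943272681567271974999987750000246499998775000024646636250499999344999988149999937533636285000000050000123499998195000000050000123,
    500103744999516750009042500103664999533850009050500048264999095749989642499909655000499749989635500108544999303150019681499803095000702649989140500108704999302150019709499802815000703649989125500108854999301150019738499802525000704749989109500091904999956150000639500006334999954167331768326680585000080749998790500008074999879072100323279000805000040449999193500004044999919361058940500109015001976649993001389414635000000149999596500175585000000149999596,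
    500104404999513650009100500104324999530850009108500048564999090049989576499909085000502849989569500109914999282150019930499801065000697749989029500109364999285650019829499802065000694149989084500108814999289250019729499803065000690549989139500092484999955850000788500007854999953171489250285107235000052349999215500005234999921564332142356681205000026249999477500002624999947757174745500108255001962949992928428255165000000149999738500173485000000149999738,
    500000005000000050000000500000005000000050000000500000005000000050000000500000005000000050000000500000005000000050000000500000005000000050000000500000005000000050000000500000005000000050000000500000005000000050000000500000005000000050000000500000005000000050000000500000005000000049999869499996315000000050000000500000005000000050000246499997545000000050000000500000005000000050000123500000005000000050000000499998775000000050000000500000005000000050000000,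
    500105064999510550009158500104994999527850009166500048874999084249989510499908505000506049989503500111284999261150020178499799035000692749988917500110024999269250019949499801325000684549989043500108764999277350019721499803615000676449989169500093074999955650000936500009374999952159837371401627495000024049999641500002404999964156563960434361595000012049999760500001204999976053290550500107505001949249992855467095705000000149999880500171395000000149999880,
    500104734999512050009129500104654999529350009137500048724999087149989543499908795000504449989536500110604999271650020054499800055000695249988973500109694999277450019889499801695000689349989063500108784999283350019725499803345000683549989154500092784999955750000862500005724999923865663774343364175000038249999428500003824999942860448264395519275000019149999618500001914999961855232754500107875001956049992891447674375000000149999809500172445000000149999809,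
    500000574999997350000050500000574999997450000050500000274999995049999943499999505000002849999943500001194999981850000215499998244999995749999903500000574999985750000104499999364999991749999965499999964999989749999993500000474999987850000026500000514999999850000129499996315000049139909111600907664999975450000369499997545000036943272681567271974999987750000246499998775000024646636250499999344999988149999937533636285000000050000123499998195000000050000123,
    500103214999519150008996500103134999536150009004500048014999100449989695499910115000497149989688500106624999340150019333499805655000718149989282500108214999329950019620499802775000728349989123500109794999319650019908499799905000738649988964500091434999956450000345500003324999955859087357409127545000022149999668500002214999966856064110439360015000011149999779500001114999977953040863500110545002004349992642469592475000000149999889500176165000000149999889,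
    499994635000025049999532499994635000024149999531499997505000046850000536500004684999974150000537499994455000034349998994500010114999962650000558499994375000034949998979500010264999962150000566499994295000035449998964500010414999961650000574499995245000002349999982499999835000002349527304504726904999998850000017499999885000001749684864503151304999999450000012499999945000001249842423499999914999998550000001501575715000000050000006499999835000000050000006,
    500107484999499250009369500107404999516950009377500050004999063149989269499906395000517749989261500111034999312850020133499797615000747849988838500112694999302150020433499794615000758549988673500114344999291550020732499791615000769249988507500095214999954550000359500003464999953959463311405368045000023149999654500002314999965456314619436854965000011649999769500001164999976953165928500115995001960649992808468341875000000149999884500172365000000149999884,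
    500099104999538350008638500099034999554650008646500046104999136249990106499913695000477349990098500102374999366450018563499813395000689549989708500103904999356550018839499810635000699349989556500105424999346750019116499807865000709249988617500087794999958150000331500003194999957558725836412742705000021349999681500002134999968155823221441768855000010749999787500001074999978752920605500112915002047349992478470795015000000149999893500179905000000149999893,
    500104204999514550009083500104134999531750009091500048474999091749989596499909255000501949989589500107644999333750019519499803785000725049989179500109254999323450019809499800885000735449989018500110854999313150020100499799035000691249988916500092314999955950000348500003354999955359174742408253705000022449999665500002244999966556122337438777755000011249999776500001124999977653069932500109975001994049992681469301805000000149999888500175275000000149999888,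
    499999975000000249999997499999975000000149999997499999985000000350000003500000034999999850000003499999975000000249999994500000064999999850000003499999975000000249999994500000064999999850000004499999965000000249999994500005744999980550000317499999975000000050000000500000005000000049996945500030555000000050000000500000005000000049997798500022025000000050000000500000005000000049998650499996874999943250000211500013505000000050000000499995035000000050000000,
    500109274999490950009524500109194999508950009533500050834999047549989090499904845000526349989082500112884999301350020468499794245000760349988652500114564999290550020772499791195000771149988484500116244999279750019651499804315000673849989208500096804999953850000365500003514999953259620591403795265000023449999649500002344999964956419419435806985000011849999766500001184999976653218247500107115001942149992878467818705000000149999882500170765000000149999882,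
    500105004999510850009152500104924999528150009160500048844999084849989517499908565000505749989509500108464999328750019667499802295000730649989096500110084999318350019960499799365000741049988935500110854999262650020100499799865000688549988962500093014999955650000351500003384999955059244610407555035000022549999662500002254999966256168891438312215000011349999775500001134999977553093173500109525001985849992712469069395000000149999887500174555000000149999887,
    499994605000025249999529499994605000024349999529499997495000047150000540500004714999974050000540499994425000034649998988500010184999962450000561499994335000035149998973500010334999961950000570499999964999999849999993500000094999999250000005499995215000002349999982499999835000002349524381504756134999998850000017499999885000001749682916503170784999999450000012499999945000001249841451499999934999998849999999501585435000000050000006499999865000000050000006,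
    500100894999530050008794500100814999546650008802500046934999120649989927499912145000485949989920500104224999354950018898499810025000702049989523500105774999344950019179499807215000712049988581500113294999245850020542499795485000703049988721500089374999957350000337500003244999956858883116411169925000021649999676500002164999967655928020440720875000010949999784500001094999978452972925500111895002028849992548470271835000000149999891500178295000000149999891,
    500105994999506250009239500105914999523650009247500049304999076149989418499907695000510549989410500109494999322350019853499800425000737549988993500111124999311850020149499798525000693549988888500110274999266650019994499800915000685049989020500093894999955250000354500003414999954659331994406681195000022749999659500002274999965956227118437729955000011449999773500001144999977353122242500108955001975549992751468778715000000149999886500173665000000149999886,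
    499999935000000349999994499999935000000349999994499999975000000650000007500000064999999750000007499999935000000449999988500000134999999550000007499999935000000449999987500005804999980350000320499996835000021349999426500005714999980650000315499999945000000050000000500000005000000049994021500059795000000050000000500000005000000049995850500041505000000050000000500000005000000049997678499996894999943650000210500023225000000050000000499995065000000050000000,
    500111064999482650009680500110984999500950009689500051664999031949988912499903285000534949988904500114734999289950020803499790875000772749988467500116434999278950019686499803945000675649989187500107334999286950019461499806195000667649989311500098384999953050000371500003574999952459777870402222485000023849999643500002384999964356524219434759005000011949999762500001194999976253270567500106095001923649992949467295525000000149999881500169155000000149999881,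
    500106784999502550009308500106714999520150009316500049674999069249989338499907005000514349989331500110314999317250020002499798925000743049988911500111114999261450020147499799375000690749988936500109804999269850019910499801745000682349989066500094594999954850000357500003434999954259401862405982525000022949999657500002294999965756273673437264415000011549999771500001154999977153145484500108505001967349992782468546305000000149999885500172955000000149999885,
    499994565000025349999526499994575000024449999526499997475000047450000543500004744999973850000543499994385000034849998981500010244999962250000565500000014999999450000002500000004999999550000000499999984999999649999997500000054999999350000003499995185000002349999982499999835000002349521457504785374999998850000017499999885000001749680968503190264999999450000012499999945000001249840478499999954999999149999998501595165000000050000006499999895000000050000006,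
    500102674999521650008950500102604999538550008957500047764999105049989749499910585000494549989741500106074999343550019233499806665000714449988551500113614999244250020600499794885000705649988688500112244999253050020352499797375000696749988825500090954999956650000343500003304999956059040396409597145000022049999670500002204999967056032820439672905000011049999780500001104999978053025244500110875002010349992619469748655000000149999890500176695000000149999890,
    500107784999497950009394500107704999515650009403500050144999060549989239499906145000519149989231500111344999310950020188499798115000695549988866500110514999265550020038499800455000687149988995500109224999273850019804499802795000678849989124500095474999954450000360500003474999953859489247405108685000023149999653500002314999965356331900436682155000011649999769500001164999976953174553500107935001957049992822468255635000000149999884500172055000000149999884,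
    499999905000000549999991499999905000000449999991499999955000000950000010500000094999999550000010499999905000000649999981500005864999980150000323499996805000021549999420500005774999980450000318499996855000021249999430500005674999980850000313499999915000000050000000500000005000000049991098500089025000000050000000500000005000000049993902500060985000000050000000500000005000000049996705499996914999943950000209500032955000000050000000499995095000000050000000,
    500112844999474250009836500112764999492850009845500052494999016449988733499901725000543549988725500116574999278550019711499803675000677049989172500107494999286350019491499805875000669249989294500106284999294150019271499808075000661449989415500099964999952350000377500003634999951659935150400649705000024249999637500002424999963756629018433711025000012149999758500001214999975853322886500105075001905149993019466772345000000149999879500167545000000149999879,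
    500108574999494250009464500108494999512050009472500050504999053649989160499905445000522949989152500111314999260650020184499798995000692549988914500110034999268850019952499801315000684349989042500108764999277050019720499803625000676149989170500096184999954150000363500003494999953559559115404410015000023349999651500002334999965156378455436216615000011749999767500001174999976753197794500107485001948849992853468023225000000149999883500171345000000149999883,
    499994535000025549999523499994535000024649999523499997465000047750000546500004764999973650000547500000064999999150000011499999914999999849999995500000034999999350000006499999964999999649999998500000004999999550000000500000024999999450000001499995155000002349999982499999825000002349518534504814614999998850000018499999885000001849679020503209744999999450000012499999945000001249839506499999974999999549999997501604885000000050000006499999925000000050000006,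
    500101424999527550008840500101344999544250008848500047184999116049989874499911685000488549989867500109984999281150019942499800965000697449989023500109394999284850019835499802025000693649989082500108814999288650019729499803095000689949989140500092514999899450000795500007644999898170933448290668065000051049999236500005104999923663961412360388435000025549999490500002554999949056989375500108225001962349992924430108795000000149999745500173395000000149999745,
    499994235000026949999497499994235000026049999496499997315000050350000577500005034999972250000577500000005000000050000001499999995000000050000000500000005000000050000001499999995000000050000000500000005000000050000001499999995000000050000000500000005000000050000000500000005000000050000612499993885000000050000000500000005000000050000408499995925000000050000000500000005000000050000204500000005000000150000000499997965000000050000000500000015000000050000000,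
    500095234999556350008543500097694999560650008286500046834999146849989950499917175000445649989702500111914999268550020291499797475000709649988831500111314999272350020183499798565000705849988890500110714999276250020075499799645000702049988950500094134999897750000809500007784999896371300202287000575000051949999222500005194999922264206016357942435000026049999481500002604999948157111829500110115001996649992800428884305000000149999740500176425000000149999740,
    499997635000011049999660499996245000016949999805499997515000033450000535500002014999995850000097499998945000006949999808500001914999993350000105499998955000006949999809500001904999993350000105499998955000006849999810500001894999993450000104499999115000001049999992499999935000001049798896502011024999999550000007499999955000000749865875501341224999999850000005499999985000000549932854499998964999981150000068500671435000000050000002499998335000000050000002,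
    500101274999528250008833500101264999544650008834500047174999116749989876499911695000438149989875500110024999280850019950499800885000697749989018500109444999284550019844499801945000693949989077500108854999288350019737499803015000690249989136500092554999899450000795500007654999898070942134290581215000051049999235500005104999923563967205360330505000025549999490500002554999949056992275500108265001963149992921430079795000000149999745500173465000000149999745,
    500001294999994049999835499998405000007250000137499997715000015150000491500004534999991350000202499997805000014449999602500003974999986150000219499997825000014349999604500003954999986250000218499997835000014249999606500003934999986250000217499998155000002049999984499999855000002049582136504178594999999050000015499999905000001549721308502786874999999550000010499999955000001049860481499997844999960850000141501395145000000050000005499996545000000050000005,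
    500096404999550950008892500101434999543850008365500049954999113149990354499916265000437849989881500109964999281250019938499800995000697349989025500109374999285050019832499802065000693549989084500108794999288750019726499803125000689749989142500092504999899450000795500007644999898170929820290704355000051049999236500005104999923663958992360412635000025549999490500002554999949056988164500108205001961949992925430120915000000149999745500173365000000149999745,
    500096314999551350008868500101174999545050008359500044914999112149990360499916335000438249989871500110074999280550019958499800805000698049989014500109484999284350019851499801865000694249989073500108894999288050019745499802935000690449989132500092594999899350000796500007654999898070950438290498165000051049999235500005104999923563972743360275125000025549999490500002554999949056995048500108315001963949992918430052075000000149999745500173535000000149999745,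
    499996925000014349999446499993955000027249999757499998764999996450000265500002565000000649999986500000154999999050000027499999735000001049999985500000154999999050000027499999735000001049999985500000154999999050000027499999735000000949999985500000134999999950000001500000014999999950028816499711845000000149999999500000014999999950019219499807825000000049999999500000004999999950009621500000155000002749999990499903795000000050000000500000245000000050000000,
    500102354999523250008695500104744999528950008433500045264999129449990287499915485000430749990044500108194999292850019617499804205000686149989202500107614999296550019512499805255000682349989260500107034999300250019408499806305000678649989317500091014999901150000782500007524999899870592370294078805000050249999248500005024999924863733932362663185000025149999498500002514999949856875494500106465001930349993039431247565000000149999749500170565000000149999749,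
    500000584999997349999926499996115000017549999803499998975000006850000221500002044999996150000091499999015000006549999821500001794999993750000099499999025000006449999822500001784999993850000098499999025000006449999823500001774999993850000098499999175000000949999993499999935000000949812056501879424999999550000007499999955000000749874652501253464999999850000005499999985000000549937248499999034999982450000064500627505000000050000002499998445000000050000002,
    500096304999501350008862500101104999545350008358500044914999111549990360499916345000438549989865500110134999280150019970499800685000698449989008500109544999283850019863499801755000694649989066500108964999287650019757499802815000690849989125500092644999899350000796500007664999897970962746290375095000051149999234500005114999923463980952360193035000025649999489500002564999948956999157500108375001965049992914430010985000000149999744500173635000000149999744,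
    500101204999528550008842500101354999494150008826500047304999115849989848499911425000438649989863500110154999279950019973499800655000698549989006500109564999283750019867499801715000694749989065500108984999287550019760499802785000690949989123500092664999899350000796500007664999897970966369290338865000051149999234500005114999923463983368360168875000025649999489500002564999948957000367500108395001965449992913429998885000000149999744500173665000000149999744]

/-- The approximate position of a vertex in the lower half of `G₂`, in units of `10⁻²⁰`. -/
def coord (a : ℕ) : ℤ × ℤ := coordTable.getD a (0, 0)

/-- The owner and the direction of a parameter. -/
def param (k : ℕ) : ℕ × ℕ := paramTable.getD k (0, 0)

/-- The ends of an edge in the lower half of `G₂`. -/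
def halfEdge (j : ℕ) : ℕ × ℕ := halfEdgeTable.getD j (0, 0)

/-- Approximations, in units of `10⁻²⁰`, to the directions in which parameters move vertices. -/
def approxDir (n : ℕ) : ℤ × ℤ :=
  match n with
  | 0 => (100000000000000000000, 0)
  | 1 => (0, 100000000000000000000)
  | _ => (99982722383336059113, -1858823503388794372)

/-- The directions in which parameters move vertices. -/
noncomputable def paramDir (n : ℕ) : ℂ :=
  match n with
  | 0 => 1
  | 1 => Complex.I
  | _ => (starRingEnd ℂ) halfTurn

/-- The Jacobian matrix of the squared edge lengths, in units of `10⁻⁴⁰`. -/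
def approxJacobian (j k : ℕ) : ℤ :=
  let e := halfEdge j
  let p := param k
  let g := approxDir p.2
  let c := 2 * ((coord e.1).1 - (coord e.2).1) * g.1 + 2 * ((coord e.1).2 - (coord e.2).2) * g.2
  (if p.1 = e.1 then c else 0) - (if p.1 = e.2 then c else 0)

/-- The entries of an approximate inverse of the Jacobian matrix, in units of `10⁻³`. -/
def approxInverse (i j : ℕ) : ℤ :=
  ((inverseTable.getD i 0 / 10 ^ (8 * j) % 100000000 : ℕ) : ℤ) - 50000000

set_option maxRecDepth 10000 in
theorem approxInverse_mul_approxJacobian : ∀ i : Fin 57,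
    ∑ k : Fin 57, |(if i = k then 10 ^ 43 else 0) -
      ∑ j : Fin 57, approxInverse i j * approxJacobian j k| ≤ 10 ^ 42 := by
  decide +kernel

theorem sum_abs_approxInverse : ∀ i : Fin 57, ∑ j : Fin 57, |approxInverse i j| ≤ 102 * 10 ^ 6 := by
  decide +kernel

theorem paramValue_approx : ∀ a : Fin 37,
    (|∑ k : Fin 57, (if (param k).1 = a then
      paramValueTable.getD k 0 * (approxDir (param k).2).1 else 0) - 10 ^ 20 * (coord a).1| ≤
        60 * 10 ^ 20) ∧
    |∑ k : Fin 57, (if (param k).1 = a then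
      paramValueTable.getD k 0 * (approxDir (param k).2).2 else 0) - 10 ^ 20 * (coord a).2| ≤
        60 * 10 ^ 20 := by
  decide +kernel

theorem abs_paramValue_le : ∀ k : Fin 57, |paramValueTable.getD k 0| ≤ 105 * 10 ^ 20 := by
  decide +kernel

theorem card_boundaryParam_le : ∀ a : Fin 37,
    (Finset.univ.filter fun k : Fin 57 => (param k).1 = a ∧ 2 ≤ (param k).2).card ≤ 1 := by
  decide +kernel

theorem card_param_le : ∀ a : Fin 37,
    (Finset.univ.filter fun k : Fin 57 => (param k).1 = a).card ≤ 2 := by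
  decide +kernel

theorem halfEdge_approx : ∀ j : Fin 57, (halfEdge j).1 < 37 ∧ (halfEdge j).2 < 37 ∧
    (halfEdge j).1 ≠ (halfEdge j).2 ∧
    |((coord (halfEdge j).1).1 - (coord (halfEdge j).2).1) ^ 2 +
      ((coord (halfEdge j).1).2 - (coord (halfEdge j).2).2) ^ 2 - 10 ^ 40| ≤ 5 * 10 ^ 20 := by
  decide +kernel

open Complex in
theorem norm_paramDir (n : ℕ) : ‖paramDir n‖ = 1 := by
  rcases n with _ | _ | n
  · simp [paramDir]
  · simp [paramDir]
  · show ‖(starRingEnd ℂ) halfTurn‖ = 1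
    rw [Complex.norm_conj, norm_halfTurn]

/-- The complex number with the given coordinates in units of `10⁻²⁰`. -/
noncomputable def ofCoord (z : ℤ × ℤ) : ℂ := ⟨z.1 / 10 ^ 20, z.2 / 10 ^ 20⟩

theorem norm_paramDir_sub_le (n : ℕ) : ‖paramDir n - ofCoord (approxDir n)‖ ≤ 3 / 10 ^ 20 := by
  rcases n with _ | _ | n
  · have h : paramDir 0 - ofCoord (approxDir 0) = 0 := by
      apply Complex.ext <;> norm_num [paramDir, approxDir, ofCoord]
    rw [h, norm_zero]; positivity
  · have h : paramDir 1 - ofCoord (approxDir 1) = 0 := by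
      apply Complex.ext <;> norm_num [paramDir, approxDir, ofCoord]
    rw [h, norm_zero]; positivity
  · have h : paramDir (n + 2) - ofCoord (approxDir (n + 2)) = (starRingEnd ℂ) (halfTurn -
        ⟨99982722383336059113 / 10 ^ 20, 1858823503388794372 / 10 ^ 20⟩) := by
      apply Complex.ext
      · simp [paramDir, approxDir, ofCoord]
      · simp [paramDir, approxDir, ofCoord]; ring
    rw [h, Complex.norm_conj]
    exact norm_halfTurn_sub_le

/-- The position of a vertex in the lower half of `G₂` as a function of the parameters. -/
noncomputable def paramPos (x : Fin 57 → ℝ) (a : ℕ) : ℂ :=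
  ∑ k : Fin 57, if (param k).1 = a then (x k : ℂ) * paramDir (param k).2 else 0

theorem norm_le_of_abs_le {z : ℂ} {b c : ℝ} (h1 : |z.re| ≤ b) (h2 : |z.im| ≤ c) : ‖z‖ ≤ b + c :=
  (Complex.norm_le_abs_re_add_abs_im z).trans (add_le_add h1 h2)

/-- The approximate values of the parameters. -/
noncomputable def approxParam (k : Fin 57) : ℝ := paramValueTable.getD k 0 / 10 ^ 20

theorem norm_paramPos_approxParam_sub_le (a : ℕ) (ha : a < 37) :
    ‖paramPos approxParam a - ofCoord (coord a)‖ ≤ 5 / 10 ^ 18 := by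
  obtain ⟨h1, h2⟩ := paramValue_approx ⟨a, ha⟩
  set s1 := ∑ k : Fin 57, (if (param k).1 = a then
      paramValueTable.getD k 0 * (approxDir (param k).2).1 else 0) with hs1
  set s2 := ∑ k : Fin 57, (if (param k).1 = a then
      paramValueTable.getD k 0 * (approxDir (param k).2).2 else 0) with hs2
  have e1 : ‖(⟨s1 / 10 ^ 40, s2 / 10 ^ 40⟩ : ℂ) - ofCoord (coord a)‖ ≤ 60 / 10 ^ 20 + 60 / 10 ^ 20 := by
    have h1' : |(s1 : ℝ) - 10 ^ 20 * (coord a).1| ≤ 60 * 10 ^ 20 := by exact_mod_cast h1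
    have h2' : |(s2 : ℝ) - 10 ^ 20 * (coord a).2| ≤ 60 * 10 ^ 20 := by exact_mod_cast h2
    rw [abs_le] at h1' h2'
    apply norm_le_of_abs_le <;> rw [abs_le] <;> simp only [ofCoord, Complex.sub_re, Complex.sub_im]
      <;> constructor <;> linarith [h1'.1, h1'.2, h2'.1, h2'.2]
  have e2 : paramPos approxParam a - (⟨s1 / 10 ^ 40, s2 / 10 ^ 40⟩ : ℂ) =
      ∑ k : Fin 57, if (param k).1 = a then
        (approxParam k : ℂ) * (paramDir (param k).2 - ofCoord (approxDir (param k).2)) else 0 := by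
    have h3 : (⟨s1 / 10 ^ 40, s2 / 10 ^ 40⟩ : ℂ) = ∑ k : Fin 57, if (param k).1 = a then
        (approxParam k : ℂ) * ofCoord (approxDir (param k).2) else 0 := by
      apply Complex.ext
      · simp only [Complex.re_sum, hs1]
        push_cast
        rw [Finset.sum_div]
        refine Finset.sum_congr rfl fun k _ => ?_
        split_ifs
        · rw [Complex.re_ofReal_mul]
          simp only [approxParam, ofCoord]
          ring
        · simp
      · simp only [Complex.im_sum, hs2]
        push_cast
        rw [Finset.sum_div]
        refine Finset.sum_congr rfl fun k _ => ?_
        split_ifs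
        · rw [Complex.im_ofReal_mul]
          simp only [approxParam, ofCoord]
          ring
        · simp
    rw [h3, paramPos, ← Finset.sum_sub_distrib]
    refine Finset.sum_congr rfl fun k _ => ?_
    split_ifs <;> ring
  have e3 : ‖paramPos approxParam a - (⟨s1 / 10 ^ 40, s2 / 10 ^ 40⟩ : ℂ)‖ ≤ 105 * (3 / 10 ^ 20) := by
    rw [e2]
    refine (norm_sum_le _ _).trans ?_
    have h4 : ∀ k : Fin 57, ‖if (param k).1 = a then
        (approxParam k : ℂ) * (paramDir (param k).2 - ofCoord (approxDir (param k).2)) else 0‖ ≤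
        if (param k).1 = a ∧ 2 ≤ (param k).2 then 105 * (3 / 10 ^ 20) else 0 := by
      intro k
      by_cases h5 : (param k).1 = a
      · by_cases h6 : 2 ≤ (param k).2
        · rw [if_pos h5, if_pos ⟨h5, h6⟩, norm_mul]
          refine mul_le_mul ?_ (norm_paramDir_sub_le _) (norm_nonneg _) (by norm_num)
          have h7 : |(paramValueTable.getD k 0 : ℝ)| ≤ 105 * 10 ^ 20 := by
            exact_mod_cast abs_paramValue_le k
          rw [Complex.norm_real, Real.norm_eq_abs, approxParam, abs_div]
          rw [div_le_iff₀ (by positivity)]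
          simpa using h7
        · rw [if_pos h5, if_neg (fun h => h6 h.2)]
          have h8 : paramDir (param k).2 - ofCoord (approxDir (param k).2) = 0 := by
            have : (param k).2 = 0 ∨ (param k).2 = 1 := by omega
            rcases this with h | h <;> rw [h] <;>
              apply Complex.ext <;> norm_num [paramDir, approxDir, ofCoord]
          rw [h8, mul_zero, norm_zero]
      · rw [if_neg h5, if_neg (fun h => h5 h.1), norm_zero]
    refine (Finset.sum_le_sum fun k _ => h4 k).trans ?_
    rw [← Finset.sum_filter, Finset.sum_const, nsmul_eq_mul]
    have h9 : ((Finset.univ.filter fun k : Fin 57 => (param k).1 = a ∧ 2 ≤ (param k).2).card : ℝ) ≤ 1 :=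
      by exact_mod_cast card_boundaryParam_le ⟨a, ha⟩
    nlinarith
  have := norm_sub_le_norm_sub_add_norm_sub (paramPos approxParam a)
    (⟨s1 / 10 ^ 40, s2 / 10 ^ 40⟩ : ℂ) (ofCoord (coord a))
  refine this.trans ((add_le_add e3 e1).trans ?_)
  norm_num

theorem norm_paramPos_sub_le (x y : Fin 57 → ℝ) (r : ℝ) (hr : 0 ≤ r) (h : ∀ k, |x k - y k| ≤ r)
    (a : ℕ) (ha : a < 37) : ‖paramPos x a - paramPos y a‖ ≤ 2 * r := by
  rw [paramPos, paramPos, ← Finset.sum_sub_distrib]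
  refine (norm_sum_le _ _).trans ?_
  have h4 : ∀ k : Fin 57, ‖(if (param k).1 = a then (x k : ℂ) * paramDir (param k).2 else 0) -
      (if (param k).1 = a then (y k : ℂ) * paramDir (param k).2 else 0)‖ ≤
      if (param k).1 = a then r else 0 := by
    intro k
    split_ifs
    · rw [← sub_mul, norm_mul, norm_paramDir, mul_one, ← Complex.ofReal_sub, Complex.norm_real]
      exact h k
    · simp
  refine (Finset.sum_le_sum fun k _ => h4 k).trans ?_
  rw [← Finset.sum_filter, Finset.sum_const, nsmul_eq_mul]
  have h9 : ((Finset.univ.filter fun k : Fin 57 => (param k).1 = a).card : ℝ) ≤ 2 := by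
    exact_mod_cast card_param_le ⟨a, ha⟩
  exact mul_le_mul_of_nonneg_right h9 hr

theorem paramPos_sub (x y : Fin 57 → ℝ) (a : ℕ) :
    paramPos x a - paramPos y a = paramPos (x - y) a := by
  rw [paramPos, paramPos, paramPos, ← Finset.sum_sub_distrib]
  refine Finset.sum_congr rfl fun k _ => ?_
  split_ifs
  · simp; ring
  · simp

/-- The vector along an edge in the lower half of `G₂` as a function of the parameters. -/
noncomputable def edgeVec (x : Fin 57 → ℝ) (j : Fin 57) : ℂ :=
  paramPos x (halfEdge j).1 - paramPos x (halfEdge j).2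

/-- The derivative of the vector along an edge with respect to a parameter. -/
noncomputable def edgeDeriv (j k : Fin 57) : ℂ :=
  (if (param k).1 = (halfEdge j).1 then paramDir (param k).2 else 0) -
    (if (param k).1 = (halfEdge j).2 then paramDir (param k).2 else 0)

theorem edgeVec_sub (x y : Fin 57 → ℝ) (j : Fin 57) :
    edgeVec x j - edgeVec y j = ∑ k, ((x k - y k : ℝ) : ℂ) * edgeDeriv j k := by
  have h : edgeVec x j - edgeVec y j = paramPos (x - y) (halfEdge j).1 -
      paramPos (x - y) (halfEdge j).2 := by
    rw [← paramPos_sub, ← paramPos_sub, edgeVec, edgeVec]; ring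
  rw [h, paramPos, paramPos, ← Finset.sum_sub_distrib]
  refine Finset.sum_congr rfl fun k _ => ?_
  rw [edgeDeriv, mul_sub, mul_ite, mul_ite, mul_zero, Pi.sub_apply]

theorem normSq_sub_normSq (z w : ℂ) :
    Complex.normSq z - Complex.normSq w = ((starRingEnd ℂ) (z + w) * (z - w)).re := by
  simp [Complex.normSq_apply]; ring

/-- The approximate vector along an edge. -/
noncomputable def approxEdgeVec (j : Fin 57) : ℂ :=
  ofCoord (coord (halfEdge j).1) - ofCoord (coord (halfEdge j).2)

theorem normSq_approxEdgeVec (j : Fin 57) :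
    |Complex.normSq (approxEdgeVec j) - 1| ≤ 5 / 10 ^ 20 := by
  have h := (halfEdge_approx j).2.2.2
  have h' : |(((coord (halfEdge j).1).1 : ℝ) - (coord (halfEdge j).2).1) ^ 2 +
      (((coord (halfEdge j).1).2 : ℝ) - (coord (halfEdge j).2).2) ^ 2 - 10 ^ 40| ≤ 5 * 10 ^ 20 := by
    exact_mod_cast h
  have e : Complex.normSq (approxEdgeVec j) - 1 =
      ((((coord (halfEdge j).1).1 : ℝ) - (coord (halfEdge j).2).1) ^ 2 +
      (((coord (halfEdge j).1).2 : ℝ) - (coord (halfEdge j).2).2) ^ 2 - 10 ^ 40) / 10 ^ 40 := by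
    simp only [approxEdgeVec, ofCoord, Complex.normSq_apply, Complex.sub_re, Complex.sub_im]
    ring
  rw [e, abs_div, abs_of_pos (show (0 : ℝ) < 10 ^ 40 by positivity), div_le_iff₀ (by positivity)]
  refine h'.trans (by norm_num)

theorem norm_approxEdgeVec_le (j : Fin 57) : ‖approxEdgeVec j‖ ≤ 1.01 := by
  have h := (abs_le.1 (normSq_approxEdgeVec j)).2
  rw [Complex.normSq_eq_norm_sq] at h
  by_contra hc
  push Not at hc
  nlinarith [norm_nonneg (approxEdgeVec j)]

theorem norm_edgeVec_sub_le (x : Fin 57 → ℝ) (r : ℝ) (hr : 0 ≤ r)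
    (h : ∀ k, |x k - approxParam k| ≤ r) (j : Fin 57) :
    ‖edgeVec x j - approxEdgeVec j‖ ≤ 4 * r + 1 / 10 ^ 17 := by
  obtain ⟨ha, hb, -⟩ := halfEdge_approx j
  have a1 := norm_paramPos_sub_le x approxParam r hr h _ ha
  have b1 := norm_paramPos_sub_le x approxParam r hr h _ hb
  have a2 := norm_paramPos_approxParam_sub_le _ ha
  have b2 := norm_paramPos_approxParam_sub_le _ hb
  have e : edgeVec x j - approxEdgeVec j =
      (paramPos x (halfEdge j).1 - paramPos approxParam (halfEdge j).1) +
      (paramPos approxParam (halfEdge j).1 - ofCoord (coord (halfEdge j).1)) -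
      (paramPos x (halfEdge j).2 - paramPos approxParam (halfEdge j).2) -
      (paramPos approxParam (halfEdge j).2 - ofCoord (coord (halfEdge j).2)) := by
    rw [edgeVec, approxEdgeVec]; ring
  rw [e]
  refine (norm_sub_le _ _).trans ?_
  have := norm_sub_le ((paramPos x (halfEdge j).1 - paramPos approxParam (halfEdge j).1) +
      (paramPos approxParam (halfEdge j).1 - ofCoord (coord (halfEdge j).1)))
      (paramPos x (halfEdge j).2 - paramPos approxParam (halfEdge j).2)
  have := norm_add_le (paramPos x (halfEdge j).1 - paramPos approxParam (halfEdge j).1)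
      (paramPos approxParam (halfEdge j).1 - ofCoord (coord (halfEdge j).1))
  linarith

/-- The approximate derivative of the vector along an edge. -/
noncomputable def approxEdgeDeriv (j k : Fin 57) : ℂ :=
  (if (param k).1 = (halfEdge j).1 then ofCoord (approxDir (param k).2) else 0) -
    (if (param k).1 = (halfEdge j).2 then ofCoord (approxDir (param k).2) else 0)

theorem norm_edgeDeriv_le (j k : Fin 57) : ‖edgeDeriv j k‖ ≤ 2 := by
  refine (norm_sub_le _ _).trans ?_
  have := norm_paramDir (param k).2
  split_ifs <;> norm_num [this]

theorem norm_edgeDeriv_sub_le (j k : Fin 57) :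
    ‖edgeDeriv j k - approxEdgeDeriv j k‖ ≤ 6 / 10 ^ 20 := by
  have h := norm_paramDir_sub_le (param k).2
  have e : edgeDeriv j k - approxEdgeDeriv j k =
      (if (param k).1 = (halfEdge j).1 then
        paramDir (param k).2 - ofCoord (approxDir (param k).2) else 0) -
      (if (param k).1 = (halfEdge j).2 then
        paramDir (param k).2 - ofCoord (approxDir (param k).2) else 0) := by
    rw [edgeDeriv, approxEdgeDeriv]
    split_ifs <;> ring
  rw [e]
  have h' : ∀ (p : Prop) [Decidable p], ‖if p then
      paramDir (param k).2 - ofCoord (approxDir (param k).2) else 0‖ ≤ 3 / 10 ^ 20 := by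
    intro p _
    split_ifs
    · exact h
    · rw [norm_zero]; positivity
  exact (norm_sub_le _ _).trans ((add_le_add (h' _) (h' _)).trans (by norm_num))

theorem approxJacobian_eq (j k : Fin 57) :
    (approxJacobian j k : ℝ) / 10 ^ 40 =
      ((starRingEnd ℂ) (2 * approxEdgeVec j) * approxEdgeDeriv j k).re := by
  simp only [approxJacobian, approxEdgeDeriv, approxEdgeVec]
  split_ifs <;> simp [ofCoord] <;> ring

theorem exists_unit_edges : ∃ x : Fin 57 → ℝ, (∀ k, |x k - approxParam k| ≤ 5 / 10 ^ 12) ∧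
    ∀ j, ‖edgeVec x j‖ = 1 := by
  suffices main : ∃ x : Fin 57 → ℝ, (∀ k, |x k - approxParam k| ≤ 5 / 10 ^ 12) ∧
      ∀ j, Complex.normSq (edgeVec x j) - 1 = 0 by
    obtain ⟨x, hx, h⟩ := main
    refine ⟨x, hx, fun j => ?_⟩
    have h1 := h j
    rw [Complex.normSq_eq_norm_sq, sub_eq_zero] at h1
    exact (pow_eq_one_iff_of_nonneg (norm_nonneg _) two_ne_zero).1 h1
  refine exists_zero_of_approximate_inverse
    (fun x j => Complex.normSq (edgeVec x j) - 1)
    (Matrix.of fun i j : Fin 57 => (approxInverse i j : ℝ) / 10 ^ 3)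
    (Matrix.of fun j k : Fin 57 => (approxJacobian j k : ℝ) / 10 ^ 40)
    approxParam (5 / 10 ^ 12) (102 * 10 ^ 3) (1 / 10 ^ 8) (22 / 10 ^ 18) (by positivity)
    ?_ ?_ (by norm_num) (by norm_num) (by positivity) ?_ ?_
  · intro i
    have h1 := approxInverse_mul_approxJacobian i
    have h2 : ∑ k : Fin 57, |(if i = k then (10 : ℝ) ^ 43 else 0) -
        ∑ j : Fin 57, (approxInverse i j : ℝ) * approxJacobian j k| ≤ 10 ^ 42 := by
      exact_mod_cast h1
    have h3 : ∀ k : Fin 57, |(1 : Matrix (Fin 57) (Fin 57) ℝ) i k -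
        ((Matrix.of fun i j : Fin 57 => (approxInverse i j : ℝ) / 10 ^ 3 :
            Matrix (Fin 57) (Fin 57) ℝ) *
          (Matrix.of fun j k : Fin 57 => (approxJacobian j k : ℝ) / 10 ^ 40 :
            Matrix (Fin 57) (Fin 57) ℝ)) i k| =
        |(if i = k then (10 : ℝ) ^ 43 else 0) -
          ∑ j : Fin 57, (approxInverse i j : ℝ) * approxJacobian j k| / 10 ^ 43 := by
      intro k
      rw [← abs_of_pos (show (0 : ℝ) < 10 ^ 43 by positivity), ← abs_div,
        abs_of_pos (show (0 : ℝ) < 10 ^ 43 by positivity)]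
      congr 1
      rw [Matrix.mul_apply, Matrix.one_apply, sub_div, Finset.sum_div]
      congr 1
      · split_ifs <;> simp
      · refine Finset.sum_congr rfl fun j _ => ?_
        simp only [Matrix.of_apply]
        ring
    rw [Finset.sum_congr rfl fun k _ => h3 k, ← Finset.sum_div, div_le_iff₀ (by positivity)]
    exact h2.trans (by norm_num)
  · intro i
    have h1 : ∑ j : Fin 57, |(approxInverse i j : ℝ)| ≤ 102 * 10 ^ 6 := by
      exact_mod_cast sum_abs_approxInverse i
    simp only [Matrix.of_apply, abs_div]
    rw [← Finset.sum_div, div_le_iff₀ (by positivity)]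
    refine h1.trans ?_
    rw [abs_of_pos (by positivity)]
    norm_num
  · intro x y hx hy E hE j
    have hE0 : 0 ≤ E := (abs_nonneg _).trans (hE 0)
    have h1 : Complex.normSq (edgeVec x j) - 1 - (Complex.normSq (edgeVec y j) - 1) -
        ∑ k, Matrix.of (fun j k : Fin 57 => (approxJacobian j k : ℝ) / 10 ^ 40) j k * (x k - y k) =
        ∑ k, (((starRingEnd ℂ) (edgeVec x j + edgeVec y j - 2 * approxEdgeVec j) *
          edgeDeriv j k).re + ((starRingEnd ℂ) (2 * approxEdgeVec j) *
          (edgeDeriv j k - approxEdgeDeriv j k)).re) * (x k - y k) := by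
      have h2 : Complex.normSq (edgeVec x j) - 1 - (Complex.normSq (edgeVec y j) - 1) =
          Complex.normSq (edgeVec x j) - Complex.normSq (edgeVec y j) := by ring
      rw [h2, normSq_sub_normSq, edgeVec_sub, Finset.mul_sum, Complex.re_sum,
        ← Finset.sum_sub_distrib]
      refine Finset.sum_congr rfl fun k _ => ?_
      rw [Matrix.of_apply, approxJacobian_eq, mul_left_comm, Complex.re_ofReal_mul]
      simp only [map_sub, sub_mul, mul_sub, Complex.sub_re]
      ring
    rw [h1]
    have hs : ‖edgeVec x j + edgeVec y j - 2 * approxEdgeVec j‖ ≤ 5 / 10 ^ 11 := by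
      have e : edgeVec x j + edgeVec y j - 2 * approxEdgeVec j =
          (edgeVec x j - approxEdgeVec j) + (edgeVec y j - approxEdgeVec j) := by ring
      rw [e]
      refine (norm_add_le _ _).trans ((add_le_add
        (norm_edgeVec_sub_le x _ (by positivity) hx j)
        (norm_edgeVec_sub_le y _ (by positivity) hy j)).trans ?_)
      norm_num
    have h3 : ∀ k, |(((starRingEnd ℂ) (edgeVec x j + edgeVec y j - 2 * approxEdgeVec j) *
          edgeDeriv j k).re + ((starRingEnd ℂ) (2 * approxEdgeVec j) *
          (edgeDeriv j k - approxEdgeDeriv j k)).re) * (x k - y k)| ≤ 11 / 10 ^ 11 * E := by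
      intro k
      rw [abs_mul]
      refine mul_le_mul ?_ (hE k) (abs_nonneg _) (by positivity)
      refine (abs_add_le _ _).trans ?_
      have n1 : |((starRingEnd ℂ) (edgeVec x j + edgeVec y j - 2 * approxEdgeVec j) *
          edgeDeriv j k).re| ≤ 5 / 10 ^ 11 * 2 := by
        refine (Complex.abs_re_le_norm _).trans ?_
        rw [norm_mul, Complex.norm_conj]
        exact mul_le_mul hs (norm_edgeDeriv_le j k) (norm_nonneg _) (by positivity)
      have n2 : |((starRingEnd ℂ) (2 * approxEdgeVec j) *
          (edgeDeriv j k - approxEdgeDeriv j k)).re| ≤ (2 * 1.01) * (6 / 10 ^ 20) := by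
        refine (Complex.abs_re_le_norm _).trans ?_
        rw [norm_mul, Complex.norm_conj, norm_mul, Complex.norm_ofNat]
        refine mul_le_mul ?_ (norm_edgeDeriv_sub_le j k) (norm_nonneg _) (by norm_num)
        exact mul_le_mul_of_nonneg_left (norm_approxEdgeVec_le j) (by norm_num)
      refine (add_le_add n1 n2).trans (by norm_num)
    refine (Finset.abs_sum_le_sum_abs _ _).trans ((Finset.sum_le_sum fun k _ => h3 k).trans ?_)
    rw [Finset.sum_const, Finset.card_univ, Fintype.card_fin, nsmul_eq_mul, ← mul_assoc]
    exact mul_le_mul_of_nonneg_right (by norm_num) hE0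
  · intro j
    have h1 := norm_edgeVec_sub_le approxParam 0 le_rfl (by simp) j
    have h2 := normSq_approxEdgeVec j
    have h3 := norm_approxEdgeVec_le j
    have h4 : |Complex.normSq (edgeVec approxParam j) - Complex.normSq (approxEdgeVec j)| ≤
        2.1 * (1 / 10 ^ 17) := by
      rw [normSq_sub_normSq]
      refine (Complex.abs_re_le_norm _).trans ?_
      rw [norm_mul, Complex.norm_conj]
      refine mul_le_mul ?_ (by linarith) (norm_nonneg _) (by norm_num)
      have e : edgeVec approxParam j + approxEdgeVec j =
        (edgeVec approxParam j - approxEdgeVec j) + (approxEdgeVec j + approxEdgeVec j) := by ring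
      rw [e]
      refine (norm_add_le _ _).trans ((add_le_add h1 (norm_add_le _ _)).trans ?_)
      norm_num at h3 ⊢
      linarith
    have e : Complex.normSq (edgeVec approxParam j) - 1 =
      (Complex.normSq (edgeVec approxParam j) - Complex.normSq (approxEdgeVec j)) +
        (Complex.normSq (approxEdgeVec j) - 1) := by ring
    show |Complex.normSq (edgeVec approxParam j) - 1| ≤ _
    rw [e]
    refine (abs_add_le _ _).trans ((add_le_add h4 h2).trans (by norm_num))

/-- The triangles of `G₂` as a list. -/
def triangleTable : List (Fin 66 × Fin 66 × Fin 66) :=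
  [(0, 1, 2), (0, 3, 4), (1, 15, 16), (2, 37, 38), (3, 37, 39), (4, 5, 6), (5, 39, 40),
    (6, 7, 8), (7, 40, 41), (8, 9, 10), (9, 41, 42), (10, 11, 12), (11, 42, 43), (12, 13, 14),
    (13, 43, 44), (14, 28, 29), (15, 17, 18), (18, 19, 20), (20, 21, 22), (22, 23, 24),
    (24, 25, 26), (26, 27, 28), (29, 30, 31), (30, 32, 33), (31, 34, 36), (33, 34, 35),
    (36, 61, 64), (38, 45, 46), (44, 58, 59), (45, 47, 48), (48, 49, 50), (50, 51, 52),
    (52, 53, 54), (54, 55, 56), (56, 57, 58), (59, 60, 61), (60, 62, 63), (63, 64, 65)]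

/-- The corners of a triangle of `G₂`. -/
def corner (i : Fin 38) (j : Fin 3) : Fin 66 :=
  let t := triangleTable.getD i (0, 0, 0)
  match j with
  | 0 => t.1
  | 1 => t.2.1
  | 2 => t.2.2

theorem G₂Triangles_eq : G₂Triangles =
    Finset.univ.image fun i : Fin 38 => Finset.univ.image (corner i) := by decide +kernel

theorem corner_injective : ∀ i, Function.Injective (corner i) := by decide +kernel

theorem adj_iff_corner (a b : Fin 66) :
    G₂.Adj a b ↔ ∃ i j k, j ≠ k ∧ corner i j = a ∧ corner i k = b := by
  constructor
  · rintro ⟨hne, t, ht, ha, hb⟩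
    rw [G₂Triangles_eq] at ht
    obtain ⟨i, -, rfl⟩ := Finset.mem_image.1 ht
    obtain ⟨j, -, rfl⟩ := Finset.mem_image.1 ha
    obtain ⟨k, -, rfl⟩ := Finset.mem_image.1 hb
    exact ⟨i, j, k, fun h => hne (by rw [h]), rfl, rfl⟩
  · rintro ⟨i, j, k, hjk, rfl, rfl⟩
    refine ⟨fun h => hjk (corner_injective i h), Finset.univ.image (corner i), ?_, ?_, ?_⟩
    · rw [G₂Triangles_eq]
      exact Finset.mem_image_of_mem _ (Finset.mem_univ i)
    · exact Finset.mem_image_of_mem _ (Finset.mem_univ j)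
    · exact Finset.mem_image_of_mem _ (Finset.mem_univ k)

/-- The reflection of `G₂` in its axis of symmetry, as a list of vertices. -/
def mirrorTable : List (Fin 66) :=
  [37, 38, 2, 3, 39, 5, 40, 7, 41, 9, 42, 11, 43, 13, 44, 45, 46, 47, 48, 49, 50, 51, 52, 53, 54,
    55, 56, 57, 58, 59, 60, 61, 62, 63, 64, 65, 36, 0, 1, 4, 6, 8, 10, 12, 14, 15, 16, 17, 18, 19,
    20, 21, 22, 23, 24, 25, 26, 27, 28, 29, 30, 31, 32, 33, 34, 35]

/-- The reflection of `G₂` in its axis of symmetry. -/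
def mirror (a : Fin 66) : Fin 66 := mirrorTable.getD a 0

theorem mirror_mirror : ∀ a, mirror (mirror a) = a := by decide +kernel

/-- The vertices of `G₂` on the lower boundary line of the sector. -/
def leftLabels : Finset (Fin 66) := {16, 17, 19, 21, 23, 25, 27, 32, 35}

/-- Values of the parameters for which all edges have length one. -/
noncomputable def sectorParam : Fin 57 → ℝ := exists_unit_edges.choose

/-- The position of a vertex of `G₂` in the sector about the positive real axis. -/
noncomputable def sectorPos (a : Fin 66) : ℂ :=
  if (a : ℕ) < 37 then paramPos sectorParam a else
    (starRingEnd ℂ) (paramPos sectorParam (mirror a))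

/-- The approximate position of a vertex of `G₂`, in units of `10⁻²⁰`. -/
def sectorCoord (a : Fin 66) : ℤ × ℤ :=
  if (a : ℕ) < 37 then coord a else ((coord (mirror a)).1, -(coord (mirror a)).2)

theorem mirror_lt_of_le : ∀ a : Fin 66, ¬ (a : ℕ) < 37 → (mirror a : ℕ) < 37 := by decide +kernel

theorem mirror_eq_of_lt : ∀ a : Fin 66, (a : ℕ) < 37 → (mirror a : ℕ) < 37 →
    mirror a = a ∧ ∀ k : Fin 57, (param k).1 = a → (param k).2 = 0 := by decide +kernel

theorem sectorPos_mirror (a : Fin 66) : sectorPos (mirror a) = (starRingEnd ℂ) (sectorPos a) := by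
  by_cases h : (a : ℕ) < 37
  · by_cases h' : (mirror a : ℕ) < 37
    · obtain ⟨h1, h2⟩ := mirror_eq_of_lt a h h'
      rw [h1, sectorPos, if_pos h, paramPos, map_sum]
      refine Finset.sum_congr rfl fun k _ => ?_
      split_ifs with hk
      · rw [h2 k hk]; simp [paramDir]
      · simp
    · rw [sectorPos, if_neg h', sectorPos, if_pos h, mirror_mirror]
  · have h' := mirror_lt_of_le a h
    rw [sectorPos, if_pos h', sectorPos, if_neg h, Complex.conj_conj]

theorem halfTurn_mul_conj : halfTurn * (starRingEnd ℂ) halfTurn = 1 := by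
  rw [Complex.mul_conj, Complex.normSq_eq_norm_sq, norm_halfTurn]; simp

theorem param_left : ∀ a ∈ leftLabels, (a : ℕ) < 37 ∧ ∀ k : Fin 57, (param k).1 = a →
    (param k).2 = 2 := by decide +kernel

theorem sectorPos_left (a : Fin 66) (ha : a ∈ leftLabels) :
    ∃ t : ℝ, sectorPos a = t * (starRingEnd ℂ) halfTurn := by
  obtain ⟨h1, h2⟩ := param_left a ha
  refine ⟨∑ k : Fin 57, if (param k).1 = a then sectorParam k else 0, ?_⟩
  rw [sectorPos, if_pos h1, paramPos, Complex.ofReal_sum, Finset.sum_mul]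
  refine Finset.sum_congr rfl fun k _ => ?_
  split_ifs with hk
  · rw [h2 k hk]; rfl
  · simp

/-- The generator of the group of rotations. -/
noncomputable def fullTurn : ℂ := halfTurn ^ 2

theorem fullTurn_mul_sectorPos (a : Fin 66) (ha : a ∈ leftLabels) :
    fullTurn * sectorPos a = sectorPos (mirror a) := by
  obtain ⟨t, ht⟩ := sectorPos_left a ha
  rw [sectorPos_mirror, ht, map_mul, Complex.conj_conj, Complex.conj_ofReal, fullTurn]
  linear_combination (t * halfTurn) * halfTurn_mul_conj

theorem exists_halfEdge_of_corner : ∀ (i : Fin 38) (j k : Fin 3), j ≠ k → ∃ l : Fin 57,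
    (((corner i j : ℕ), (corner i k : ℕ)) = halfEdge l ∨
      ((corner i k : ℕ), (corner i j : ℕ)) = halfEdge l) ∨
    ((mirror (corner i j) : ℕ), (mirror (corner i k) : ℕ)) = halfEdge l ∨
    ((mirror (corner i k) : ℕ), (mirror (corner i j) : ℕ)) = halfEdge l := by decide +kernel

theorem norm_sectorPos_sub_of_halfEdge (a b : Fin 66) (j : Fin 57)
    (h : ((a : ℕ), (b : ℕ)) = halfEdge j) : ‖sectorPos a - sectorPos b‖ = 1 := by
  have h1 : (halfEdge j).1 = a := by rw [← h]
  have h2 : (halfEdge j).2 = b := by rw [← h]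
  have h3 := halfEdge_approx j
  rw [h1, h2] at h3
  have h4 := exists_unit_edges.choose_spec.2 j
  rw [edgeVec, h1, h2] at h4
  rw [sectorPos, sectorPos, if_pos h3.1, if_pos h3.2.1]
  exact h4

theorem norm_sectorPos_sub (a b : Fin 66) (h : G₂.Adj a b) : ‖sectorPos a - sectorPos b‖ = 1 := by
  have hm : ∀ a b, ‖sectorPos (mirror a) - sectorPos (mirror b)‖ = ‖sectorPos a - sectorPos b‖ := by
    intro a b
    rw [sectorPos_mirror, sectorPos_mirror, ← map_sub, Complex.norm_conj]
  obtain ⟨i, j, k, hjk, rfl, rfl⟩ := (adj_iff_corner a b).1 h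
  obtain ⟨j, (hj | hj) | hj | hj⟩ := exists_halfEdge_of_corner i j k hjk
  · exact norm_sectorPos_sub_of_halfEdge _ _ j hj
  · rw [norm_sub_rev]; exact norm_sectorPos_sub_of_halfEdge _ _ j hj
  · rw [← hm]; exact norm_sectorPos_sub_of_halfEdge _ _ j hj
  · rw [← hm, norm_sub_rev]; exact norm_sectorPos_sub_of_halfEdge _ _ j hj

theorem norm_sectorPos_sub_sectorCoord (a : Fin 66) :
    ‖sectorPos a - ofCoord (sectorCoord a)‖ ≤ 11 / 10 ^ 12 := by
  have key : ∀ a : ℕ, a < 37 → ‖paramPos sectorParam a - ofCoord (coord a)‖ ≤ 11 / 10 ^ 12 := by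
    intro a ha
    have h1 := norm_paramPos_sub_le sectorParam approxParam _ (by positivity)
      exists_unit_edges.choose_spec.1 a ha
    have h2 := norm_paramPos_approxParam_sub_le a ha
    have h3 := norm_sub_le_norm_sub_add_norm_sub (paramPos sectorParam a)
      (paramPos approxParam a) (ofCoord (coord a))
    refine h3.trans ((add_le_add h1 h2).trans (by norm_num))
  rw [sectorPos, sectorCoord]
  split_ifs with h
  · exact key a h
  · have h1 := key _ (mirror_lt_of_le a h)
    rw [← Complex.norm_conj, map_sub, Complex.conj_conj]
    convert h1 using 2
    congr 1
    apply Complex.ext <;> simp [ofCoord]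
    ring

/-- The edges of `G₂`. -/
def sectorEdge (i : ℕ) : Fin 66 × Fin 66 :=
  let e := halfEdge (i % 57)
  let a : Fin 66 := Fin.ofNat 66 e.1
  let b : Fin 66 := Fin.ofNat 66 e.2
  if i < 57 then (a, b) else (mirror a, mirror b)

/-- Twice the signed area of a triangle. -/
def cross (p q r : ℤ × ℤ) : ℤ :=
  (q.1 - p.1) * (r.2 - p.2) - (q.2 - p.2) * (r.1 - p.1)

/-- The points `r` and `s` lie on the same side of the line through `p` and `q`, with a margin. -/
def sameSide (p q r s : ℤ × ℤ) : Bool :=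
  let c := cross p q r
  let d := cross p q s
  (decide (10000000000000000000000000000000 < c) && decide (10000000000000000000000000000000 < d)) ||
    (decide (c < -10000000000000000000000000000000) && decide (d < -10000000000000000000000000000000))

/-- The edges number `i` and `j` of `G₂` have a common end or are separated by the line through one
of them. -/
def edgesSeparated (i j : ℕ) : Bool :=
  let e := sectorEdge i
  let f := sectorEdge j
  (e.1 == f.1 || e.1 == f.2 || e.2 == f.1 || e.2 == f.2) ||
    sameSide (sectorCoord e.1) (sectorCoord e.2) (sectorCoord f.1) (sectorCoord f.2) ||
    sameSide (sectorCoord f.1) (sectorCoord f.2) (sectorCoord e.1) (sectorCoord e.2)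

set_option maxRecDepth 100000 in
theorem edgesSeparated_of_lt : ∀ i < 114, ∀ j < i, edgesSeparated i j = true := by
  decide +kernel

theorem exists_sectorEdge_of_corner : ∀ (i : Fin 38) (j k : Fin 3), j ≠ k → ∃ l : Fin 114,
    sectorEdge l = (corner i j, corner i k) ∨ sectorEdge l = (corner i k, corner i j) := by
  decide +kernel

theorem exists_sectorEdge_of_adj {a b : Fin 66} (h : G₂.Adj a b) : ∃ l < 114,
    sectorEdge l = (a, b) ∨ sectorEdge l = (b, a) := by
  obtain ⟨i, j, k, hjk, rfl, rfl⟩ := (adj_iff_corner a b).1 h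
  obtain ⟨l, hl⟩ := exists_sectorEdge_of_corner i j k hjk
  exact ⟨l, l.2, hl⟩

theorem sectorCoord_bounds : ∀ a : Fin 66,
    (95 * 10 ^ 20 ≤ (sectorCoord a).1 ∧ (sectorCoord a).1 ≤ 105 * 10 ^ 20) ∧
    (-2 * 10 ^ 20 ≤ (sectorCoord a).2 ∧ (sectorCoord a).2 ≤ 2 * 10 ^ 20) := by decide +kernel

theorem sectorCoord_separated : ∀ a b : Fin 66, a < b →
    10 ^ 10 < |(sectorCoord a).1 - (sectorCoord b).1| ∨
    10 ^ 10 < |(sectorCoord a).2 - (sectorCoord b).2| := by decide +kernel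

theorem norm_ofCoord_sub_le (a b : Fin 66) :
    ‖ofCoord (sectorCoord a) - ofCoord (sectorCoord b)‖ ≤ 14 := by
  obtain ⟨⟨a1, a2⟩, a3, a4⟩ := sectorCoord_bounds a
  obtain ⟨⟨b1, b2⟩, b3, b4⟩ := sectorCoord_bounds b
  have a1' : (95 * 10 ^ 20 : ℝ) ≤ (sectorCoord a).1 := by exact_mod_cast a1
  have a2' : ((sectorCoord a).1 : ℝ) ≤ 105 * 10 ^ 20 := by exact_mod_cast a2
  have a3' : (-2 * 10 ^ 20 : ℝ) ≤ (sectorCoord a).2 := by exact_mod_cast a3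
  have a4' : ((sectorCoord a).2 : ℝ) ≤ 2 * 10 ^ 20 := by exact_mod_cast a4
  have b1' : (95 * 10 ^ 20 : ℝ) ≤ (sectorCoord b).1 := by exact_mod_cast b1
  have b2' : ((sectorCoord b).1 : ℝ) ≤ 105 * 10 ^ 20 := by exact_mod_cast b2
  have b3' : (-2 * 10 ^ 20 : ℝ) ≤ (sectorCoord b).2 := by exact_mod_cast b3
  have b4' : ((sectorCoord b).2 : ℝ) ≤ 2 * 10 ^ 20 := by exact_mod_cast b4
  refine (norm_le_of_abs_le (b := 10) (c := 4) ?_ ?_).trans (by norm_num) <;>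
    simp only [ofCoord, Complex.sub_re, Complex.sub_im] <;> rw [abs_le] <;> constructor <;> linarith

theorem norm_sub_sub_ofCoord_le (a b : Fin 66) :
    ‖(sectorPos a - sectorPos b) - (ofCoord (sectorCoord a) - ofCoord (sectorCoord b))‖ ≤
      22 / 10 ^ 12 := by
  have e : (sectorPos a - sectorPos b) - (ofCoord (sectorCoord a) - ofCoord (sectorCoord b)) =
      (sectorPos a - ofCoord (sectorCoord a)) - (sectorPos b - ofCoord (sectorCoord b)) := by ring
  rw [e]
  refine (norm_sub_le _ _).trans ((add_le_add (norm_sectorPos_sub_sectorCoord a)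
    (norm_sectorPos_sub_sectorCoord b)).trans (by norm_num))

theorem sectorPos_injective : Function.Injective sectorPos := by
  have key : ∀ a b, a < b → sectorPos a ≠ sectorPos b := by
    intro a b hab h
    have h1 := norm_sub_sub_ofCoord_le a b
    rw [h, sub_self, zero_sub, norm_neg] at h1
    have h2 := (Complex.abs_re_le_norm _).trans h1
    have h3 := (Complex.abs_im_le_norm _).trans h1
    simp only [ofCoord, Complex.sub_re, Complex.sub_im] at h2 h3
    rw [← sub_div, abs_div, div_le_iff₀ (by positivity)] at h2 h3
    rw [abs_of_pos (show (0 : ℝ) < 10 ^ 20 by positivity)] at h2 h3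
    rcases sectorCoord_separated a b hab with h4 | h4
    · have h4' : (10 : ℝ) ^ 10 < |((sectorCoord a).1 : ℝ) - (sectorCoord b).1| := by exact_mod_cast h4
      norm_num at h2 h4'
      linarith
    · have h4' : (10 : ℝ) ^ 10 < |((sectorCoord a).2 : ℝ) - (sectorCoord b).2| := by exact_mod_cast h4
      norm_num at h3 h4'
      linarith
  intro a b h
  rcases lt_trichotomy a b with h1 | h1 | h1
  · exact absurd h (key a b h1)
  · exact h1
  · exact absurd h.symm (key b a h1)

/-- Twice the signed area of a triangle in the plane. -/
noncomputable def crossProd (p q r : ℂ) : ℝ := ((starRingEnd ℂ) (q - p) * (r - p)).im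

theorem norm_conj_mul_sub_le (z w z₀ w₀ : ℂ) {e m : ℝ} (hz : ‖z - z₀‖ ≤ e) (hw : ‖w - w₀‖ ≤ e)
    (hz₀ : ‖z₀‖ ≤ m) (hw₀ : ‖w₀‖ ≤ m) :
    ‖(starRingEnd ℂ) z * w - (starRingEnd ℂ) z₀ * w₀‖ ≤ e * (m + e) + m * e := by
  have he : 0 ≤ e := (norm_nonneg _).trans hz
  have hw' : ‖w‖ ≤ m + e := by
    have : w = w₀ + (w - w₀) := by ring
    rw [this]
    exact (norm_add_le _ _).trans (add_le_add hw₀ hw)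
  have e1 : (starRingEnd ℂ) z * w - (starRingEnd ℂ) z₀ * w₀ =
      (starRingEnd ℂ) (z - z₀) * w + (starRingEnd ℂ) z₀ * (w - w₀) := by
    rw [map_sub]; ring
  rw [e1]
  refine (norm_add_le _ _).trans (add_le_add ?_ ?_)
  · rw [norm_mul, Complex.norm_conj]
    exact mul_le_mul hz hw' (norm_nonneg _) he
  · rw [norm_mul, Complex.norm_conj]
    exact mul_le_mul hz₀ hw (norm_nonneg _) ((norm_nonneg _).trans hz₀)

theorem abs_crossProd_sub_le (a b c : Fin 66) :
    |crossProd (sectorPos a) (sectorPos b) (sectorPos c) -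
      cross (sectorCoord a) (sectorCoord b) (sectorCoord c) / 10 ^ 40| ≤ 1 / 10 ^ 9 := by
  have h := norm_conj_mul_sub_le _ _ _ _ (norm_sub_sub_ofCoord_le b a)
    (norm_sub_sub_ofCoord_le c a) (norm_ofCoord_sub_le b a) (norm_ofCoord_sub_le c a)
  have h1 := (Complex.abs_im_le_norm _).trans h
  rw [Complex.sub_im] at h1
  have e : ((starRingEnd ℂ) (ofCoord (sectorCoord b) - ofCoord (sectorCoord a)) *
      (ofCoord (sectorCoord c) - ofCoord (sectorCoord a))).im =
      (cross (sectorCoord a) (sectorCoord b) (sectorCoord c) : ℝ) / 10 ^ 40 := by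
    simp [ofCoord, cross]
    ring
  rw [e] at h1
  exact h1.trans (by norm_num)

theorem crossProd_eq_zero_of_mem_segment {p q z : ℂ} (hz : z ∈ segment ℝ p q) :
    crossProd p q z = 0 := by
  obtain ⟨s, t, -, -, hst, rfl⟩ := hz
  have hs : s = 1 - t := by linarith
  have : s • p + t • q - p = (t : ℂ) * (q - p) := by
    rw [hs]; simp; ring
  rw [crossProd, this, mul_left_comm, ← Complex.normSq_eq_conj_mul_self]
  simp

theorem crossProd_convex (p q r s : ℂ) (a b : ℝ) (hab : a + b = 1) :
    crossProd p q (a • r + b • s) = a * crossProd p q r + b * crossProd p q s := by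
  have ha : a = 1 - b := by linarith
  simp only [crossProd, ha]
  simp
  ring

theorem not_mem_segment_of_crossProd {p q r s z : ℂ}
    (h : 0 < crossProd p q r ∧ 0 < crossProd p q s ∨ crossProd p q r < 0 ∧ crossProd p q s < 0)
    (hz : z ∈ segment ℝ p q) : z ∉ segment ℝ r s := by
  rintro ⟨a, b, ha, hb, hab, rfl⟩
  have h0 := crossProd_eq_zero_of_mem_segment hz
  rw [crossProd_convex _ _ _ _ _ _ hab] at h0
  rcases h with ⟨h1, h2⟩ | ⟨h1, h2⟩
  · rcases ha.eq_or_lt with rfl | ha'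
    · have : b = 1 := by linarith
      subst this; linarith
    · nlinarith [mul_pos ha' h1, mul_nonneg hb h2.le]
  · rcases ha.eq_or_lt with rfl | ha'
    · have : b = 1 := by linarith
      subst this; linarith
    · nlinarith [mul_pos ha' (neg_pos.2 h1), mul_nonneg hb (neg_pos.2 h2).le]

theorem not_mem_segment_of_sameSide {a b c d : Fin 66} {z : ℂ}
    (h : sameSide (sectorCoord a) (sectorCoord b) (sectorCoord c) (sectorCoord d) = true)
    (hz : z ∈ segment ℝ (sectorPos a) (sectorPos b)) :
    z ∉ segment ℝ (sectorPos c) (sectorPos d) := by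
  refine not_mem_segment_of_crossProd ?_ hz
  have h1 := abs_le.1 (abs_crossProd_sub_le a b c)
  have h2 := abs_le.1 (abs_crossProd_sub_le a b d)
  simp only [sameSide, Bool.or_eq_true, Bool.and_eq_true, decide_eq_true_eq] at h
  rcases h with ⟨h3, h4⟩ | ⟨h3, h4⟩
  · left
    have h3' : (10000000000000000000000000000000 : ℝ) <
      cross (sectorCoord a) (sectorCoord b) (sectorCoord c) := by exact_mod_cast h3
    have h4' : (10000000000000000000000000000000 : ℝ) <
      cross (sectorCoord a) (sectorCoord b) (sectorCoord d) := by exact_mod_cast h4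
    constructor <;> linarith [h1.1, h2.1]
  · right
    have h3' : (cross (sectorCoord a) (sectorCoord b) (sectorCoord c) : ℝ) <
      -10000000000000000000000000000000 := by exact_mod_cast h3
    have h4' : (cross (sectorCoord a) (sectorCoord b) (sectorCoord d) : ℝ) <
      -10000000000000000000000000000000 := by exact_mod_cast h4
    constructor <;> linarith [h1.2, h2.2]

/-- Two segments of length one with a common end have no other common point. -/
theorem eq_of_mem_segment_of_mem_segment {x a b z : ℂ} (ha : ‖x - a‖ = 1) (hb : ‖x - b‖ = 1)
    (hab : a ≠ b) (hza : z ∈ segment ℝ x a) (hzb : z ∈ segment ℝ x b) : z = x := by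
  obtain ⟨s, t, hs, ht, hst, rfl⟩ := hza
  obtain ⟨s', t', hs', ht', hst', h⟩ := hzb
  have e1 : s • x + t • a = x + (t : ℂ) * (a - x) := by
    have : s = 1 - t := by linarith
    rw [this]; simp; ring
  have e2 : s' • x + t' • b = x + (t' : ℂ) * (b - x) := by
    have : s' = 1 - t' := by linarith
    rw [this]; simp; ring
  rw [e1, e2, add_right_inj] at h
  have h1 := congrArg norm h
  rw [norm_mul, norm_mul, norm_sub_rev, hb, norm_sub_rev, ha, mul_one, mul_one, Complex.norm_real,
    Complex.norm_real, Real.norm_of_nonneg ht, Real.norm_of_nonneg ht'] at h1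
  subst h1
  rw [e1]
  by_cases h0 : t' = 0
  · simp [h0]
  · exact absurd (by simpa [h0] using h.symm) hab

theorem common_end_of_edgesSeparated {i j : ℕ} (h : edgesSeparated i j = true) {z : ℂ}
    (h1 : z ∈ segment ℝ (sectorPos (sectorEdge i).1) (sectorPos (sectorEdge i).2))
    (h2 : z ∈ segment ℝ (sectorPos (sectorEdge j).1) (sectorPos (sectorEdge j).2)) :
    ((sectorEdge i).1 = (sectorEdge j).1 ∨ (sectorEdge i).1 = (sectorEdge j).2) ∨
      (sectorEdge i).2 = (sectorEdge j).1 ∨ (sectorEdge i).2 = (sectorEdge j).2 := by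
  rw [edgesSeparated, Bool.or_eq_true, Bool.or_eq_true] at h
  rcases h with (h | h) | h
  · simpa [or_assoc] using h
  · exact absurd h2 (not_mem_segment_of_sameSide h h1)
  · exact absurd h1 (not_mem_segment_of_sameSide h h2)

theorem sector_edge_inter {a b c d : Fin 66} (hab : G₂.Adj a b) (hcd : G₂.Adj c d)
    (hne : s(a, b) ≠ s(c, d)) {z : ℂ} (h1 : z ∈ segment ℝ (sectorPos a) (sectorPos b))
    (h2 : z ∈ segment ℝ (sectorPos c) (sectorPos d)) :
    ∃ v, v ∈ s(a, b) ∧ v ∈ s(c, d) ∧ sectorPos v = z := by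
  have shared : ∀ a b d : Fin 66, G₂.Adj a b → G₂.Adj a d → b ≠ d →
      z ∈ segment ℝ (sectorPos a) (sectorPos b) → z ∈ segment ℝ (sectorPos a) (sectorPos d) →
      sectorPos a = z := fun a b d hab had hbd h1 h2 =>
    (eq_of_mem_segment_of_mem_segment (norm_sectorPos_sub a b hab) (norm_sectorPos_sub a d had)
      (fun h => hbd (sectorPos_injective h)) h1 h2).symm
  by_cases hac : a = c
  · subst hac
    exact ⟨a, by simp, by simp, shared a b d hab hcd (fun h => hne (by rw [h])) h1 h2⟩
  by_cases had : a = d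
  · subst had
    rw [segment_symm] at h2
    exact ⟨a, by simp, by simp, shared a b c hab hcd.symm (fun h => hne (by rw [h, Sym2.eq_swap])) h1 h2⟩
  by_cases hbc : b = c
  · subst hbc
    rw [segment_symm] at h1
    exact ⟨b, by simp, by simp, shared b a d hab.symm hcd (fun h => hne (by rw [h, Sym2.eq_swap])) h1 h2⟩
  by_cases hbd : b = d
  · subst hbd
    rw [segment_symm] at h1 h2
    exact ⟨b, by simp, by simp, shared b a c hab.symm hcd.symm (fun h => hne (by rw [h])) h1 h2⟩
  exfalso
  obtain ⟨i, hi, hi'⟩ := exists_sectorEdge_of_adj hab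
  obtain ⟨j, hj, hj'⟩ := exists_sectorEdge_of_adj hcd
  have key : edgesSeparated i j = true ∨ edgesSeparated j i = true := by
    rcases lt_trichotomy i j with h | h | h
    · exact Or.inr (edgesSeparated_of_lt j hj i h)
    · subst h
      exfalso
      rcases hi' with h | h <;> rcases hj' with h' | h' <;> rw [h] at h' <;> simp_all
    · exact Or.inl (edgesSeparated_of_lt i hi j h)
  have g1 : z ∈ segment ℝ (sectorPos (sectorEdge i).1) (sectorPos (sectorEdge i).2) := by
    rcases hi' with h | h <;> rw [h]
    · exact h1
    · rwa [segment_symm]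
  have g2 : z ∈ segment ℝ (sectorPos (sectorEdge j).1) (sectorPos (sectorEdge j).2) := by
    rcases hj' with h | h <;> rw [h]
    · exact h2
    · rwa [segment_symm]
  have g3 := key.imp (fun k => common_end_of_edgesSeparated k g1 g2)
    fun k => common_end_of_edgesSeparated k g2 g1
  rcases hi' with h | h <;> rcases hj' with h' | h' <;> rw [h, h'] at g3 <;> grind

theorem fullTurn_eq_exp : fullTurn = Complex.exp (2 * Real.pi * Complex.I / 169) := by
  rw [fullTurn, halfTurn, ← Complex.exp_nat_mul]
  congr 1
  push_cast
  ring

theorem fullTurn_pow : fullTurn ^ 169 = 1 := by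
  rw [fullTurn_eq_exp, ← Complex.exp_nat_mul]
  convert Complex.exp_two_pi_mul_I using 2
  push_cast
  ring

theorem norm_fullTurn : ‖fullTurn‖ = 1 := by rw [fullTurn, norm_pow, norm_halfTurn, one_pow]

/-- The rotations that carry the ring to itself. -/
noncomputable def turn (k : ZMod 169) : ℂ := fullTurn ^ k.val

theorem turn_natCast (n : ℕ) : turn n = fullTurn ^ n := by
  rw [turn, ZMod.val_natCast, ← pow_mod_orderOf fullTurn n, ← pow_mod_orderOf fullTurn (n % 169),
    Nat.mod_mod_of_dvd n (orderOf_dvd_of_pow_eq_one fullTurn_pow)]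

theorem turn_zero : turn 0 = 1 := by simp [turn]

theorem turn_one : turn 1 = fullTurn := by
  have := turn_natCast 1
  simpa using this

theorem turn_add (k l : ZMod 169) : turn (k + l) = turn k * turn l := by
  have h : k + l = ((k.val + l.val : ℕ) : ZMod 169) := by simp
  rw [h, turn_natCast, pow_add, turn, turn]

theorem norm_turn (k : ZMod 169) : ‖turn k‖ = 1 := by rw [turn, norm_pow, norm_fullTurn, one_pow]

theorem turn_ne_zero (k : ZMod 169) : turn k ≠ 0 := by
  intro h
  have := norm_turn k
  simp [h] at this

/-- The distance from the lower boundary line of the sector about the positive real axis. -/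
noncomputable def lowerDist (z : ℂ) : ℝ := (z * halfTurn).im

/-- The distance from the upper boundary line of the sector about the positive real axis. -/
noncomputable def upperDist (z : ℂ) : ℝ := -(z * (starRingEnd ℂ) halfTurn).im

theorem upperDist_eq (z : ℂ) : upperDist z = lowerDist ((starRingEnd ℂ) z) := by
  simp [upperDist, lowerDist]
  ring

/-- The closed sector about the positive real axis, without its apex. -/
def sector : Set ℂ := {z | 0 < z.re ∧ 0 ≤ lowerDist z ∧ 0 ≤ upperDist z}

theorem lowerDist_convex (z w : ℂ) (s t : ℝ) :
    lowerDist (s • z + t • w) = s * lowerDist z + t * lowerDist w := by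
  simp [lowerDist]; ring

theorem upperDist_convex (z w : ℂ) (s t : ℝ) :
    upperDist (s • z + t • w) = s * upperDist z + t * upperDist w := by
  simp [upperDist]; ring

theorem segment_subset_sector {z w v : ℂ} (hz : z ∈ sector) (hw : w ∈ sector)
    (hv : v ∈ segment ℝ z w) : v ∈ sector := by
  obtain ⟨s, t, hs, ht, hst, rfl⟩ := hv
  obtain ⟨z1, z2, z3⟩ := hz
  obtain ⟨w1, w2, w3⟩ := hw
  refine ⟨?_, ?_, ?_⟩
  · simp only [Complex.add_re, Complex.real_smul, Complex.re_ofReal_mul]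
    rcases hs.eq_or_lt with rfl | hs'
    · have : t = 1 := by linarith
      subst this; linarith
    · have := mul_pos hs' z1
      have := mul_nonneg ht w1.le
      linarith
  · rw [lowerDist_convex]; positivity
  · rw [upperDist_convex]; positivity

theorem lowerDist_eq_sin (z : ℂ) : lowerDist z = ‖z‖ * Real.sin (z.arg + Real.pi / 169) := by
  have h : z * halfTurn = ‖z‖ * Complex.exp (((z.arg + Real.pi / 169 : ℝ) : ℂ) * Complex.I) := by
    conv_lhs => rw [← Complex.norm_mul_exp_arg_mul_I z]
    rw [halfTurn, mul_assoc, ← Complex.exp_add]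
    congr 2
    push_cast
    ring
  rw [lowerDist, h, Complex.im_ofReal_mul, Complex.exp_ofReal_mul_I_im]

theorem upperDist_eq_sin (z : ℂ) (hz : z.arg ≠ Real.pi) :
    upperDist z = ‖z‖ * Real.sin (Real.pi / 169 - z.arg) := by
  rw [upperDist_eq, lowerDist_eq_sin, Complex.norm_conj, Complex.arg_conj, if_neg hz]
  ring_nf

theorem arg_of_mem_sector {z : ℂ} (hz : z ∈ sector) :
    -(Real.pi / 169) ≤ z.arg ∧ z.arg ≤ Real.pi / 169 := by
  obtain ⟨h1, h2, h3⟩ := hz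
  have hz0 : 0 < ‖z‖ := norm_pos_iff.2 fun h => by simp [h] at h1
  have h4 := Complex.abs_arg_lt_pi_div_two_iff.2 (Or.inl h1)
  rw [abs_lt] at h4
  have hpi := Real.pi_pos
  have h5 : z.arg ≠ Real.pi := by linarith
  rw [lowerDist_eq_sin] at h2
  rw [upperDist_eq_sin z h5] at h3
  have h2' := nonneg_of_mul_nonneg_right h2 hz0
  have h3' := nonneg_of_mul_nonneg_right h3 hz0
  constructor
  · by_contra hc
    push Not at hc
    have := Real.sin_neg_of_neg_of_neg_pi_lt (x := z.arg + Real.pi / 169) (by linarith) (by linarith)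
    linarith
  · by_contra hc
    push Not at hc
    have := Real.sin_neg_of_neg_of_neg_pi_lt (x := Real.pi / 169 - z.arg) (by linarith) (by linarith)
    linarith

/-- Two different images of the sector meet at most in a boundary line. -/
theorem eq_turn_mul_of_mem_sector {z w : ℂ} (hz : z ∈ sector) (hw : w ∈ sector) {k : ZMod 169}
    (h : z = turn k * w) :
    k = 0 ∨ (k = 1 ∧ upperDist z = 0 ∧ lowerDist w = 0) ∨
      (k = -1 ∧ lowerDist z = 0 ∧ upperDist w = 0) := by
  obtain ⟨z1, z2⟩ := arg_of_mem_sector hz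
  obtain ⟨w1, w2⟩ := arg_of_mem_sector hw
  have hpi := Real.pi_pos
  have hz0 : z ≠ 0 := by rintro rfl; simpa using hz.1
  have hw0 : w ≠ 0 := by rintro rfl; simpa using hw.1
  have hnorm : ‖z‖ = ‖w‖ := by rw [h, norm_mul, norm_turn, one_mul]
  have hexp : Complex.exp (z.arg * Complex.I) =
      Complex.exp (((2 * (k.val : ℝ) * (Real.pi / 169) + w.arg : ℝ) : ℂ) * Complex.I) := by
    have e1 : turn k = Complex.exp (((2 * (k.val : ℝ) * (Real.pi / 169) : ℝ) : ℂ) * Complex.I) := by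
      rw [turn, fullTurn_eq_exp, ← Complex.exp_nat_mul]
      congr 1
      push_cast
      ring
    have e2 := Complex.norm_mul_exp_arg_mul_I z
    have e3 := Complex.norm_mul_exp_arg_mul_I w
    have hn0 : ((‖w‖ : ℝ) : ℂ) ≠ 0 := by
      rw [Ne, Complex.ofReal_eq_zero, norm_eq_zero]; exact hw0
    apply mul_left_cancel₀ hn0
    rw [Complex.ofReal_add, add_mul, Complex.exp_add, ← e1, mul_left_comm, e3, ← h, ← hnorm, e2]
  rw [Complex.exp_eq_exp_iff_exists_int] at hexp
  obtain ⟨m, hm⟩ := hexp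
  have hm' : z.arg = 2 * ((k.val : ℤ) + 169 * m : ℤ) * (Real.pi / 169) + w.arg := by
    have h1 : (z.arg : ℂ) =
        ((2 * (k.val : ℝ) * (Real.pi / 169) + w.arg + m * (2 * Real.pi) : ℝ) : ℂ) := by
      apply mul_right_cancel₀ Complex.I_ne_zero
      rw [hm]
      push_cast
      ring
    have h2 := Complex.ofReal_injective h1
    rw [h2]
    push_cast
    ring
  set n : ℤ := (k.val : ℤ) + 169 * m with hn
  have hk : (n : ZMod 169) = k := by
    rw [hn]; push_cast
    rw [ZMod.natCast_zmod_val]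
    have : (169 : ZMod 169) = 0 := by decide
    rw [this, zero_mul, add_zero]
  have hn1 : (n : ℝ) < 2 := by
    by_contra hc
    push Not at hc
    nlinarith
  have hn2 : (-2 : ℝ) < n := by
    by_contra hc
    push Not at hc
    nlinarith
  have hn1' : n < 2 := by exact_mod_cast hn1
  have hn2' : -2 < n := by exact_mod_cast hn2
  have hlt : ∀ v : ℂ, v.arg ≤ Real.pi / 169 → v.arg ≠ Real.pi := by
    intro v hv hv'
    linarith
  have hcases : n = -1 ∨ n = 0 ∨ n = 1 := by omega
  rcases hcases with h0 | h0 | h0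
  · right; right
    rw [h0] at hk hm'
    push_cast at hk hm'
    refine ⟨hk.symm, ?_, ?_⟩
    · rw [lowerDist_eq_sin, show z.arg + Real.pi / 169 = 0 by linarith, Real.sin_zero, mul_zero]
    · rw [upperDist_eq_sin _ (hlt _ w2), show Real.pi / 169 - w.arg = 0 by linarith,
        Real.sin_zero, mul_zero]
  · left
    rw [h0] at hk
    simpa using hk.symm
  · right; left
    rw [h0] at hk hm'
    push_cast at hk hm'
    refine ⟨hk.symm, ?_, ?_⟩
    · rw [upperDist_eq_sin _ (hlt _ z2), show Real.pi / 169 - z.arg = 0 by linarith,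
        Real.sin_zero, mul_zero]
    · rw [lowerDist_eq_sin, show w.arg + Real.pi / 169 = 0 by linarith, Real.sin_zero, mul_zero]

theorem sectorCoord_lowerDist : ∀ a : Fin 66, a ∉ leftLabels →
    10 ^ 38 < (sectorCoord a).1 * 1858823503388794372 + (sectorCoord a).2 * 99982722383336059113 := by
  decide +kernel

theorem lowerDist_pos {a : Fin 66} (ha : a ∉ leftLabels) : 0 < lowerDist (sectorPos a) := by
  have h1 := norm_sectorPos_sub_sectorCoord a
  have h2 := norm_halfTurn_sub_le
  set u₀ : ℂ := ⟨99982722383336059113 / 10 ^ 20, 1858823503388794372 / 10 ^ 20⟩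
  have h3 : ((10 : ℝ) ^ 38) < (sectorCoord a).1 * 1858823503388794372 +
    (sectorCoord a).2 * 99982722383336059113 := by exact_mod_cast sectorCoord_lowerDist a ha
  have h4 : (ofCoord (sectorCoord a) * u₀).im = ((sectorCoord a).1 * 1858823503388794372 +
    (sectorCoord a).2 * 99982722383336059113) / 10 ^ 40 := by
    simp [ofCoord, u₀]; ring
  have h5 : ‖ofCoord (sectorCoord a)‖ ≤ 107 := by
    obtain ⟨⟨a1, a2⟩, a3, a4⟩ := sectorCoord_bounds a
    have a1' : (95 * 10 ^ 20 : ℝ) ≤ (sectorCoord a).1 := by exact_mod_cast a1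
    have a2' : ((sectorCoord a).1 : ℝ) ≤ 105 * 10 ^ 20 := by exact_mod_cast a2
    have a3' : (-2 * 10 ^ 20 : ℝ) ≤ (sectorCoord a).2 := by exact_mod_cast a3
    have a4' : ((sectorCoord a).2 : ℝ) ≤ 2 * 10 ^ 20 := by exact_mod_cast a4
    refine (norm_le_of_abs_le (b := 105) (c := 2) ?_ ?_).trans (by norm_num) <;>
      simp only [ofCoord] <;> rw [abs_le] <;> constructor <;> linarith
  have h6 : ‖sectorPos a * halfTurn - ofCoord (sectorCoord a) * u₀‖ ≤ 1 / 10 ^ 5 := by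
    have e : sectorPos a * halfTurn - ofCoord (sectorCoord a) * u₀ =
        (sectorPos a - ofCoord (sectorCoord a)) * halfTurn +
          ofCoord (sectorCoord a) * (halfTurn - u₀) := by ring
    rw [e]
    refine (norm_add_le _ _).trans ?_
    rw [norm_mul, norm_mul, norm_halfTurn, mul_one]
    have := mul_le_mul h5 h2 (norm_nonneg _) (by norm_num)
    refine (add_le_add h1 this).trans (by norm_num)
  have h7 := (Complex.abs_im_le_norm _).trans h6
  rw [Complex.sub_im, h4] at h7
  have h8 := (abs_le.1 h7).1
  rw [lowerDist]
  linarith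

theorem lowerDist_eq_zero {a : Fin 66} (ha : a ∈ leftLabels) : lowerDist (sectorPos a) = 0 := by
  obtain ⟨t, ht⟩ := sectorPos_left a ha
  rw [lowerDist, ht, mul_assoc, mul_comm _ halfTurn, halfTurn_mul_conj, mul_one, Complex.ofReal_im]

theorem lowerDist_eq_zero_iff {a : Fin 66} : lowerDist (sectorPos a) = 0 ↔ a ∈ leftLabels :=
  ⟨fun h => by_contra fun hc => (lowerDist_pos hc).ne' h, lowerDist_eq_zero⟩

theorem upperDist_sectorPos (a : Fin 66) :
    upperDist (sectorPos a) = lowerDist (sectorPos (mirror a)) := by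
  rw [upperDist_eq, sectorPos_mirror]

theorem lowerDist_nonneg (a : Fin 66) : 0 ≤ lowerDist (sectorPos a) := by
  by_cases h : a ∈ leftLabels
  · rw [lowerDist_eq_zero h]
  · exact (lowerDist_pos h).le

theorem sectorPos_re_pos (a : Fin 66) : 0 < (sectorPos a).re := by
  have h1 := (Complex.abs_re_le_norm _).trans (norm_sectorPos_sub_sectorCoord a)
  have h2 : (95 * 10 ^ 20 : ℝ) ≤ (sectorCoord a).1 := by exact_mod_cast (sectorCoord_bounds a).1.1
  rw [Complex.sub_re] at h1
  have h3 := (abs_le.1 h1).1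
  simp only [ofCoord] at h3
  have h4 : (95 : ℝ) ≤ (sectorCoord a).1 / 10 ^ 20 := by
    rw [le_div_iff₀ (by positivity)]; exact h2
  linarith

theorem sectorPos_mem_sector (a : Fin 66) : sectorPos a ∈ sector :=
  ⟨sectorPos_re_pos a, lowerDist_nonneg a, by rw [upperDist_sectorPos]; exact lowerDist_nonneg _⟩

theorem left_not_adj : ∀ i j k, j ≠ k → corner i j ∈ leftLabels → corner i k ∉ leftLabels := by
  decide +kernel

theorem right_not_adj : ∀ i j k, j ≠ k → mirror (corner i j) ∈ leftLabels →
    mirror (corner i k) ∉ leftLabels := by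
  decide +kernel

theorem not_mem_left_of_adj {a b : Fin 66} (h : G₂.Adj a b) (ha : a ∈ leftLabels) :
    b ∉ leftLabels := by
  obtain ⟨i, j, k, hjk, rfl, rfl⟩ := (adj_iff_corner a b).1 h
  exact left_not_adj i j k hjk ha

theorem not_mem_right_of_adj {a b : Fin 66} (h : G₂.Adj a b) (ha : mirror a ∈ leftLabels) :
    mirror b ∉ leftLabels := by
  obtain ⟨i, j, k, hjk, rfl, rfl⟩ := (adj_iff_corner a b).1 h
  exact right_not_adj i j k hjk ha

theorem eq_of_convex_eq_zero {s t x y : ℝ} (hs : 0 ≤ s) (ht : 0 ≤ t) (hst : s + t = 1)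
    (hx : 0 ≤ x) (hy : 0 ≤ y) (hxy : ¬ (x = 0 ∧ y = 0)) (h : s * x + t * y = 0) :
    (s = 1 ∧ t = 0 ∧ x = 0) ∨ (s = 0 ∧ t = 1 ∧ y = 0) := by
  have h1 := mul_nonneg hs hx
  have h2 := mul_nonneg ht hy
  have h3 : s * x = 0 := by linarith
  have h4 : t * y = 0 := by linarith
  rcases mul_eq_zero.1 h3 with h5 | h5 <;> rcases mul_eq_zero.1 h4 with h6 | h6
  · linarith
  · exact Or.inr ⟨h5, by linarith, h6⟩
  · exact Or.inl ⟨by linarith, h6, h5⟩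
  · exact absurd ⟨h5, h6⟩ hxy

theorem exists_left_of_lowerDist_eq_zero {a b : Fin 66} (h : G₂.Adj a b) {z : ℂ}
    (hz : z ∈ segment ℝ (sectorPos a) (sectorPos b)) (h0 : lowerDist z = 0) :
    ∃ v ∈ s(a, b), v ∈ leftLabels ∧ z = sectorPos v := by
  obtain ⟨s, t, hs, ht, hst, rfl⟩ := hz
  rw [lowerDist_convex] at h0
  rcases eq_of_convex_eq_zero hs ht hst (lowerDist_nonneg a) (lowerDist_nonneg b) (fun hc =>
    not_mem_left_of_adj h (lowerDist_eq_zero_iff.1 hc.1) (lowerDist_eq_zero_iff.1 hc.2)) h0 with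
    ⟨rfl, rfl, h1⟩ | ⟨rfl, rfl, h1⟩
  · exact ⟨a, by simp, lowerDist_eq_zero_iff.1 h1, by simp⟩
  · exact ⟨b, by simp, lowerDist_eq_zero_iff.1 h1, by simp⟩

theorem exists_right_of_upperDist_eq_zero {a b : Fin 66} (h : G₂.Adj a b) {z : ℂ}
    (hz : z ∈ segment ℝ (sectorPos a) (sectorPos b)) (h0 : upperDist z = 0) :
    ∃ v ∈ s(a, b), mirror v ∈ leftLabels ∧ z = sectorPos v := by
  obtain ⟨s, t, hs, ht, hst, rfl⟩ := hz
  rw [upperDist_convex, upperDist_sectorPos, upperDist_sectorPos] at h0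
  rcases eq_of_convex_eq_zero hs ht hst (lowerDist_nonneg _) (lowerDist_nonneg _) (fun hc =>
    not_mem_right_of_adj h (lowerDist_eq_zero_iff.1 hc.1) (lowerDist_eq_zero_iff.1 hc.2)) h0 with
    ⟨rfl, rfl, h1⟩ | ⟨rfl, rfl, h1⟩
  · exact ⟨a, by simp, lowerDist_eq_zero_iff.1 h1, by simp⟩
  · exact ⟨b, by simp, lowerDist_eq_zero_iff.1 h1, by simp⟩

/-- The number of vertices of the ring. -/
def ringOrder : ℕ := 9633

theorem card_ringLabels :
    Fintype.card (ZMod 169 × {a : Fin 66 // mirror a ∉ leftLabels}) = ringOrder := by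
  rw [Fintype.card_prod, ZMod.card]
  have : Fintype.card {a : Fin 66 // mirror a ∉ leftLabels} = 57 := by decide +kernel
  rw [this]
  rfl

/-- The vertices of the ring, as pairs of a copy of `G₂` and one of its vertices not on the upper
boundary line. -/
noncomputable def ringLabel : ZMod 169 × {a : Fin 66 // mirror a ∉ leftLabels} ≃ Fin ringOrder :=
  Fintype.equivFinOfCardEq card_ringLabels

theorem mirror_not_mem_of_mem : ∀ a ∈ leftLabels, mirror a ∉ leftLabels := by decide +kernel

/-- The vertex of the ring that is the vertex `a` of the copy number `k` of `G₂`. -/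
noncomputable def ringVertex (k : ZMod 169) (a : Fin 66) : Fin ringOrder :=
  if h : mirror a ∉ leftLabels then ringLabel (k, ⟨a, h⟩) else
    ringLabel (k + 1, ⟨mirror a, by
      rw [mirror_mirror]
      have := mirror_not_mem_of_mem _ (not_not.1 h)
      rwa [mirror_mirror] at this⟩)

/-- The position of a vertex of the ring. -/
noncomputable def ringPos (v : Fin ringOrder) : ℂ :=
  turn (ringLabel.symm v).1 * sectorPos (ringLabel.symm v).2

theorem ringPos_ringVertex (k : ZMod 169) (a : Fin 66) :
    ringPos (ringVertex k a) = turn k * sectorPos a := by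
  rw [ringVertex]
  split_ifs with h
  · simp only [ringPos, Equiv.symm_apply_apply]
    have h1 := fullTurn_mul_sectorPos _ h
    rw [mirror_mirror] at h1
    rw [turn_add, turn_one, mul_assoc, h1]
  · simp [ringPos]

theorem ringVertex_add_one {a : Fin 66} (ha : a ∈ leftLabels) (k : ZMod 169) :
    ringVertex (k + 1) a = ringVertex k (mirror a) := by
  have h1 := mirror_not_mem_of_mem a ha
  rw [ringVertex, dif_pos h1, ringVertex, dif_neg (by rw [mirror_mirror]; exact not_not.2 ha)]
  congr 2
  exact Subtype.ext (mirror_mirror a).symm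

theorem exists_ringVertex (v : Fin ringOrder) :
    ∃ k a, mirror a ∉ leftLabels ∧ ringVertex k a = v := by
  obtain ⟨⟨k, a, ha⟩, rfl⟩ := ringLabel.surjective v
  exact ⟨k, a, ha, by rw [ringVertex, dif_pos ha]⟩

/-- If two vertices of copies of `G₂` have the same position, then they are the same vertex of the
ring, and this is described by the following three cases. -/
theorem turn_mul_sectorPos_eq {k l : ZMod 169} {a b : Fin 66}
    (h : turn k * sectorPos a = turn l * sectorPos b) :
    (k = l ∧ a = b) ∨ (k = l + 1 ∧ a ∈ leftLabels ∧ b = mirror a) ∨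
      (l = k + 1 ∧ b ∈ leftLabels ∧ a = mirror b) := by
  have h1 : sectorPos a = turn (l - k) * sectorPos b := by
    apply mul_left_cancel₀ (turn_ne_zero k)
    rw [h, ← mul_assoc, ← turn_add]
    congr 2
    ring
  rcases eq_turn_mul_of_mem_sector (sectorPos_mem_sector a) (sectorPos_mem_sector b) h1 with
    h2 | ⟨h2, -, h4⟩ | ⟨h2, h3, -⟩
  · left
    rw [h2, turn_zero, one_mul] at h1
    exact ⟨(sub_eq_zero.1 h2).symm, sectorPos_injective h1⟩
  · right; right
    rw [lowerDist_eq_zero_iff] at h4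
    rw [h2, turn_one, fullTurn_mul_sectorPos b h4] at h1
    exact ⟨by rw [← h2]; ring, h4, sectorPos_injective h1⟩
  · right; left
    rw [lowerDist_eq_zero_iff] at h3
    refine ⟨by rw [← sub_eq_iff_eq_add', ← neg_sub, h2, neg_neg], h3, ?_⟩
    apply sectorPos_injective
    rw [← fullTurn_mul_sectorPos a h3, h1, h2, ← mul_assoc, ← turn_one, ← turn_add]
    simp [turn_zero]

theorem ringVertex_eq_iff {k l : ZMod 169} {a b : Fin 66} :
    ringVertex k a = ringVertex l b ↔ (k = l ∧ a = b) ∨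
      (k = l + 1 ∧ a ∈ leftLabels ∧ b = mirror a) ∨
      (l = k + 1 ∧ b ∈ leftLabels ∧ a = mirror b) := by
  constructor
  · intro h
    apply turn_mul_sectorPos_eq
    rw [← ringPos_ringVertex, ← ringPos_ringVertex, h]
  · rintro (⟨rfl, rfl⟩ | ⟨rfl, h, rfl⟩ | ⟨rfl, h, rfl⟩)
    · rfl
    · exact ringVertex_add_one h l
    · exact (ringVertex_add_one h k).symm

theorem ringPos_injective : Function.Injective ringPos := by
  intro v w h
  obtain ⟨k, a, -, rfl⟩ := exists_ringVertex v
  obtain ⟨l, b, -, rfl⟩ := exists_ringVertex w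
  rw [ringPos_ringVertex, ringPos_ringVertex] at h
  exact ringVertex_eq_iff.2 (turn_mul_sectorPos_eq h)

theorem ne_add_one (k : ZMod 169) : k ≠ k + 1 := by
  intro h
  have h1 : (1 : ZMod 169) = 0 := by simpa using h.symm
  exact absurd h1 (by decide)

theorem ne_add_one_add_one (k : ZMod 169) : k ≠ k + 1 + 1 := by
  intro h
  have h1 : (1 + 1 : ZMod 169) = 0 := by
    rw [add_assoc] at h
    simpa using h.symm
  exact absurd h1 (by decide)

theorem ringVertex_injective (k : ZMod 169) : Function.Injective (ringVertex k) := by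
  intro a b h
  rcases ringVertex_eq_iff.1 h with h | h | h
  · exact h.2
  · exact absurd h.1 (ne_add_one k)
  · exact absurd h.1 (ne_add_one k)

/-- A unit triangle of the ring. -/
noncomputable def ringTriangle (p : ZMod 169 × Fin 38) : Finset (Fin ringOrder) :=
  Finset.univ.image fun j => ringVertex p.1 (corner p.2 j)

/-- The unit triangles of the ring. -/
noncomputable def ringTriangles : Finset (Finset (Fin ringOrder)) :=
  (Set.finite_range ringTriangle).toFinset

theorem mem_ringTriangles {t : Finset (Fin ringOrder)} :
    t ∈ ringTriangles ↔ ∃ p, ringTriangle p = t := by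
  rw [ringTriangles, Set.Finite.mem_toFinset, Set.mem_range]

/-- The graph of the ring. -/
def ringGraph : SimpleGraph (Fin ringOrder) where
  Adj v w := v ≠ w ∧ ∃ t ∈ ringTriangles, v ∈ t ∧ w ∈ t
  symm := ⟨by
    rintro v w ⟨h, t, ht, hv, hw⟩
    exact ⟨h.symm, t, ht, hw, hv⟩⟩
  loopless := ⟨fun _ h => h.1 rfl⟩

theorem mem_ringTriangle {p : ZMod 169 × Fin 38} {v : Fin ringOrder} :
    v ∈ ringTriangle p ↔ ∃ j, ringVertex p.1 (corner p.2 j) = v := by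
  simp [ringTriangle]

theorem ringTriangle_mem (p : ZMod 169 × Fin 38) : ringTriangle p ∈ ringTriangles :=
  mem_ringTriangles.2 ⟨p, rfl⟩

theorem ringGraph_adj_iff {v w : Fin ringOrder} : ringGraph.Adj v w ↔
    ∃ k a b, G₂.Adj a b ∧ ringVertex k a = v ∧ ringVertex k b = w := by
  constructor
  · rintro ⟨hne, t, ht, hv, hw⟩
    obtain ⟨⟨k, i⟩, rfl⟩ := mem_ringTriangles.1 ht
    obtain ⟨j, rfl⟩ := mem_ringTriangle.1 hv
    obtain ⟨j', rfl⟩ := mem_ringTriangle.1 hw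
    exact ⟨k, _, _, (adj_iff_corner _ _).2 ⟨i, j, j', fun h => hne (by rw [h]), rfl, rfl⟩, rfl, rfl⟩
  · rintro ⟨k, a, b, hab, rfl, rfl⟩
    refine ⟨fun h => hab.ne (ringVertex_injective k h), ?_⟩
    obtain ⟨i, j, j', -, rfl, rfl⟩ := (adj_iff_corner _ _).1 hab
    exact ⟨ringTriangle (k, i), ringTriangle_mem _, mem_ringTriangle.2 ⟨j, rfl⟩,
      mem_ringTriangle.2 ⟨j', rfl⟩⟩

theorem ringGraph_adj {k : ZMod 169} {a b : Fin 66} (h : G₂.Adj a b) :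
    ringGraph.Adj (ringVertex k a) (ringVertex k b) :=
  ringGraph_adj_iff.2 ⟨k, a, b, h, rfl, rfl⟩

theorem norm_ringPos_sub {v w : Fin ringOrder} (h : ringGraph.Adj v w) :
    ‖ringPos v - ringPos w‖ = 1 := by
  obtain ⟨k, a, b, hab, rfl, rfl⟩ := ringGraph_adj_iff.1 h
  rw [ringPos_ringVertex, ringPos_ringVertex, ← mul_sub, norm_mul, norm_turn, one_mul,
    norm_sectorPos_sub a b hab]

theorem mem_segment_turn {k : ZMod 169} {a b z : ℂ} (h : z ∈ segment ℝ (turn k * a) (turn k * b)) :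
    ∃ w ∈ segment ℝ a b, z = turn k * w := by
  obtain ⟨s, t, hs, ht, hst, rfl⟩ := h
  refine ⟨s • a + t • b, ⟨s, t, hs, ht, hst, rfl⟩, ?_⟩
  simp
  ring

theorem ring_edge_inter_of_ne {k l : ZMod 169} {a b c d : Fin 66} (hab : G₂.Adj a b)
    (hcd : G₂.Adj c d) {w w' : ℂ} (hw : w ∈ segment ℝ (sectorPos a) (sectorPos b))
    (hw' : w' ∈ segment ℝ (sectorPos c) (sectorPos d)) (h : turn k * w = turn l * w')
    (hl : l = k + 1) : ∃ e ∈ s(a, b), ∃ f ∈ s(c, d), ringVertex k e = ringVertex l f ∧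
      w = sectorPos e := by
  subst hl
  have h1 : w = turn 1 * w' := by
    apply mul_left_cancel₀ (turn_ne_zero k)
    rw [h, turn_add, mul_assoc]
  rcases eq_turn_mul_of_mem_sector
    (segment_subset_sector (sectorPos_mem_sector a) (sectorPos_mem_sector b) hw)
    (segment_subset_sector (sectorPos_mem_sector c) (sectorPos_mem_sector d) hw') h1 with
    h2 | ⟨-, h3, h4⟩ | ⟨h2, -⟩
  · exact absurd h2 (by decide)
  · obtain ⟨e, he, he', rfl⟩ := exists_right_of_upperDist_eq_zero hab hw h3
    obtain ⟨f, hf, hf', rfl⟩ := exists_left_of_lowerDist_eq_zero hcd hw' h4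
    refine ⟨e, he, f, hf, ?_, rfl⟩
    apply ringPos_injective
    rw [ringPos_ringVertex, ringPos_ringVertex, h]
  · exact absurd h2 (by decide)

theorem ring_edge_inter {v w v' w' : Fin ringOrder} (h : ringGraph.Adj v w)
    (h' : ringGraph.Adj v' w') (hne : s(v, w) ≠ s(v', w')) {z : ℂ}
    (hz : z ∈ segment ℝ (ringPos v) (ringPos w)) (hz' : z ∈ segment ℝ (ringPos v') (ringPos w')) :
    ∃ x, x ∈ s(v, w) ∧ x ∈ s(v', w') ∧ ringPos x = z := by
  obtain ⟨k, a, b, hab, rfl, rfl⟩ := ringGraph_adj_iff.1 h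
  obtain ⟨l, c, d, hcd, rfl, rfl⟩ := ringGraph_adj_iff.1 h'
  rw [ringPos_ringVertex, ringPos_ringVertex] at hz hz'
  obtain ⟨x, hx, rfl⟩ := mem_segment_turn hz
  obtain ⟨y, hy, hxy⟩ := mem_segment_turn hz'
  have mem : ∀ {k : ZMod 169} {a b e : Fin 66}, e ∈ s(a, b) →
      ringVertex k e ∈ s(ringVertex k a, ringVertex k b) := by
    intro k a b e he
    rw [Sym2.mem_iff] at he ⊢
    exact he.imp (fun h => by rw [h]) fun h => by rw [h]
  have h1 : x = turn (l - k) * y := by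
    apply mul_left_cancel₀ (turn_ne_zero k)
    rw [hxy, ← mul_assoc, ← turn_add]
    congr 2
    ring
  rcases eq_turn_mul_of_mem_sector
    (segment_subset_sector (sectorPos_mem_sector a) (sectorPos_mem_sector b) hx)
    (segment_subset_sector (sectorPos_mem_sector c) (sectorPos_mem_sector d) hy) h1 with
    h2 | ⟨h2, -⟩ | ⟨h2, -⟩
  · obtain rfl : l = k := sub_eq_zero.1 h2
    rw [h2, turn_zero, one_mul] at h1
    subst h1
    obtain ⟨e, he, he', rfl⟩ := sector_edge_inter hab hcd (fun hc => hne (by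
      rw [← Sym2.map_mk, ← Sym2.map_mk, hc])) hx hy
    exact ⟨ringVertex l e, mem he, mem he', ringPos_ringVertex l e⟩
  · obtain ⟨e, he, f, hf, hef, rfl⟩ := ring_edge_inter_of_ne hab hcd hx hy hxy
      (by rw [← h2]; ring)
    exact ⟨ringVertex k e, mem he, hef ▸ mem hf, ringPos_ringVertex k e⟩
  · obtain ⟨e, he, f, hf, hef, rfl⟩ := ring_edge_inter_of_ne hcd hab hy hx hxy.symm
      (by rw [← sub_eq_iff_eq_add', ← neg_sub, h2, neg_neg])
    exact ⟨ringVertex l e, hef ▸ mem hf, mem he, by rw [ringPos_ringVertex, hxy]⟩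

theorem card_common_corners : ∀ i i' : Fin 38, i ≠ i' →
    (Finset.univ.filter fun p : Fin 3 × Fin 3 => corner i p.1 = corner i' p.2).card ≤ 1 := by
  decide +kernel

theorem ringTriangle_unique {p q : ZMod 169 × Fin 38} {v w : Fin ringOrder} (hne : v ≠ w)
    (hv : v ∈ ringTriangle p) (hw : w ∈ ringTriangle p) (hv' : v ∈ ringTriangle q)
    (hw' : w ∈ ringTriangle q) : p = q := by
  obtain ⟨k, i⟩ := p
  obtain ⟨l, i'⟩ := q
  obtain ⟨j₁, rfl⟩ := mem_ringTriangle.1 hv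
  obtain ⟨j₂, rfl⟩ := mem_ringTriangle.1 hw
  obtain ⟨j₁', h₁⟩ := mem_ringTriangle.1 hv'
  obtain ⟨j₂', h₂⟩ := mem_ringTriangle.1 hw'
  simp only at h₁ h₂ hne
  have hj : j₁ ≠ j₂ := fun h => hne (by rw [h])
  have hj' : j₁' ≠ j₂' := fun h => hne (by rw [← h₁, ← h₂, h])
  rcases ringVertex_eq_iff.1 h₁ with ⟨h3, h4⟩ | ⟨h3, h4, h5⟩ | ⟨h3, h4, h5⟩ <;>
    rcases ringVertex_eq_iff.1 h₂ with ⟨g3, g4⟩ | ⟨g3, g4, g5⟩ | ⟨g3, g4, g5⟩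
  · by_contra hc
    have hii : i ≠ i' := fun h => hc (by rw [h, h3])
    have h5 := Finset.card_le_one.1 (card_common_corners i i' hii) (j₁, j₁')
      (Finset.mem_filter.2 ⟨Finset.mem_univ _, h4.symm⟩) (j₂, j₂')
      (Finset.mem_filter.2 ⟨Finset.mem_univ _, g4.symm⟩)
    exact hj (congrArg Prod.fst h5)
  · exact absurd (h3.symm.trans g3) (ne_add_one k)
  · exact absurd (h3.trans g3) (ne_add_one l)
  · exact absurd (g3.symm.trans h3) (ne_add_one k)
  · exact absurd g4 (left_not_adj i' j₁' j₂' hj' h4)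
  · exact absurd (h3.trans (by rw [g3])) (ne_add_one_add_one l)
  · exact absurd (g3.trans h3) (ne_add_one l)
  · exact absurd (g3.trans (by rw [h3])) (ne_add_one_add_one l)
  · exact absurd g4 (left_not_adj i j₁ j₂ hj h4)

theorem ringTriangle_corner_injective (p : ZMod 169 × Fin 38) :
    Function.Injective fun j => ringVertex p.1 (corner p.2 j) :=
  (ringVertex_injective _).comp (corner_injective _)

theorem ringTriangle_injective : Function.Injective ringTriangle := by
  intro p q h
  have h0 := mem_ringTriangle (p := p).2 ⟨0, rfl⟩
  have h1 := mem_ringTriangle (p := p).2 ⟨1, rfl⟩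
  exact ringTriangle_unique (fun hc => absurd (ringTriangle_corner_injective p hc) (by decide)) h0
    h1 (h ▸ h0) (h ▸ h1)

theorem card_ringTriangles : ringTriangles.card = 6422 := by
  rw [ringTriangles, ← Set.ncard_eq_toFinset_card, ← Set.image_univ,
    Set.ncard_image_of_injective _ ringTriangle_injective, Set.ncard_univ, Nat.card_eq_fintype_card,
    Fintype.card_prod, ZMod.card, Fintype.card_fin]

theorem card_ringTriangle (p : ZMod 169 × Fin 38) : (ringTriangle p).card = 3 := by
  rw [ringTriangle, Finset.card_image_of_injective _ (ringTriangle_corner_injective p)]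
  rfl

theorem isNClique_of_mem_ringTriangles {t : Finset (Fin ringOrder)} (ht : t ∈ ringTriangles) :
    ringGraph.IsNClique 3 t := by
  refine ⟨fun v hv w hw hne => ⟨hne, t, ht, hv, hw⟩, ?_⟩
  obtain ⟨p, rfl⟩ := mem_ringTriangles.1 ht
  exact card_ringTriangle p

theorem existsUnique_ringTriangle {v w : Fin ringOrder} (h : ringGraph.Adj v w) :
    ∃! t, t ∈ ringTriangles ∧ v ∈ t ∧ w ∈ t := by
  obtain ⟨hne, t, ht, hv, hw⟩ := h
  refine ⟨t, ⟨ht, hv, hw⟩, ?_⟩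
  rintro s ⟨hs, hv', hw'⟩
  obtain ⟨p, rfl⟩ := mem_ringTriangles.1 ht
  obtain ⟨q, rfl⟩ := mem_ringTriangles.1 hs
  rw [ringTriangle_unique hne hv hw hv' hw']

/-- The neighbours of a vertex in `G₂`. -/
def sectorNeighbors (a : Fin 66) : Finset (Fin 66) :=
  (Finset.univ.filter fun p : Fin 38 × Fin 3 × Fin 3 =>
    p.2.1 ≠ p.2.2 ∧ corner p.1 p.2.1 = a).image fun p => corner p.1 p.2.2

theorem mem_sectorNeighbors {a b : Fin 66} : b ∈ sectorNeighbors a ↔ G₂.Adj a b := by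
  rw [adj_iff_corner]
  simp only [sectorNeighbors, Finset.mem_image, Finset.mem_filter, Finset.mem_univ, true_and,
    Prod.exists]
  constructor
  · rintro ⟨i, j, k, ⟨h1, h2⟩, h3⟩
    exact ⟨i, j, k, h1, h2, h3⟩
  · rintro ⟨i, j, k, h1, h2, h3⟩
    exact ⟨i, j, k, ⟨h1, h2⟩, h3⟩

theorem card_sectorNeighbors : ∀ a, (sectorNeighbors a).card =
    if a ∈ leftLabels ∨ mirror a ∈ leftLabels then 2 else 4 := by
  decide +kernel

theorem ringGraph_regular (v : Fin ringOrder) : (ringGraph.neighborSet v).ncard = 4 := by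
  obtain ⟨k, a, ha, rfl⟩ := exists_ringVertex v
  by_cases hl : a ∈ leftLabels
  · have h1 : ringGraph.neighborSet (ringVertex k a) =
        (((sectorNeighbors a).image (ringVertex k) ∪
          (sectorNeighbors (mirror a)).image (ringVertex (k - 1)) : Finset _) : Set _) := by
      have hk : ringVertex k a = ringVertex (k - 1) (mirror a) := by
        rw [← ringVertex_add_one hl, sub_add_cancel]
      ext w
      simp only [SimpleGraph.mem_neighborSet, Finset.coe_union, Finset.coe_image, Set.mem_union,
        Set.mem_image, Finset.mem_coe, mem_sectorNeighbors]
      constructor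
      · intro h
        obtain ⟨l, b, c, hbc, h2, rfl⟩ := ringGraph_adj_iff.1 h
        rcases ringVertex_eq_iff.1 h2 with ⟨rfl, rfl⟩ | ⟨-, h3, h4⟩ | ⟨h3, -, h4⟩
        · exact Or.inl ⟨c, hbc, rfl⟩
        · exact absurd (by rw [h4, mirror_mirror]; exact h3) ha
        · subst h4
          exact Or.inr ⟨c, hbc, by rw [h3, add_sub_cancel_right]⟩
      · rintro (⟨c, hc, rfl⟩ | ⟨c, hc, rfl⟩)
        · exact ringGraph_adj hc
        · rw [hk]
          exact ringGraph_adj hc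
    rw [h1, Set.ncard_coe_finset, Finset.card_union_of_disjoint,
      Finset.card_image_of_injective _ (ringVertex_injective _),
      Finset.card_image_of_injective _ (ringVertex_injective _), card_sectorNeighbors,
      card_sectorNeighbors, if_pos (Or.inl hl), if_pos (Or.inr (by rw [mirror_mirror]; exact hl))]
    rw [Finset.disjoint_left]
    intro w hw hw'
    obtain ⟨b, hb, rfl⟩ := Finset.mem_image.1 hw
    obtain ⟨c, hc, hbc⟩ := Finset.mem_image.1 hw'
    rw [mem_sectorNeighbors] at hb
    rcases ringVertex_eq_iff.1 hbc with ⟨h3, -⟩ | ⟨h3, h4, -⟩ | ⟨-, h4, -⟩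
    · exact absurd (by rw [sub_add_cancel]; exact h3) (ne_add_one (k - 1))
    · exact ne_add_one_add_one (k - 1) (by rw [sub_add_cancel]; exact h3)
    · exact not_mem_left_of_adj hb hl h4
  · have h1 : ringGraph.neighborSet (ringVertex k a) =
        ((sectorNeighbors a).image (ringVertex k) : Finset _) := by
      ext w
      simp only [SimpleGraph.mem_neighborSet, Finset.coe_image, Set.mem_image, Finset.mem_coe,
        mem_sectorNeighbors]
      constructor
      · intro h
        obtain ⟨l, b, c, hbc, h2, rfl⟩ := ringGraph_adj_iff.1 h
        rcases ringVertex_eq_iff.1 h2 with ⟨rfl, rfl⟩ | ⟨-, h3, h4⟩ | ⟨-, h3, -⟩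
        · exact ⟨c, hbc, rfl⟩
        · exact absurd (by rw [h4, mirror_mirror]; exact h3) ha
        · exact absurd h3 hl
      · rintro ⟨c, hc, rfl⟩
        exact ringGraph_adj hc
    rw [h1, Set.ncard_coe_finset, Finset.card_image_of_injective _ (ringVertex_injective _),
      card_sectorNeighbors, if_neg (by tauto)]

theorem ring_planar : IsPlanarUnitDistance ringGraph ringPos where
  injective := ringPos_injective
  dist_eq_one x y h := by rw [dist_eq_norm]; exact norm_ringPos_sub h
  vertex_on_edge v x y h hv := by
    have h1 : (ringGraph.neighborSet v).Nonempty := by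
      rw [← Set.ncard_pos (Set.toFinite _), ringGraph_regular]
      norm_num
    obtain ⟨w, hw⟩ := h1
    rw [SimpleGraph.mem_neighborSet] at hw
    by_cases he : s(v, w) = s(x, y)
    · have : v ∈ s(x, y) := by rw [← he]; simp
      simpa using this
    · obtain ⟨z, -, hz, hz'⟩ := ring_edge_inter hw h he (left_mem_segment ℝ _ _) hv
      rw [ringPos_injective hz'] at hz
      simpa using hz
  edge_inter x y x' y' h h' hne z hz := ring_edge_inter h h' hne hz.1 hz.2

/-- Neighbours `b` and `c` of the vertex `a` of `G₂` are neither in opposite directions from `a` nor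
at distance one, with a margin. -/
def generalPosition (a b c : Fin 66) : Bool :=
  let p := sectorCoord a
  let q := sectorCoord b
  let r := sectorCoord c
  (decide (10 ^ 10 < |q.1 + r.1 - 2 * p.1|) || decide (10 ^ 10 < |q.2 + r.2 - 2 * p.2|)) &&
    decide (10 ^ 31 < |(q.1 - r.1) ^ 2 + (q.2 - r.2) ^ 2 - 10 ^ 40|)

set_option maxRecDepth 10000 in
theorem generalPosition_of_ne : ∀ (i i' : Fin 38) (j j' : Fin 3), i ≠ i' → corner i j = corner i' j' →
    ∀ m, m ≠ j → ∀ m', m' ≠ j' →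
      generalPosition (corner i j) (corner i m) (corner i' m') = true := by
  decide +kernel

/-- The edge vector from `a` to `b`, turned by half the angle of the sector, in units of `10⁻⁴⁰`. -/
def turnedCoord (a b : Fin 66) : ℤ × ℤ :=
  let x := (sectorCoord b).1 - (sectorCoord a).1
  let y := (sectorCoord b).2 - (sectorCoord a).2
  (x * 99982722383336059113 - y * 1858823503388794372,
    x * 1858823503388794372 + y * 99982722383336059113)

theorem turnedCoord_separated : ∀ (i : Fin 38) (j m : Fin 3) (i' : Fin 38) (j' m' : Fin 3), m ≠ j →
    corner i j ∈ leftLabels → m' ≠ j' → corner i' j' = corner i j →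
    (10 ^ 30 < |(turnedCoord (corner i j) (corner i m)).1 +
        (turnedCoord (corner i j) (corner i' m')).1| ∨
      10 ^ 30 < |(turnedCoord (corner i j) (corner i m)).2 -
        (turnedCoord (corner i j) (corner i' m')).2|) ∧
      10 ^ 71 < |((turnedCoord (corner i j) (corner i m)).1 -
          (turnedCoord (corner i j) (corner i' m')).1) ^ 2 +
        ((turnedCoord (corner i j) (corner i m)).2 +
          (turnedCoord (corner i j) (corner i' m')).2) ^ 2 - 10 ^ 80| := by
  decide +kernel

theorem abs_re_sq_add_im_sq_sub_one_le {z w : ℂ} (hz : ‖z‖ = 1) (h : ‖z - w‖ ≤ 1 / 10 ^ 10) :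
    |w.re ^ 2 + w.im ^ 2 - 1| ≤ 1 / 10 ^ 9 := by
  have h1 : w.re ^ 2 + w.im ^ 2 = ‖w‖ ^ 2 := by
    rw [← Complex.normSq_eq_norm_sq, Complex.normSq_apply]; ring
  have h2 := (abs_norm_sub_norm_le z w).trans h
  rw [hz, abs_le] at h2
  rw [h1, abs_le]
  constructor <;> nlinarith

theorem sectorPos_generalPosition {a b c : Fin 66} (h : generalPosition a b c = true) :
    sectorPos b + sectorPos c ≠ 2 * sectorPos a ∧ ‖sectorPos b - sectorPos c‖ ≠ 1 := by
  simp only [generalPosition, Bool.and_eq_true, Bool.or_eq_true, decide_eq_true_eq] at h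
  obtain ⟨h1, h2⟩ := h
  constructor
  · intro hc
    have h3 : ‖(ofCoord (sectorCoord b) + ofCoord (sectorCoord c) -
        2 * ofCoord (sectorCoord a))‖ ≤ 44 / 10 ^ 12 := by
      have e : ofCoord (sectorCoord b) + ofCoord (sectorCoord c) - 2 * ofCoord (sectorCoord a) =
          ((sectorPos a - sectorPos b) - (ofCoord (sectorCoord a) - ofCoord (sectorCoord b))) +
          ((sectorPos a - sectorPos c) - (ofCoord (sectorCoord a) - ofCoord (sectorCoord c))) := by
        linear_combination hc
      rw [e]
      exact (norm_add_le _ _).trans ((add_le_add (norm_sub_sub_ofCoord_le a b)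
        (norm_sub_sub_ofCoord_le a c)).trans (by norm_num))
    rcases h1 with h1 | h1
    · have h4 := (Complex.abs_re_le_norm _).trans h3
      have e : (ofCoord (sectorCoord b) + ofCoord (sectorCoord c) -
          2 * ofCoord (sectorCoord a)).re =
          (((sectorCoord b).1 + (sectorCoord c).1 - 2 * (sectorCoord a).1 : ℤ) : ℝ) / 10 ^ 20 := by
        simp [ofCoord]; ring
      have h1' : (10 : ℝ) ^ 10 <
          |(((sectorCoord b).1 + (sectorCoord c).1 - 2 * (sectorCoord a).1 : ℤ) : ℝ)| := by
        exact_mod_cast h1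
      rw [e, abs_div, div_le_iff₀ (by positivity), abs_of_pos (show (0 : ℝ) < 10 ^ 20 by positivity)]
        at h4
      norm_num at h1' h4
      linarith
    · have h4 := (Complex.abs_im_le_norm _).trans h3
      have e : (ofCoord (sectorCoord b) + ofCoord (sectorCoord c) -
          2 * ofCoord (sectorCoord a)).im =
          (((sectorCoord b).2 + (sectorCoord c).2 - 2 * (sectorCoord a).2 : ℤ) : ℝ) / 10 ^ 20 := by
        simp [ofCoord]; ring
      have h1' : (10 : ℝ) ^ 10 <
          |(((sectorCoord b).2 + (sectorCoord c).2 - 2 * (sectorCoord a).2 : ℤ) : ℝ)| := by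
        exact_mod_cast h1
      rw [e, abs_div, div_le_iff₀ (by positivity), abs_of_pos (show (0 : ℝ) < 10 ^ 20 by positivity)]
        at h4
      norm_num at h1' h4
      linarith
  · intro hc
    have h3 := abs_re_sq_add_im_sq_sub_one_le hc ((norm_sub_sub_ofCoord_le b c).trans (by norm_num))
    have e : (ofCoord (sectorCoord b) - ofCoord (sectorCoord c)).re ^ 2 +
        (ofCoord (sectorCoord b) - ofCoord (sectorCoord c)).im ^ 2 - 1 =
        ((((sectorCoord b).1 - (sectorCoord c).1) ^ 2 +
          ((sectorCoord b).2 - (sectorCoord c).2) ^ 2 - 10 ^ 40 : ℤ) : ℝ) / 10 ^ 40 := by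
      simp [ofCoord]; ring
    have h2' : (10 : ℝ) ^ 31 < |((((sectorCoord b).1 - (sectorCoord c).1) ^ 2 +
          ((sectorCoord b).2 - (sectorCoord c).2) ^ 2 - 10 ^ 40 : ℤ) : ℝ)| := by
      exact_mod_cast h2
    rw [e, abs_div, div_le_iff₀ (by positivity), abs_of_pos (show (0 : ℝ) < 10 ^ 40 by positivity)]
      at h3
    refine absurd (h2'.trans_le h3) ?_
    norm_num

theorem exists_mirror_corner : ∀ (i : Fin 38) (j k : Fin 3), j ≠ k → ∃ (i' : Fin 38) (j' k' : Fin 3),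
    j' ≠ k' ∧ corner i' j' = mirror (corner i j) ∧ corner i' k' = mirror (corner i k) := by
  decide +kernel

theorem adj_mirror {a b : Fin 66} (h : G₂.Adj a b) : G₂.Adj (mirror a) (mirror b) := by
  obtain ⟨i, j, k, hjk, rfl, rfl⟩ := (adj_iff_corner a b).1 h
  exact (adj_iff_corner _ _).2 (exists_mirror_corner i j k hjk)

/-- The edge vector from `a` to `b`, turned by half the angle of the sector. -/
noncomputable def turnedEdge (a b : Fin 66) : ℂ := (sectorPos b - sectorPos a) * halfTurn

theorem norm_turnedEdge_sub_le (a b : Fin 66) : ‖turnedEdge a b -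
    ⟨(turnedCoord a b).1 / 10 ^ 40, (turnedCoord a b).2 / 10 ^ 40⟩‖ ≤ 23 / 10 ^ 12 := by
  have h1 := norm_sub_sub_ofCoord_le b a
  have h2 := norm_halfTurn_sub_le
  set u₀ : ℂ := ⟨99982722383336059113 / 10 ^ 20, 1858823503388794372 / 10 ^ 20⟩
  have e : turnedEdge a b - ⟨(turnedCoord a b).1 / 10 ^ 40, (turnedCoord a b).2 / 10 ^ 40⟩ =
      ((sectorPos b - sectorPos a) - (ofCoord (sectorCoord b) - ofCoord (sectorCoord a))) * halfTurn +
      (ofCoord (sectorCoord b) - ofCoord (sectorCoord a)) * (halfTurn - u₀) := by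
    have e' : (⟨(turnedCoord a b).1 / 10 ^ 40, (turnedCoord a b).2 / 10 ^ 40⟩ : ℂ) =
        (ofCoord (sectorCoord b) - ofCoord (sectorCoord a)) * u₀ := by
      apply Complex.ext <;> simp [ofCoord, turnedCoord, u₀] <;> ring
    rw [e', turnedEdge]
    ring
  rw [e]
  refine (norm_add_le _ _).trans ?_
  rw [norm_mul, norm_mul, norm_halfTurn, mul_one]
  refine (add_le_add h1 (mul_le_mul (norm_ofCoord_sub_le b a) h2 (norm_nonneg _)
    (by norm_num))).trans (by norm_num)

theorem turnedEdge_separated {a b c : Fin 66} (ha : a ∈ leftLabels) (hb : G₂.Adj a b)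
    (hc : G₂.Adj a c) : turnedEdge a b + (starRingEnd ℂ) (turnedEdge a c) ≠ 0 ∧
      ‖turnedEdge a b - (starRingEnd ℂ) (turnedEdge a c)‖ ≠ 1 := by
  have key : (10 ^ 30 < |(turnedCoord a b).1 + (turnedCoord a c).1| ∨
      10 ^ 30 < |(turnedCoord a b).2 - (turnedCoord a c).2|) ∧
      10 ^ 71 < |((turnedCoord a b).1 - (turnedCoord a c).1) ^ 2 +
        ((turnedCoord a b).2 + (turnedCoord a c).2) ^ 2 - 10 ^ 80| := by
    obtain ⟨i, j, m, hjm, rfl, rfl⟩ := (adj_iff_corner _ _).1 hb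
    obtain ⟨i', j', m', hjm', h', rfl⟩ := (adj_iff_corner _ _).1 hc
    exact turnedCoord_separated i j m i' j' m' hjm.symm ha hjm'.symm h'
  have hb' := norm_turnedEdge_sub_le a b
  have hc' := norm_turnedEdge_sub_le a c
  rw [← Complex.norm_conj, map_sub] at hc'
  obtain ⟨h1, h2⟩ := key
  generalize turnedEdge a b = z at *
  generalize (starRingEnd ℂ) (turnedEdge a c) = w at *
  generalize turnedCoord a b = Z at *
  generalize turnedCoord a c = W at *
  constructor
  · intro h0
    have h3 : ‖(⟨Z.1 / 10 ^ 40, Z.2 / 10 ^ 40⟩ : ℂ) +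
        (starRingEnd ℂ) ⟨W.1 / 10 ^ 40, W.2 / 10 ^ 40⟩‖ ≤ 46 / 10 ^ 12 := by
      have e : (⟨Z.1 / 10 ^ 40, Z.2 / 10 ^ 40⟩ : ℂ) +
          (starRingEnd ℂ) ⟨W.1 / 10 ^ 40, W.2 / 10 ^ 40⟩ =
          -((z - ⟨Z.1 / 10 ^ 40, Z.2 / 10 ^ 40⟩) +
            (w - (starRingEnd ℂ) ⟨W.1 / 10 ^ 40, W.2 / 10 ^ 40⟩)) := by
        linear_combination h0
      rw [e, norm_neg]
      exact (norm_add_le _ _).trans ((add_le_add hb' hc').trans (by norm_num))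
    rcases h1 with h1 | h1
    · have h4 := (Complex.abs_re_le_norm _).trans h3
      simp only [Complex.add_re, Complex.conj_re] at h4
      rw [← add_div, abs_div, div_le_iff₀ (by positivity),
        abs_of_pos (show (0 : ℝ) < 10 ^ 40 by positivity)] at h4
      have h1' : (10 : ℝ) ^ 30 < |(Z.1 : ℝ) + W.1| := by exact_mod_cast h1
      refine absurd (h1'.trans_le h4) (by norm_num)
    · have h4 := (Complex.abs_im_le_norm _).trans h3
      simp only [Complex.add_im, Complex.conj_im] at h4
      rw [← sub_eq_add_neg, ← sub_div, abs_div, div_le_iff₀ (by positivity),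
        abs_of_pos (show (0 : ℝ) < 10 ^ 40 by positivity)] at h4
      have h1' : (10 : ℝ) ^ 30 < |(Z.2 : ℝ) - W.2| := by exact_mod_cast h1
      refine absurd (h1'.trans_le h4) (by norm_num)
  · intro h0
    have h3 : ‖(z - w) - ((⟨Z.1 / 10 ^ 40, Z.2 / 10 ^ 40⟩ : ℂ) -
        (starRingEnd ℂ) ⟨W.1 / 10 ^ 40, W.2 / 10 ^ 40⟩)‖ ≤ 1 / 10 ^ 10 := by
      rw [sub_sub_sub_comm]
      exact (norm_sub_le _ _).trans ((add_le_add hb' hc').trans (by norm_num))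
    have h4 := abs_re_sq_add_im_sq_sub_one_le h0 h3
    have e : ((⟨Z.1 / 10 ^ 40, Z.2 / 10 ^ 40⟩ : ℂ) -
        (starRingEnd ℂ) ⟨W.1 / 10 ^ 40, W.2 / 10 ^ 40⟩).re ^ 2 +
        ((⟨Z.1 / 10 ^ 40, Z.2 / 10 ^ 40⟩ : ℂ) -
        (starRingEnd ℂ) ⟨W.1 / 10 ^ 40, W.2 / 10 ^ 40⟩).im ^ 2 - 1 =
        (((Z.1 - W.1) ^ 2 + (Z.2 + W.2) ^ 2 - 10 ^ 80 : ℤ) : ℝ) / 10 ^ 80 := by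
      simp; ring
    rw [e, abs_div, div_le_iff₀ (by positivity),
      abs_of_pos (show (0 : ℝ) < 10 ^ 80 by positivity)] at h4
    have h2' : (10 : ℝ) ^ 71 < |(((Z.1 - W.1) ^ 2 + (Z.2 + W.2) ^ 2 - 10 ^ 80 : ℤ) : ℝ)| := by
      exact_mod_cast h2
    refine absurd (h2'.trans_le h4) (by norm_num)

theorem ring_generalPosition_same (k : ZMod 169) {a b c : Fin 66} (hb : G₂.Adj a b)
    (hc : G₂.Adj a c) :
    (∃ t ∈ ringTriangles, ringVertex k a ∈ t ∧ ringVertex k b ∈ t ∧ ringVertex k c ∈ t) ∨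
      (ringPos (ringVertex k b) + ringPos (ringVertex k c) ≠ 2 * ringPos (ringVertex k a) ∧
        ‖ringPos (ringVertex k b) - ringPos (ringVertex k c)‖ ≠ 1) := by
  obtain ⟨i, j, m, hjm, rfl, rfl⟩ := (adj_iff_corner _ _).1 hb
  obtain ⟨i', j', m', hjm', h', rfl⟩ := (adj_iff_corner _ _).1 hc
  by_cases hi : i = i'
  · subst hi
    exact Or.inl ⟨_, ringTriangle_mem (k, i), mem_ringTriangle.2 ⟨j, rfl⟩,
      mem_ringTriangle.2 ⟨m, rfl⟩, mem_ringTriangle.2 ⟨m', rfl⟩⟩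
  · right
    obtain ⟨h1, h2⟩ := sectorPos_generalPosition
      (generalPosition_of_ne i i' j j' hi h'.symm m hjm.symm m' hjm'.symm)
    simp only [ringPos_ringVertex]
    constructor
    · intro hc
      apply h1
      apply mul_left_cancel₀ (turn_ne_zero k)
      linear_combination hc
    · rwa [← mul_sub, norm_mul, norm_turn, one_mul]

theorem ring_generalPosition_ne (k : ZMod 169) {a b c : Fin 66} (ha : a ∈ leftLabels)
    (hb : G₂.Adj a b) (hc : G₂.Adj (mirror a) c) :
    ringPos (ringVertex (k + 1) b) + ringPos (ringVertex k c) ≠ 2 * ringPos (ringVertex (k + 1) a) ∧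
      ‖ringPos (ringVertex (k + 1) b) - ringPos (ringVertex k c)‖ ≠ 1 := by
  have hc' := adj_mirror hc
  rw [mirror_mirror] at hc'
  obtain ⟨h1, h2⟩ := turnedEdge_separated ha hb hc'
  simp only [ringPos_ringVertex]
  have h3 : sectorPos c = (starRingEnd ℂ) (sectorPos (mirror c)) := by
    rw [sectorPos_mirror, Complex.conj_conj]
  have h4 := fullTurn_mul_sectorPos a ha
  rw [sectorPos_mirror] at h4
  have h5 := halfTurn_mul_conj
  rw [turn_add, turn_one]
  simp only [turnedEdge, map_mul, map_sub] at h1 h2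
  rw [← h3] at h1 h2
  rw [fullTurn] at *
  constructor
  · intro h0
    apply h1
    apply mul_left_cancel₀ (turn_ne_zero k)
    have hu : halfTurn ≠ 0 := left_ne_zero_of_mul_eq_one h5
    apply mul_left_cancel₀ hu
    linear_combination h0 + turn k * h4 + turn k * (sectorPos c - (starRingEnd ℂ) (sectorPos a)) * h5
  · have e : turn k * halfTurn ^ 2 * sectorPos b - turn k * sectorPos c =
        turn k * halfTurn * ((sectorPos b - sectorPos a) * halfTurn -
          (sectorPos c - (starRingEnd ℂ) (sectorPos a)) * (starRingEnd ℂ) halfTurn) := by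
      linear_combination turn k * h4 + turn k * (sectorPos c - (starRingEnd ℂ) (sectorPos a)) * h5
    rwa [e, norm_mul, norm_mul, norm_turn, norm_halfTurn, one_mul, one_mul]

/-- Two neighbours of a vertex lie in a common triangle with it, or are neither in opposite
directions nor at distance one. -/
theorem ring_generalPosition {v w w' : Fin ringOrder} (h : ringGraph.Adj v w)
    (h' : ringGraph.Adj v w') :
    (∃ t ∈ ringTriangles, v ∈ t ∧ w ∈ t ∧ w' ∈ t) ∨
      (ringPos w + ringPos w' ≠ 2 * ringPos v ∧ ‖ringPos w - ringPos w'‖ ≠ 1) := by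
  obtain ⟨k, a, b, hab, rfl, rfl⟩ := ringGraph_adj_iff.1 h
  obtain ⟨l, c, d, hcd, hv, rfl⟩ := ringGraph_adj_iff.1 h'
  rcases ringVertex_eq_iff.1 hv with ⟨rfl, rfl⟩ | ⟨rfl, h3, rfl⟩ | ⟨rfl, h3, rfl⟩
  · exact ring_generalPosition_same _ hab hcd
  · right
    rw [← hv, add_comm (ringPos _), norm_sub_rev]
    exact ring_generalPosition_ne k h3 hcd hab
  · exact Or.inr (ring_generalPosition_ne l h3 hab hcd)

section covered

variable {V : Type*} [Finite V] {G : SimpleGraph V} {p : V → ℂ}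

/-- If a segment that starts at a vertex is covered by edges then one of them starts there in the
direction of the segment. -/
theorem exists_adj_of_segment_subset (hp : IsPlanarUnitDistance G p) (x : V) {d : ℂ} (hd : d ≠ 0)
    (h : ∀ t : ℝ, 0 ≤ t → t ≤ 1 → p x + t * d ∈ drawing G p) :
    ∃ w, G.Adj x w ∧ ∃ s : ℝ, 0 < s ∧ d = s * (p w - p x) := by
  set F : Set ℂ := ⋃ e ∈ {e : V × V | G.Adj e.1 e.2 ∧ e.1 ≠ x ∧ e.2 ≠ x},
    segment ℝ (p e.1) (p e.2) with hF
  have hF1 : IsClosed F := by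
    refine Set.Finite.isClosed_biUnion (Set.toFinite _) fun e _ => ?_
    rw [segment_eq_image_lineMap]
    exact (isCompact_Icc.image AffineMap.lineMap_continuous).isClosed
  have hF2 : p x ∉ F := by
    intro hc
    simp only [hF, Set.mem_iUnion] at hc
    obtain ⟨e, ⟨he, h1, h2⟩, h3⟩ := hc
    rcases hp.vertex_on_edge x e.1 e.2 he h3 with h4 | h4
    · exact h1 h4.symm
    · exact h2 h4.symm
  have hcont : Continuous fun t : ℝ => p x + t * d := by fun_prop
  have h1 : ∀ᶠ t : ℝ in nhds 0, p x + t * d ∈ Fᶜ := by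
    refine hcont.continuousAt.eventually_mem (hF1.isOpen_compl.mem_nhds ?_)
    simpa using hF2
  obtain ⟨ε, hε, h2⟩ := Metric.eventually_nhds_iff.1 h1
  set t : ℝ := min (ε / 2) 1 with ht
  have ht0 : 0 < t := lt_min (by linarith) one_pos
  have h3 : p x + t * d ∉ F := by
    refine h2 ?_
    rw [Real.dist_eq, sub_zero, abs_of_pos ht0]
    exact (min_le_left _ _).trans_lt (by linarith)
  have key : ∀ w, G.Adj x w → p x + t * d ∈ segment ℝ (p x) (p w) →
      ∃ w, G.Adj x w ∧ ∃ s : ℝ, 0 < s ∧ d = s * (p w - p x) := by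
    rintro w hw ⟨a, b, ha, hb, hab, h4⟩
    have h5 : (t : ℂ) * d = b * (p w - p x) := by
      have : a = 1 - b := by linarith
      rw [this] at h4
      simp only [Complex.real_smul] at h4
      push_cast at h4
      linear_combination -h4
    have ht0' : (t : ℂ) ≠ 0 := by exact_mod_cast ht0.ne'
    refine ⟨w, hw, b / t, ?_, ?_⟩
    · refine div_pos (lt_of_le_of_ne hb ?_) ht0
      rintro rfl
      simp [hd, ht0'] at h5
    · push_cast
      field_simp
      linear_combination h5
  obtain ⟨a, b, hab, h4⟩ := h t ht0.le (min_le_right _ _)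
  by_cases ha : a = x
  · subst ha
    exact key b hab h4
  by_cases hb : b = x
  · subst hb
    rw [segment_symm] at h4
    exact key a hab.symm h4
  exact absurd (Set.mem_biUnion (show (a, b) ∈ {e : V × V | G.Adj e.1 e.2 ∧ e.1 ≠ x ∧ e.2 ≠ x} from
    ⟨hab, ha, hb⟩) h4) h3

/-- If no vertex has two opposite neighbours then a segment between vertices that is covered by
edges is an edge. -/
theorem adj_of_segment_subset (hp : IsPlanarUnitDistance G p)
    (hop : ∀ v w w', G.Adj v w → G.Adj v w' → p w + p w' ≠ 2 * p v) {x y : V} (hxy : x ≠ y)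
    (h : segment ℝ (p x) (p y) ⊆ drawing G p) : G.Adj x y := by
  have hd : p y - p x ≠ 0 := sub_ne_zero.2 fun hc => hxy (hp.injective hc).symm
  have hmem : ∀ t : ℝ, 0 ≤ t → t ≤ 1 → p x + t * (p y - p x) ∈ segment ℝ (p x) (p y) := by
    intro t h0 h1
    refine ⟨1 - t, t, by linarith, h0, by ring, ?_⟩
    simp only [Complex.real_smul]
    push_cast
    ring
  obtain ⟨w, hw, s, hs, hsw⟩ := exists_adj_of_segment_subset hp x hd fun t h0 h1 => h (hmem t h0 h1)
  rcases le_or_gt s 1 with h1 | h1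
  · have h2 : p y ∈ segment ℝ (p x) (p w) := by
      refine ⟨1 - s, s, by linarith, hs.le, by ring, ?_⟩
      simp only [Complex.real_smul]
      push_cast
      linear_combination -hsw
    rcases hp.vertex_on_edge y x w hw h2 with h3 | h3
    · exact absurd h3.symm hxy
    · rwa [h3]
  · exfalso
    have hs0 : (s : ℂ) ≠ 0 := by exact_mod_cast hs.ne'
    have hn : ‖p w - p x‖ = 1 := by
      rw [norm_sub_rev, ← dist_eq_norm]; exact hp.dist_eq_one x w hw
    have hwx : p w - p x ≠ 0 := fun hc => by simp [hc] at hn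
    have hs1 : ((s - 1 : ℝ) : ℂ) ≠ 0 := by
      rw [Complex.ofReal_ne_zero]; linarith
    obtain ⟨w', hw', s', hs', hsw'⟩ := exists_adj_of_segment_subset hp w
      (d := ((s - 1 : ℝ) : ℂ) * (p w - p x)) (mul_ne_zero hs1 hwx) (by
        intro t h0 h2
        have h3 := hmem ((1 + t * (s - 1)) / s) (by
          have := mul_nonneg h0 (sub_nonneg.2 h1.le)
          positivity) (by
            rw [div_le_one hs]
            nlinarith)
        convert h h3 using 1
        rw [hsw]
        push_cast
        field_simp
        ring)
    have hn' : ‖p w' - p w‖ = 1 := by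
      rw [norm_sub_rev, ← dist_eq_norm]; exact hp.dist_eq_one w w' hw'
    have h4 := congrArg norm hsw'
    rw [norm_mul, norm_mul, hn, hn', mul_one, mul_one, Complex.norm_real, Complex.norm_real,
      Real.norm_of_nonneg (by linarith), Real.norm_of_nonneg hs'.le] at h4
    rw [← h4] at hsw'
    have h5 := mul_left_cancel₀ hs1 hsw'
    refine hop w x w' hw.symm hw' ?_
    linear_combination -h5

end covered

theorem ring_not_opposite (v w w' : Fin ringOrder) (h : ringGraph.Adj v w)
    (h' : ringGraph.Adj v w') : ringPos w + ringPos w' ≠ 2 * ringPos v := by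
  intro hc
  have h1 := norm_ringPos_sub h
  have h2 : ringPos w - ringPos w' = -2 * (ringPos v - ringPos w) := by linear_combination -hc
  have h3 := congrArg norm h2
  rw [norm_mul, h1] at h3
  norm_num at h3
  rcases ring_generalPosition h h' with ⟨t, ht, -, hw, hw'⟩ | h4
  · by_cases hww : w = w'
    · simp [hww] at h3
    · rw [norm_ringPos_sub ⟨hww, t, ht, hw, hw'⟩] at h3
      norm_num at h3
  · exact h4.1 hc

theorem ring_isUnitTriangleGraph : IsUnitTriangleGraph ringGraph ringPos ringTriangles where
  nonempty := ⟨ringVertex 0 0⟩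
  planar := ring_planar
  regular := ringGraph_regular
  triangles _ ht := isNClique_of_mem_ringTriangles ht
  edges _ _ h := existsUnique_ringTriangle h
  no_additional x y z h := by
    obtain ⟨hcol, hxy, hyz, hzx⟩ := h
    have nxy : x ≠ y := by
      rintro rfl
      exact hcol (by simpa using collinear_pair ℝ (ringPos x) (ringPos z))
    have nyz : y ≠ z := by
      rintro rfl
      exact hcol (by simpa using collinear_pair ℝ (ringPos x) (ringPos y))
    have nzx : z ≠ x := by
      rintro rfl
      exact hcol (by
        rw [Set.insert_comm, Set.pair_eq_singleton]
        exact collinear_pair ℝ (ringPos y) (ringPos z))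
    have axy := adj_of_segment_subset ring_planar ring_not_opposite nxy hxy
    have ayz := adj_of_segment_subset ring_planar ring_not_opposite nyz hyz
    have azx := adj_of_segment_subset ring_planar ring_not_opposite nzx hzx
    rcases ring_generalPosition axy azx.symm with ⟨t, ht, hx, hy, hz⟩ | h4
    · have h1 : ({x, y, z} : Finset (Fin ringOrder)) = t := by
        apply Finset.eq_of_subset_of_card_le
        · intro a ha
          simp only [Finset.mem_insert, Finset.mem_singleton] at ha
          rcases ha with rfl | rfl | rfl <;> assumption
        · rw [(isNClique_of_mem_ringTriangles ht).card_eq, Finset.card_eq_three.2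
            ⟨x, y, z, nxy, nzx.symm, nyz, rfl⟩]
      rwa [h1]
    · exact absurd (norm_ringPos_sub ayz) h4.2

/-- The rotation of the ring by one sector. -/
noncomputable def ringShift : ringGraph ≃g ringGraph where
  toEquiv := (ringLabel.symm.trans ((Equiv.addRight 1).prodCongr (Equiv.refl _))).trans ringLabel
  map_rel_iff' := by
    set e := (ringLabel.symm.trans ((Equiv.addRight 1).prodCongr (Equiv.refl _))).trans ringLabel
      with he
    have h1 : ∀ v, ringPos (e v) = fullTurn * ringPos v := by
      intro v
      simp only [he, ringPos, Equiv.trans_apply, Equiv.symm_apply_apply, Equiv.prodCongr_apply,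
        Prod.map_fst, Prod.map_snd, Equiv.refl_apply, Equiv.coe_addRight, turn_add, turn_one]
      ring
    have h2 : ∀ k a, e (ringVertex k a) = ringVertex (k + 1) a := by
      intro k a
      apply ringPos_injective
      rw [h1, ringPos_ringVertex, ringPos_ringVertex, turn_add, turn_one]
      ring
    intro v w
    rw [ringGraph_adj_iff, ringGraph_adj_iff]
    constructor
    · rintro ⟨k, a, b, hab, hv, hw⟩
      refine ⟨k - 1, a, b, hab, e.injective ?_, e.injective ?_⟩
      · rw [h2, sub_add_cancel, hv]
      · rw [h2, sub_add_cancel, hw]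
    · rintro ⟨k, a, b, hab, rfl, rfl⟩
      exact ⟨k + 1, a, b, hab, (h2 k a).symm, (h2 k b).symm⟩

theorem ringPos_ringShift (v : Fin ringOrder) : ringPos (ringShift v) = fullTurn * ringPos v := by
  change ringPos (ringLabel _) = _
  simp only [ringPos, Equiv.symm_apply_apply, Equiv.prodCongr_apply, Equiv.trans_apply,
    Prod.map_fst, Prod.map_snd, Equiv.refl_apply, Equiv.coe_addRight, turn_add, turn_one]
  ring

theorem ringShift_ringVertex (k : ZMod 169) (a : Fin 66) :
    ringShift (ringVertex k a) = ringVertex (k + 1) a := by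
  apply ringPos_injective
  rw [ringPos_ringShift, ringPos_ringVertex, ringPos_ringVertex, turn_add, turn_one]
  ring

theorem ringShift_pow_ringVertex (n : ℕ) (k : ZMod 169) (a : Fin 66) :
    (ringShift ^ n) (ringVertex k a) = ringVertex (k + n) a := by
  induction n with
  | zero => simp
  | succ n ih =>
    rw [pow_succ', RelIso.mul_apply, ih, ringShift_ringVertex]
    push_cast
    rw [add_assoc]

theorem ringPos_ringShift_pow (n : ℕ) (v : Fin ringOrder) :
    ringPos ((ringShift ^ n) v) = fullTurn ^ n * ringPos v := by
  obtain ⟨k, a, -, rfl⟩ := exists_ringVertex v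
  rw [ringShift_pow_ringVertex, ringPos_ringVertex, ringPos_ringVertex, turn_add, turn_natCast]
  ring

theorem exists_smaller_neighbor : ∀ a : Fin 66, a ≠ 0 → ∃ (i : Fin 38) (j k : Fin 3), j ≠ k ∧
    corner i j = a ∧ corner i k < a := by
  decide +kernel

theorem G₂_reachable (a : Fin 66) : G₂.Reachable 0 a := by
  induction a using WellFoundedLT.induction with
  | ind a ih =>
    by_cases h : a = 0
    · rw [h]
    · obtain ⟨i, j, k, hjk, rfl, hlt⟩ := exists_smaller_neighbor a h
      exact (ih _ hlt).trans
        ((adj_iff_corner _ _).2 ⟨i, k, j, hjk.symm, rfl, rfl⟩).reachable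

/-- The homomorphism of `G₂` to a copy in the ring. -/
noncomputable def ringHom (k : ZMod 169) : G₂ →g ringGraph where
  toFun := ringVertex k
  map_rel' h := ringGraph_adj h

theorem ring_connected : ringGraph.Connected := by
  have h1 : ∀ k a, ringGraph.Reachable (ringVertex k 0) (ringVertex k a) :=
    fun k a => (G₂_reachable a).map (ringHom k)
  have h2 : ∀ n : ℕ, ringGraph.Reachable (ringVertex 0 0) (ringVertex n 0) := by
    intro n
    induction n with
    | zero => simp
    | succ n ih =>
      have h3 := h1 (n + 1) 16
      rw [show ringVertex ((n : ZMod 169) + 1) 16 = ringVertex n 46 from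
        ringVertex_add_one (by decide) _] at h3
      push_cast
      exact (ih.trans (h1 _ _)).trans h3.symm
  have h3 : ∀ v, ringGraph.Reachable (ringVertex 0 0) v := by
    intro v
    obtain ⟨k, a, -, rfl⟩ := exists_ringVertex v
    have h4 := h2 k.val
    rw [ZMod.natCast_zmod_val] at h4
    exact h4.trans (h1 k a)
  have : Nonempty (Fin ringOrder) := ⟨ringVertex 0 0⟩
  exact ⟨fun v w => (h3 v).symm.trans (h3 w)⟩

theorem sectorCoord_min_radius : ∀ a : Fin 66, a = 35 ∨ a = 65 ∨
    (sectorCoord 35).1 ^ 2 + (sectorCoord 35).2 ^ 2 + 10 ^ 40 <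
      (sectorCoord a).1 ^ 2 + (sectorCoord a).2 ^ 2 := by decide +kernel

theorem sectorPos_min_radius {a : Fin 66} (h : ‖sectorPos a‖ = ‖sectorPos 35‖) :
    a = 35 ∨ a = 65 := by
  rcases sectorCoord_min_radius a with h1 | h1 | h1
  · exact Or.inl h1
  · exact Or.inr h1
  · exfalso
    have e : ∀ a, ‖ofCoord (sectorCoord a)‖ ^ 2 =
        ((sectorCoord a).1 ^ 2 + (sectorCoord a).2 ^ 2) / 10 ^ 40 := by
      intro a
      rw [← Complex.normSq_eq_norm_sq, Complex.normSq_apply]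
      simp [ofCoord]
      ring
    have h2 : ((sectorCoord 35).1 ^ 2 + (sectorCoord 35).2 ^ 2 + 10 ^ 40 : ℝ) <
      (sectorCoord a).1 ^ 2 + (sectorCoord a).2 ^ 2 := by exact_mod_cast h1
    have h3 : ‖ofCoord (sectorCoord 35)‖ ^ 2 + 1 < ‖ofCoord (sectorCoord a)‖ ^ 2 := by
      rw [e, e]
      rw [div_add_one (by positivity)]
      exact div_lt_div_of_pos_right h2 (by positivity)
    have h4 := (abs_norm_sub_norm_le _ _).trans (norm_sectorPos_sub_sectorCoord a)
    have h5 := (abs_norm_sub_norm_le _ _).trans (norm_sectorPos_sub_sectorCoord 35)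
    rw [h] at h4
    have h6 : ‖ofCoord (sectorCoord 35)‖ ≤ 107 := by
      obtain ⟨⟨a1, a2⟩, a3, a4⟩ := sectorCoord_bounds 35
      have a1' : (95 * 10 ^ 20 : ℝ) ≤ (sectorCoord 35).1 := by exact_mod_cast a1
      have a2' : ((sectorCoord 35).1 : ℝ) ≤ 105 * 10 ^ 20 := by exact_mod_cast a2
      have a3' : (-2 * 10 ^ 20 : ℝ) ≤ (sectorCoord 35).2 := by exact_mod_cast a3
      have a4' : ((sectorCoord 35).2 : ℝ) ≤ 2 * 10 ^ 20 := by exact_mod_cast a4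
      refine (norm_le_of_abs_le (b := 105) (c := 2) ?_ ?_).trans (by norm_num) <;>
        simp only [ofCoord] <;> rw [abs_le] <;> constructor <;> linarith
    have h7 : ‖ofCoord (sectorCoord a)‖ ≤ ‖ofCoord (sectorCoord 35)‖ + 22 / 10 ^ 12 := by
      linarith [(abs_le.1 h4).1, (abs_le.1 h5).2]
    nlinarith [norm_nonneg (ofCoord (sectorCoord a)), norm_nonneg (ofCoord (sectorCoord 35))]

theorem ring_isSymmetry_iff {u : ℂ} (hu : ‖u‖ = 1) :
    IsSymmetry ringGraph ringPos (rotateAbout 0 u) ↔ u ^ 169 = 1 := by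
  constructor
  · rintro ⟨σ, hσ⟩
    obtain ⟨k, a, ha, h1⟩ := exists_ringVertex (σ (ringVertex 0 35))
    have h3 := hσ (ringVertex 0 35)
    simp only [rotateAbout, sub_zero, zero_add] at h3
    rw [← h1, ringPos_ringVertex, ringPos_ringVertex, turn_zero, one_mul] at h3
    have hp : sectorPos 35 ≠ 0 := fun hc => by
      have := sectorPos_re_pos 35
      simp [hc] at this
    have h4 := congrArg norm h3
    rw [norm_mul, norm_mul, norm_turn, hu, one_mul, one_mul] at h4
    rcases sectorPos_min_radius h4 with rfl | rfl
    · rw [← mul_right_cancel₀ hp h3, turn, ← pow_mul, mul_comm, pow_mul, fullTurn_pow, one_pow]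
    · exact absurd (by decide) ha
  · intro h
    have hprim := Complex.isPrimitiveRoot_exp 169 (by norm_num)
    obtain ⟨n, -, hn⟩ := hprim.eq_pow_of_pow_eq_one h
    refine ⟨ringShift ^ n, fun v => ?_⟩
    rw [ringPos_ringShift_pow, rotateAbout, fullTurn_eq_exp]
    push_cast at hn
    rw [hn]
    simp

/-- The first copy of `G₂` in the ring. -/
noncomputable def ringCopy : SimpleGraph.Copy G₂ ringGraph := ⟨ringHom 0, ringVertex_injective 0⟩

theorem ringCopy_apply (a : Fin 66) : ringCopy a = ringVertex 0 a := rfl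

theorem ringPos_ringCopy (a : Fin 66) : ringPos (ringCopy a) = sectorPos a := by
  rw [ringCopy_apply, ringPos_ringVertex, turn_zero, one_mul]

theorem mem_ringTriangles_iff_exists_copy (t : Finset (Fin ringOrder)) :
    t ∈ ringTriangles ↔
      ∃ k < 169, ∃ s ∈ G₂Triangles, t = s.image fun a => (ringShift ^ k) (ringCopy a) := by
  have h1 : ∀ (n : ℕ) (i : Fin 38), ((Finset.univ.image (corner i)).image fun a =>
      (ringShift ^ n) (ringCopy a)) = ringTriangle ((n : ZMod 169), i) := by
    intro n i
    rw [Finset.image_image]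
    refine Finset.image_congr fun j _ => ?_
    simp only [Function.comp_apply, ringCopy_apply, ringShift_pow_ringVertex, zero_add]
  rw [mem_ringTriangles]
  constructor
  · rintro ⟨⟨k, i⟩, rfl⟩
    refine ⟨k.val, ZMod.val_lt k, Finset.univ.image (corner i), ?_, ?_⟩
    · rw [G₂Triangles_eq]
      exact Finset.mem_image_of_mem _ (Finset.mem_univ i)
    · rw [h1, ZMod.natCast_zmod_val]
  · rintro ⟨n, -, s, hs, rfl⟩
    rw [G₂Triangles_eq] at hs
    obtain ⟨i, -, rfl⟩ := Finset.mem_image.1 hs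
    exact ⟨_, (h1 n i).symm⟩

/-- The reflection of `G₂` in its axis of symmetry. -/
def mirrorIso : G₂ ≃g G₂ where
  toFun := mirror
  invFun := mirror
  left_inv := mirror_mirror
  right_inv := mirror_mirror
  map_rel_iff' := by
    intro a b
    refine ⟨fun h => ?_, adj_mirror⟩
    have := adj_mirror h
    simpa only [Equiv.coe_fn_mk, mirror_mirror] using this

theorem ringCopy_isSymmetry :
    IsSymmetry G₂ (fun a => ringPos (ringCopy a)) (reflectAbout 0 1) := by
  refine ⟨mirrorIso, fun a => ?_⟩
  simp only [ringPos_ringCopy, reflectAbout, sub_zero, one_mul, zero_add]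
  exact sectorPos_mirror a

/-- A chain of three unit bars with fixed ends, not stretched, can be moved. -/
theorem exists_fourBar_motion {a b c : ℂ} (hb : ‖b‖ = 1) (hc : ‖c‖ = 1) (hbc : b ≠ c)
    (hbc' : b + c ≠ 0) : ∃ ω₁ ω₂ ω₃ : ℝ → ℂ,
      (∀ θ, ω₁ θ = Complex.exp (θ * Complex.I)) ∧
      ContinuousAt ω₁ 0 ∧ ContinuousAt ω₂ 0 ∧ ContinuousAt ω₃ 0 ∧ ω₂ 0 = 1 ∧ ω₃ 0 = 1 ∧
      ∀ᶠ θ in nhds 0, ‖ω₁ θ‖ = 1 ∧ ‖ω₂ θ‖ = 1 ∧ ‖ω₃ θ‖ = 1 ∧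
        ω₁ θ * a + ω₂ θ * b + ω₃ θ * c = a + b + c := by
  have hb0 : b ≠ 0 := fun h => by simp [h] at hb
  have hc0 : c ≠ 0 := fun h => by simp [h] at hc
  set d : ℝ → ℂ := fun θ => a + b + c - Complex.exp (θ * Complex.I) * a with hd
  have hd0 : d 0 = b + c := by simp [hd]; ring
  have hdc : Continuous d := by fun_prop
  set y₀ : ℝ := (b / (b + c)).im with hy₀
  have hb1 : b / (b + c) = 1 / 2 + y₀ * Complex.I := by
    have h1 : (b / (b + c)).re = 1 / 2 := by
      have h2 : ‖b / (b + c)‖ = ‖1 - b / (b + c)‖ := by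
        have : 1 - b / (b + c) = c / (b + c) := by field_simp; ring
        rw [this, norm_div, norm_div, hb, hc]
      have h3 := congrArg (· ^ 2) h2
      simp only [← Complex.normSq_eq_norm_sq, Complex.normSq_apply, Complex.sub_re, Complex.sub_im,
        Complex.one_re, Complex.one_im] at h3
      linarith
    apply Complex.ext <;> simp [h1, hy₀]
  have hy₀' : y₀ ≠ 0 := by
    intro h
    rw [h] at hb1
    apply hbc
    field_simp at hb1
    simp at hb1
    linear_combination hb1
  have hnorm : ∀ y : ℝ, ‖(1 / 2 + y * Complex.I : ℂ)‖ ^ 2 = 1 / 4 + y ^ 2 := by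
    intro y
    rw [← Complex.normSq_eq_norm_sq, Complex.normSq_apply]
    simp
    ring
  have hy₀2 : 1 / ‖b + c‖ ^ 2 - 1 / 4 = y₀ ^ 2 := by
    have h1 := hnorm y₀
    rw [← hb1, norm_div, hb, div_pow, one_pow] at h1
    linarith
  set y : ℝ → ℝ := fun θ => y₀ * √((1 / ‖d θ‖ ^ 2 - 1 / 4) / y₀ ^ 2) with hy
  have hn0 : ‖d 0‖ ≠ 0 := by rw [hd0]; exact norm_ne_zero_iff.2 hbc'
  have hratio : ContinuousAt (fun θ => (1 / ‖d θ‖ ^ 2 - 1 / 4) / y₀ ^ 2) 0 := by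
    refine ContinuousAt.div_const (ContinuousAt.sub (ContinuousAt.div continuousAt_const
      (hdc.norm.pow 2).continuousAt (pow_ne_zero 2 hn0)) continuousAt_const) _
  have hratio0 : (1 / ‖d 0‖ ^ 2 - 1 / 4) / y₀ ^ 2 = 1 := by
    rw [hd0, hy₀2, div_self (pow_ne_zero 2 hy₀')]
  have hyc : ContinuousAt y 0 := continuousAt_const.mul hratio.sqrt
  have hy0 : y 0 = y₀ := by simp only [hy]; rw [hratio0, Real.sqrt_one, mul_one]
  have hwc : ContinuousAt (fun θ => d θ * (1 / 2 + y θ * Complex.I)) 0 :=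
    hdc.continuousAt.mul (continuousAt_const.add
      ((Complex.continuous_ofReal.continuousAt.comp hyc).mul continuousAt_const))
  have hw0 : d 0 * (1 / 2 + y 0 * Complex.I) = b := by
    rw [hy0, ← hb1, hd0, mul_div_cancel₀ _ hbc']
  refine ⟨fun θ => Complex.exp (θ * Complex.I), fun θ => d θ * (1 / 2 + y θ * Complex.I) / b,
    fun θ => (d θ - d θ * (1 / 2 + y θ * Complex.I)) / c, fun _ => rfl,
    Continuous.continuousAt (by fun_prop), hwc.div_const b, (hdc.continuousAt.sub hwc).div_const c,
    ?_, ?_, ?_⟩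
  · simp only [hw0]
    exact div_self hb0
  · change (d 0 - d 0 * (1 / 2 + y 0 * Complex.I)) / c = 1
    rw [hw0, hd0, add_sub_cancel_left, div_self hc0]
  · have hratio1 : 0 < (1 / ‖d 0‖ ^ 2 - 1 / 4) / y₀ ^ 2 := by rw [hratio0]; exact one_pos
    have h1 : ∀ᶠ θ in nhds 0, d θ ≠ 0 :=
      hdc.continuousAt.eventually_ne (by rw [hd0]; exact hbc')
    have h2 : ∀ᶠ θ in nhds 0, 0 < (1 / ‖d θ‖ ^ 2 - 1 / 4) / y₀ ^ 2 :=
      hratio.eventually_const_lt hratio1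
    filter_upwards [h1, h2] with θ h3 h4
    have h5 : 1 / 4 + y θ ^ 2 = 1 / ‖d θ‖ ^ 2 := by
      simp only [hy]
      rw [mul_pow, Real.sq_sqrt h4.le]
      field_simp
      ring
    have h6 : ∀ z : ℝ, z ^ 2 = y θ ^ 2 → ‖d θ * (1 / 2 + z * Complex.I)‖ = 1 := by
      intro z hz
      have h7 := hnorm z
      rw [hz, h5] at h7
      have h8 : ‖d θ * (1 / 2 + z * Complex.I)‖ ^ 2 = 1 := by
        rw [norm_mul, mul_pow, h7, mul_one_div_cancel]
        exact pow_ne_zero 2 (norm_ne_zero_iff.2 h3)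
      exact (pow_eq_one_iff_of_nonneg (norm_nonneg _) two_ne_zero).1 h8
    refine ⟨Complex.norm_exp_ofReal_mul_I θ, ?_, ?_, ?_⟩
    · rw [norm_div, hb, div_one, h6 _ rfl]
    · rw [norm_div, hc, div_one, ← h6 (-y θ) (by ring)]
      congr 1
      push_cast
      ring
    · rw [div_mul_cancel₀ _ hb0, div_mul_cancel₀ _ hc0]
      simp only [hd]
      ring

theorem eq_zero_of_inner_eq_zero {u v z : ℂ} (hu : ‖u‖ = 1) (hv : ‖v‖ = 1) (huv : ‖u - v‖ = 1)
    (h1 : z.re * u.re + z.im * u.im = 0) (h2 : z.re * v.re + z.im * v.im = 0) : z = 0 := by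
  have e : ∀ w : ℂ, ‖w‖ = 1 → w.re ^ 2 + w.im ^ 2 = 1 := by
    intro w hw
    have := Complex.normSq_eq_norm_sq w
    rw [hw, Complex.normSq_apply] at this
    linarith
  have hu' := e u hu
  have hv' := e v hv
  have huv' := e _ huv
  rw [Complex.sub_re, Complex.sub_im] at huv'
  have h3 : (u.re * v.im - u.im * v.re) ^ 2 = 3 / 4 := by
    have h4 : u.re * v.re + u.im * v.im = 1 / 2 := by linarith
    have h5 : (u.re * v.im - u.im * v.re) ^ 2 =
        (u.re ^ 2 + u.im ^ 2) * (v.re ^ 2 + v.im ^ 2) - (u.re * v.re + u.im * v.im) ^ 2 := by ring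
    rw [h5, hu', hv', h4]
    norm_num
  have h6 : u.re * v.im - u.im * v.re ≠ 0 := fun h => by rw [h] at h3; norm_num at h3
  have hr : z.re * (u.re * v.im - u.im * v.re) = 0 := by linear_combination v.im * h1 - u.im * h2
  have hi : z.im * (u.re * v.im - u.im * v.re) = 0 := by linear_combination u.re * h2 - v.re * h1
  exact Complex.ext ((mul_eq_zero.1 hr).resolve_right h6) ((mul_eq_zero.1 hi).resolve_right h6)

/-- A point is determined by its distances from the corners of a unit triangle. -/
theorem eq_of_norm_sub_eq {a b c z w : ℂ} (hab : ‖a - b‖ = 1) (hac : ‖a - c‖ = 1)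
    (hbc : ‖b - c‖ = 1) (ha : ‖z - a‖ = ‖w - a‖) (hb : ‖z - b‖ = ‖w - b‖)
    (hc : ‖z - c‖ = ‖w - c‖) : z = w := by
  have e : ∀ x, ‖z - x‖ = ‖w - x‖ →
      (z.re - x.re) ^ 2 + (z.im - x.im) ^ 2 = (w.re - x.re) ^ 2 + (w.im - x.im) ^ 2 := by
    intro x hx
    have h1 := Complex.normSq_eq_norm_sq (z - x)
    have h2 := Complex.normSq_eq_norm_sq (w - x)
    rw [hx, ← h2, Complex.normSq_apply, Complex.normSq_apply] at h1
    simp only [Complex.sub_re, Complex.sub_im] at h1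
    linarith
  have ha' := e a ha
  have hb' := e b hb
  have hc' := e c hc
  apply sub_eq_zero.1
  refine eq_zero_of_inner_eq_zero hab hac (by rw [← hbc, ← norm_neg]; ring_nf) ?_ ?_ <;>
    simp only [Complex.sub_re, Complex.sub_im] <;> linarith

theorem corner_mem_chain : ∀ i : Fin 38, i = 17 ∨ i = 18 ∨ i = 19 ∨
    ∀ j, corner i j ≠ 19 ∧ corner i j ≠ 20 ∧ corner i j ≠ 21 ∧ corner i j ≠ 22 ∧ corner i j ≠ 23 := by
  decide +kernel

theorem generalPosition_chain : generalPosition 22 20 24 = true := by decide +kernel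

theorem isFlexible_sectorPos : IsFlexible G₂ sectorPos := by
  rintro ⟨ε, hε, hrig⟩
  have adj : ∀ (i : Fin 38) (j k : Fin 3), j ≠ k → G₂.Adj (corner i j) (corner i k) :=
    fun i j k h => (adj_iff_corner _ _).2 ⟨i, j, k, h, rfl, rfl⟩
  have h2220 : ‖sectorPos 22 - sectorPos 20‖ = 1 :=
    norm_sectorPos_sub _ _ (adj 18 2 0 (by decide))
  have h2422 : ‖sectorPos 24 - sectorPos 22‖ = 1 :=
    norm_sectorPos_sub _ _ (adj 19 2 0 (by decide))
  obtain ⟨ω₁, ω₂, ω₃, h1, c1, c2, c3, e2, e3, hω⟩ := exists_fourBar_motion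
    (a := sectorPos 20 - sectorPos 18) h2220 h2422 (by
      intro h
      refine (sectorPos_generalPosition generalPosition_chain).1 ?_
      linear_combination -h) (by
      intro h
      have h3 : sectorPos 24 = sectorPos 20 := by linear_combination h
      exact absurd (sectorPos_injective h3) (by decide))
  have e1 : ω₁ 0 = 1 := by rw [h1]; simp
  set q : ℝ → Fin 66 → ℂ := fun θ v =>
    if v = 19 then sectorPos 18 + ω₁ θ * (sectorPos 19 - sectorPos 18)
    else if v = 20 then sectorPos 18 + ω₁ θ * (sectorPos 20 - sectorPos 18)
    else if v = 21 then sectorPos 18 + ω₁ θ * (sectorPos 20 - sectorPos 18) +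
      ω₂ θ * (sectorPos 21 - sectorPos 20)
    else if v = 22 then sectorPos 24 - ω₃ θ * (sectorPos 24 - sectorPos 22)
    else if v = 23 then sectorPos 24 - ω₃ θ * (sectorPos 24 - sectorPos 23)
    else sectorPos v with hq
  have hq0 : ∀ v, q 0 v = sectorPos v := by
    intro v
    simp only [hq, e1, e2, e3]
    split_ifs <;> simp_all
  have hqc : ∀ v, ContinuousAt (fun θ => q θ v) 0 := by
    intro v
    simp only [hq]
    split_ifs <;> fun_prop
  have hclose : ∀ᶠ θ in nhds 0, ∀ v, dist (q θ v) (sectorPos v) < ε := by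
    rw [Filter.eventually_all]
    intro v
    have := Metric.continuousAt_iff'.1 (hqc v) ε hε
    simpa only [hq0] using this
  have hpos : ∀ᶠ θ : ℝ in nhdsWithin 0 (Set.Ioi 0), 0 < θ ∧ θ < 1 :=
    Ioo_mem_nhdsGT one_pos
  obtain ⟨θ, ⟨hθ0, hθ1⟩, hclose, n1, n2, n3, hsum⟩ := (hpos.and
    ((hclose.filter_mono nhdsWithin_le_nhds).and (hω.filter_mono nhdsWithin_le_nhds))).exists
  have hrigid : ∀ i : Fin 38, ∃ b ω : ℂ, ‖ω‖ = 1 ∧ ∀ j, q θ (corner i j) =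
      b + ω * sectorPos (corner i j) := by
    intro i
    rcases corner_mem_chain i with rfl | rfl | rfl | h
    · refine ⟨sectorPos 18 - ω₁ θ * sectorPos 18, ω₁ θ, n1, fun j => ?_⟩
      fin_cases j
      · change sectorPos 18 = _ + _ * sectorPos 18
        ring
      · change sectorPos 18 + ω₁ θ * (sectorPos 19 - sectorPos 18) = _ + _ * sectorPos 19
        ring
      · change sectorPos 18 + ω₁ θ * (sectorPos 20 - sectorPos 18) = _ + _ * sectorPos 20
        ring
    · refine ⟨sectorPos 18 + ω₁ θ * (sectorPos 20 - sectorPos 18) - ω₂ θ * sectorPos 20, ω₂ θ, n2,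
        fun j => ?_⟩
      fin_cases j
      · change sectorPos 18 + ω₁ θ * (sectorPos 20 - sectorPos 18) = _ + _ * sectorPos 20
        ring
      · change sectorPos 18 + ω₁ θ * (sectorPos 20 - sectorPos 18) +
          ω₂ θ * (sectorPos 21 - sectorPos 20) = _ + _ * sectorPos 21
        ring
      · change sectorPos 24 - ω₃ θ * (sectorPos 24 - sectorPos 22) = _ + _ * sectorPos 22
        linear_combination -hsum
    · refine ⟨sectorPos 24 - ω₃ θ * sectorPos 24, ω₃ θ, n3, fun j => ?_⟩
      fin_cases j
      · change sectorPos 24 - ω₃ θ * (sectorPos 24 - sectorPos 22) = _ + _ * sectorPos 22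
        ring
      · change sectorPos 24 - ω₃ θ * (sectorPos 24 - sectorPos 23) = _ + _ * sectorPos 23
        ring
      · change sectorPos 24 = _ + _ * sectorPos 24
        ring
    · refine ⟨0, 1, norm_one, fun j => ?_⟩
      obtain ⟨h1, h2, h3, h4, h5⟩ := h j
      simp only [hq]
      rw [if_neg h1, if_neg h2, if_neg h3, if_neg h4, if_neg h5]
      ring
  have hcong := hrig (q θ) (by
    intro x y hxy
    obtain ⟨i, j, k, -, rfl, rfl⟩ := (adj_iff_corner _ _).1 hxy
    obtain ⟨b, ω, hω, h⟩ := hrigid i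
    rw [h j, h k, dist_eq_norm, dist_eq_norm, add_sub_add_left_eq_sub, ← mul_sub, norm_mul, hω,
      one_mul]) hclose
  have h20 : q θ 20 = sectorPos 20 := by
    have d0 := hcong 20 0
    have d1 := hcong 20 1
    have d2 := hcong 20 2
    have f0 : q θ 0 = sectorPos 0 := rfl
    have f1 : q θ 1 = sectorPos 1 := rfl
    have f2 : q θ 2 = sectorPos 2 := rfl
    rw [dist_eq_norm, dist_eq_norm] at d0 d1 d2
    rw [f0] at d0
    rw [f1] at d1
    rw [f2] at d2
    exact eq_of_norm_sub_eq (norm_sectorPos_sub _ _ (adj 0 0 1 (by decide)))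
      (norm_sectorPos_sub _ _ (adj 0 0 2 (by decide)))
      (norm_sectorPos_sub _ _ (adj 0 1 2 (by decide))) d0 d1 d2
  have f20 : q θ 20 = sectorPos 18 + ω₁ θ * (sectorPos 20 - sectorPos 18) := rfl
  rw [f20] at h20
  have hne : sectorPos 20 - sectorPos 18 ≠ 0 := sub_ne_zero.2 fun h =>
    absurd (sectorPos_injective h) (by decide)
  have h21 : ω₁ θ = 1 := by
    apply mul_right_cancel₀ hne
    linear_combination h20
  have h22 := congrArg Complex.im ((h1 θ).symm.trans h21)
  rw [Complex.exp_ofReal_mul_I_im, Complex.one_im] at h22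
  have hpi := Real.pi_gt_three
  exact (Real.sin_pos_of_pos_of_lt_pi hθ0 (by linarith)).ne' h22

section infinitesimal

variable {V : Type*} [Fintype V]

/-- The rigidity map of the framework `(G, m)`, extended by the values that determine a trivial
motion. -/
noncomputable def rigidityMap (G : SimpleGraph V) [DecidableRel G.Adj] (v₀ v₁ : V) (m : V → ℂ) :
    (V → ℂ) →L[ℝ] ({e : V × V // G.Adj e.1 e.2} → ℝ) × ℂ × ℝ :=
  LinearMap.toContinuousLinearMap
    { toFun := fun d => (fun e => inner ℝ (m e.1.1 - m e.1.2) (d e.1.1 - d e.1.2), d v₀,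
        inner ℝ (Complex.I * (m v₁ - m v₀)) (d v₁ - d v₀))
      map_add' := by
        intro d d'
        ext <;> simp only [Pi.add_apply, Prod.mk_add_mk] <;>
          simp only [add_sub_add_comm, inner_add_right]
      map_smul' := by
        intro c d
        ext <;> simp only [Pi.smul_apply, Prod.smul_mk, ← smul_sub, inner_smul_right,
          RingHom.id_apply, smul_eq_mul] }

theorem rigidityMap_apply (G : SimpleGraph V) [DecidableRel G.Adj] (v₀ v₁ : V) (m d : V → ℂ) :
    rigidityMap G v₀ v₁ m d = (fun e => inner ℝ (m e.1.1 - m e.1.2) (d e.1.1 - d e.1.2), d v₀,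
        inner ℝ (Complex.I * (m v₁ - m v₀)) (d v₁ - d v₀)) := rfl

theorem continuous_rigidityMap (G : SimpleGraph V) [DecidableRel G.Adj] (v₀ v₁ : V) :
    Continuous (rigidityMap G v₀ v₁) := by
  refine (continuous_clm_apply (𝕜 := ℝ) (E := V → ℂ)).2 fun d => ?_
  simp only [rigidityMap_apply]
  fun_prop

theorem inner_I_mul_self (s : ℝ) (z : ℂ) : inner ℝ z (Complex.I * s * z) = 0 := by
  simp [Complex.inner]
  ring

/-- A framework is rigid if all its infinitesimal motions are trivial. -/
theorem isRigid_of_infinitesimal {G : SimpleGraph V} {p : V → ℂ} (hne : ∃ v₀ v₁, p v₀ ≠ p v₁)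
    (h : ∀ d : V → ℂ, (∀ x y, G.Adj x y → inner ℝ (p x - p y) (d x - d y) = (0 : ℝ)) →
      ∃ (t : ℂ) (s : ℝ), ∀ v, d v = t + Complex.I * s * p v) : IsRigid G p := by
  classical
  obtain ⟨v₀, v₁, h01⟩ := hne
  have hinj : Function.Injective (rigidityMap G v₀ v₁ p) := by
    rw [injective_iff_map_eq_zero]
    intro d hd
    rw [rigidityMap_apply, Prod.mk_eq_zero, Prod.mk_eq_zero] at hd
    obtain ⟨h1, h2, h3⟩ := hd
    obtain ⟨t, s, hts⟩ := h d fun x y hxy => congrFun h1 ⟨(x, y), hxy⟩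
    rw [hts v₀] at h2
    have h4 : d v₁ - d v₀ = (s : ℝ) • (Complex.I * (p v₁ - p v₀)) := by
      rw [hts, hts, Complex.real_smul]
      ring
    rw [h4, inner_smul_right, real_inner_self_eq_norm_sq] at h3
    have h5 : s = 0 := by
      refine (mul_eq_zero.1 h3).resolve_right (pow_ne_zero 2 (norm_ne_zero_iff.2 ?_))
      exact mul_ne_zero Complex.I_ne_zero (sub_ne_zero.2 h01.symm)
    ext v
    rw [hts v]
    rw [h5] at h2 ⊢
    simpa using h2
  have hopen : ∀ᶠ m in nhds p, Function.Injective (rigidityMap G v₀ v₁ m) :=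
    (continuous_rigidityMap G v₀ v₁).continuousAt.preimage_mem_nhds
      (ContinuousLinearMap.isOpen_injective.mem_nhds hinj)
  have hopen' : ∀ᶠ m : V → ℂ in nhds p, m v₁ - m v₀ ≠ 0 :=
    ContinuousAt.eventually_ne (by fun_prop) (sub_ne_zero.2 h01.symm)
  obtain ⟨ε, hε, hball⟩ := Metric.eventually_nhds_iff.1 (hopen.and hopen')
  refine ⟨ε, hε, fun q hq hqp x y => ?_⟩
  set m : V → ℂ := fun v => (p v + q v) / 2 with hm
  set d : V → ℂ := fun v => q v - p v with hd
  have hmp : dist m p < ε := by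
    rw [dist_pi_lt_iff hε]
    intro v
    have : m v - p v = (q v - p v) / 2 := by simp only [hm]; ring
    rw [dist_eq_norm, this, norm_div, Complex.norm_ofNat, ← dist_eq_norm]
    linarith [hqp v, dist_nonneg (x := q v) (y := p v)]
  obtain ⟨hm1, hm2⟩ := hball hmp
  have hinner : ∀ x y, inner ℝ (m x - m y) (d x - d y) =
      (‖q x - q y‖ ^ 2 - ‖p x - p y‖ ^ 2) / 2 := by
    intro x y
    have e1 : m x - m y = (1 / 2 : ℝ) • ((q x - q y) + (p x - p y)) := by
      simp only [hm, Complex.real_smul]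
      push_cast
      ring
    have e2 : d x - d y = (q x - q y) - (p x - p y) := by simp only [hd]; ring
    rw [e1, e2]
    generalize q x - q y = A
    generalize p x - p y = B
    rw [inner_smul_left, inner_add_left, inner_sub_right, inner_sub_right,
      real_inner_self_eq_norm_sq, real_inner_self_eq_norm_sq, real_inner_comm A]
    simp only [conj_trivial]
    ring
  set w : ℂ := Complex.I * (m v₁ - m v₀) with hw
  have hw0 : ‖w‖ ^ 2 ≠ 0 :=
    pow_ne_zero 2 (norm_ne_zero_iff.2 (mul_ne_zero Complex.I_ne_zero hm2))
  set s : ℝ := inner ℝ w (d v₁ - d v₀) / ‖w‖ ^ 2 with hs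
  set d' : V → ℂ := fun v => d v - d v₀ - Complex.I * s * (m v - m v₀) with hd'
  have hd'0 : d' = 0 := by
    apply hm1
    rw [map_zero, rigidityMap_apply, Prod.mk_eq_zero, Prod.mk_eq_zero]
    refine ⟨?_, by simp [hd'], ?_⟩
    · ext ⟨⟨a, b⟩, hab⟩
      have e : d' a - d' b = (d a - d b) - Complex.I * s * (m a - m b) := by
        simp only [hd']; ring
      change inner ℝ (m a - m b) (d' a - d' b) = 0
      rw [e, inner_sub_right, inner_I_mul_self, hinner, ← dist_eq_norm, ← dist_eq_norm, hq a b hab]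
      simp
    · have e : d' v₁ - d' v₀ = (d v₁ - d v₀) - s • w := by
        simp only [hd', hw, Complex.real_smul]; ring
      rw [e, ← hw, inner_sub_right, inner_smul_right, real_inner_self_eq_norm_sq, hs,
        div_mul_cancel₀ _ hw0, sub_self]
  have hxy : d x - d y = Complex.I * s * (m x - m y) := by
    have h1 := congrFun hd'0 x
    have h2 := congrFun hd'0 y
    simp only [hd', Pi.zero_apply] at h1 h2
    linear_combination h1 - h2
  have h3 := hinner x y
  rw [hxy, inner_I_mul_self] at h3
  rw [dist_eq_norm, dist_eq_norm]
  have h4 : ‖q x - q y‖ ^ 2 = ‖p x - p y‖ ^ 2 := by linarith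
  exact (sq_eq_sq₀ (norm_nonneg _) (norm_nonneg _)).1 h4

end infinitesimal

theorem inner_eq_zero_iff_exists {u z : ℂ} (hu : ‖u‖ = 1) (h : inner ℝ u z = (0 : ℝ)) :
    ∃ w : ℝ, z = Complex.I * w * u := by
  have hu1 : u.re ^ 2 + u.im ^ 2 = 1 := by
    have := Complex.normSq_eq_norm_sq u
    rw [hu, Complex.normSq_apply] at this
    linarith
  have h1 : u.re * z.re + u.im * z.im = 0 := by
    rw [← h]; simp [Complex.inner]; ring
  refine ⟨u.re * z.im - u.im * z.re, ?_⟩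
  apply Complex.ext
  · simp
    linear_combination u.re * h1 - z.re * hu1
  · simp
    linear_combination u.im * h1 - z.im * hu1

theorem eq_of_real_combination {u v : ℂ} (hu : ‖u‖ = 1) (hv : ‖v‖ = 1) (h1 : u ≠ v) (h2 : u ≠ -v)
    {s t : ℝ} (h : s * u + t * v = 0) : s = 0 ∧ t = 0 := by
  have key : ∀ {u v : ℂ} {s t : ℝ}, ‖u‖ = 1 → ‖v‖ = 1 → u ≠ v → u ≠ -v → s * u + t * v = 0 →
      s = 0 := by
    intro u v s t hu hv h1 h2 h
    have h3 : (s : ℂ) * u = -(t * v) := by linear_combination h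
    have h4 := congrArg norm h3
    rw [norm_neg, norm_mul, norm_mul, hu, hv, mul_one, mul_one, Complex.norm_real,
      Complex.norm_real, Real.norm_eq_abs, Real.norm_eq_abs, abs_eq_abs] at h4
    by_contra hs
    have hs' : (s : ℂ) ≠ 0 := by exact_mod_cast hs
    rcases h4 with h4 | h4
    · apply h2
      apply mul_left_cancel₀ hs'
      rw [← h4] at h3
      linear_combination h3
    · apply h1
      apply mul_left_cancel₀ hs'
      have : (t : ℂ) = -s := by rw [h4]; simp
      rw [this] at h3
      linear_combination h3
  refine ⟨key hu hv h1 h2 h, key hv hu h1.symm (fun hc => h2 ?_) ((add_comm _ _).trans h)⟩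
  rw [hc, neg_neg]

/-- An infinitesimal motion of a unit triangle has an angular velocity. -/
theorem exists_angular_velocity {a b c da db dc : ℂ} (hab : ‖a - b‖ = 1) (hac : ‖a - c‖ = 1)
    (hbc : ‖b - c‖ = 1) (h1 : inner ℝ (a - b) (da - db) = (0 : ℝ))
    (h2 : inner ℝ (a - c) (da - dc) = (0 : ℝ)) (h3 : inner ℝ (b - c) (db - dc) = (0 : ℝ)) :
    ∃ w : ℝ, da - db = Complex.I * w * (a - b) ∧ da - dc = Complex.I * w * (a - c) := by
  obtain ⟨w, hw⟩ := inner_eq_zero_iff_exists hab h1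
  obtain ⟨w', hw'⟩ := inner_eq_zero_iff_exists hac h2
  obtain ⟨w'', hw''⟩ := inner_eq_zero_iff_exists hbc h3
  have h : ((w - w'' : ℝ) : ℂ) * (a - b) + ((w'' - w' : ℝ) : ℂ) * (a - c) = 0 := by
    apply mul_left_cancel₀ Complex.I_ne_zero
    push_cast
    linear_combination -hw + hw' - hw''
  have h5 := eq_of_real_combination hab hac (fun hc => by
    have : b - c = 0 := by linear_combination -hc
    simp [this] at hbc) (fun hc => by
    have : b - c = 2 * (a - c) := by linear_combination -hc
    rw [this, norm_mul, hac] at hbc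
    norm_num at hbc) h
  refine ⟨w, hw, ?_⟩
  rw [hw']
  have : w' = w := by linarith [h5.1, h5.2]
  rw [this]

/-- A unit rhombus is a parallelogram. -/
theorem add_eq_add_of_rhombus {a b c d : ℂ} (hab : ‖a - b‖ = 1) (hbc : ‖b - c‖ = 1)
    (hcd : ‖c - d‖ = 1) (hda : ‖d - a‖ = 1) (hac : a ≠ c) (hbd : b ≠ d) : a + c = b + d := by
  have e : ∀ z : ℂ, ‖z‖ = 1 → z.re ^ 2 + z.im ^ 2 = 1 := by
    intro z hz
    have := Complex.normSq_eq_norm_sq z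
    rw [hz, Complex.normSq_apply] at this
    linarith
  have h1 := e _ hab
  have h2 := e _ hbc
  have h3 := e _ hcd
  have h4 := e _ hda
  simp only [Complex.sub_re, Complex.sub_im] at h1 h2 h3 h4
  have hsq : ∀ z w : ℂ, z ≠ w → (z.re - w.re) ^ 2 + (z.im - w.im) ^ 2 ≠ 0 := by
    intro z w hzw h
    apply hzw
    apply Complex.ext <;> nlinarith [sq_nonneg (z.re - w.re), sq_nonneg (z.im - w.im)]
  set f₁ := c.re - a.re
  set f₂ := c.im - a.im
  set g₁ := b.re - d.re
  set g₂ := b.im - d.im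
  set w₁ := a.re + c.re - b.re - d.re with hw₁
  set w₂ := a.im + c.im - b.im - d.im with hw₂
  have hfg : f₁ * g₁ + f₂ * g₂ = 0 := by simp only [f₁, f₂, g₁, g₂]; linarith
  have hfw : f₁ * w₁ + f₂ * w₂ = 0 := by simp only [f₁, f₂, w₁, w₂]; linarith
  have hgw : g₁ * w₁ + g₂ * w₂ = 0 := by simp only [g₁, g₂, w₁, w₂]; linarith
  have hdet : f₁ * g₂ - f₂ * g₁ ≠ 0 := by
    intro h
    refine mul_ne_zero (hsq c a hac.symm) (hsq b d hbd) ?_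
    change (f₁ ^ 2 + f₂ ^ 2) * (g₁ ^ 2 + g₂ ^ 2) = 0
    linear_combination (f₁ * g₁ + f₂ * g₂) * hfg + (f₁ * g₂ - f₂ * g₁) * h
  have hw1 : w₁ * (f₁ * g₂ - f₂ * g₁) = 0 := by linear_combination g₂ * hfw - f₂ * hgw
  have hw2 : w₂ * (f₁ * g₂ - f₂ * g₁) = 0 := by linear_combination f₁ * hgw - g₁ * hfw
  have hw1' := (mul_eq_zero.1 hw1).resolve_right hdet
  have hw2' := (mul_eq_zero.1 hw2).resolve_right hdet
  apply Complex.ext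
  · simp only [Complex.add_re]; linarith
  · simp only [Complex.add_im]; linarith

/-- Opposite sides of a unit rhombus have the same angular velocity. -/
theorem angular_velocity_rhombus {a b c d da db dc dd : ℂ} {w₁ w₂ w₃ w₄ : ℝ}
    (hab : ‖a - b‖ = 1) (hbc : ‖b - c‖ = 1) (hcd : ‖c - d‖ = 1) (hda : ‖d - a‖ = 1)
    (hac : a ≠ c) (hbd : b ≠ d) (h1 : da - db = Complex.I * w₁ * (a - b))
    (h2 : db - dc = Complex.I * w₂ * (b - c)) (h3 : dc - dd = Complex.I * w₃ * (c - d))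
    (h4 : dd - da = Complex.I * w₄ * (d - a)) : w₁ = w₃ ∧ w₂ = w₄ := by
  have hp := add_eq_add_of_rhombus hab hbc hcd hda hac hbd
  have h : ((w₁ - w₃ : ℝ) : ℂ) * (a - b) + ((w₂ - w₄ : ℝ) : ℂ) * (b - c) = 0 := by
    apply mul_left_cancel₀ Complex.I_ne_zero
    push_cast
    linear_combination -h1 - h2 - h3 - h4 + Complex.I * (w₄ - w₃) * hp
  obtain ⟨h5, h6⟩ := eq_of_real_combination hab hbc (fun hc => hbd (by
    linear_combination hp - hc)) (fun hc => hac (by linear_combination hc)) h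
  exact ⟨by linarith, by linarith⟩

theorem abs_sub_le_of_step {f : ZMod 169 → ℝ} {c : ℝ} (hf : ∀ k, |f (k + 1) - f k| ≤ c)
    (j k : ZMod 169) : |f k - f j| ≤ 169 * c := by
  have hc : 0 ≤ c := (abs_nonneg _).trans (hf 0)
  have h : ∀ n : ℕ, |f (j + n) - f j| ≤ n * c := by
    intro n
    induction n with
    | zero => simp
    | succ n ih =>
      have h1 := hf (j + n)
      have e : j + ((n + 1 : ℕ) : ZMod 169) = j + n + 1 := by push_cast; ring
      rw [e]
      have h2 := abs_sub_le (f (j + n + 1)) (f (j + n)) (f j)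
      push_cast
      linarith
  have h1 := h (k - j).val
  rw [ZMod.natCast_zmod_val, add_sub_cancel] at h1
  refine h1.trans (mul_le_mul_of_nonneg_right ?_ hc)
  exact_mod_cast (ZMod.val_lt (k - j)).le

theorem sum_step_eq_zero (f : ZMod 169 → ℝ) : ∑ k, (f (k + 1) - f k) = 0 := by
  rw [Finset.sum_sub_distrib, sub_eq_zero]
  exact Equiv.sum_comp (Equiv.addRight (1 : ZMod 169)) f

/-- A periodic sequence with small second differences is nearly constant. -/
theorem abs_step_le {f : ZMod 169 → ℝ} {c : ℝ}
    (hf : ∀ k, |(f (k + 1 + 1) - f (k + 1)) - (f (k + 1) - f k)| ≤ c) (k : ZMod 169) :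
    |f (k + 1) - f k| ≤ 169 * c := by
  have h1 := abs_sub_le_of_step (f := fun k => f (k + 1) - f k) hf
  have h2 : ∑ j : ZMod 169, ((f (k + 1) - f k) - (f (j + 1) - f j)) = 169 * (f (k + 1) - f k) := by
    rw [Finset.sum_sub_distrib, sum_step_eq_zero, sub_zero, Finset.sum_const, Finset.card_univ,
      ZMod.card]
    simp
  have h3 := Finset.abs_sum_le_sum_abs
    (fun j : ZMod 169 => (f (k + 1) - f k) - (f (j + 1) - f j)) Finset.univ
  have h4 : ∑ j : ZMod 169, |(f (k + 1) - f k) - (f (j + 1) - f j)| ≤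
      ∑ _j : ZMod 169, 169 * c := Finset.sum_le_sum fun j _ => h1 j k
  rw [Finset.sum_const, Finset.card_univ, ZMod.card, nsmul_eq_mul] at h4
  rw [h2, abs_mul, Nat.abs_ofNat] at h3
  push_cast at h4
  linarith

theorem abs_le_of_recurrence {x y : ZMod 169 → ℝ} {e : ℝ}
    (h1 : ∀ k, |0.856378507768 * (y k - y (k + 1 + 1 + 1)) -
      7.170961147153 * (y (k + 1) - y (k + 1 + 1)) - 0.097168280254 * (x k + x (k + 1 + 1 + 1)) -
      0.433997248977 * (x (k + 1) + x (k + 1 + 1))| ≤ e)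
    (h2 : ∀ k, |0.012009861602 * (y (k + 1) + y (k + 1 + 1) - y k - y (k + 1 + 1 + 1)) +
      0.526631538622 * (x (k + 1) - x (k + 1 + 1)) + 0.00136268903 * (x k - x (k + 1 + 1 + 1))| ≤ e)
    (hy : y 0 = 0) (k : ZMod 169) : |y k| ≤ 28561 * e ∧ |x k| ≤ 2000 * e := by
  obtain ⟨m, hm⟩ := Finite.exists_max fun k => |(y (k + 1 + 1) - y (k + 1)) - (y (k + 1) - y k)|
  obtain ⟨n, hn⟩ := Finite.exists_max fun k => |x (k + 1) - x k|
  obtain ⟨m, rfl⟩ : ∃ m', m = m' + 1 := ⟨m - 1, by ring⟩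
  obtain ⟨n, rfl⟩ : ∃ n', n = n' + 1 := ⟨n - 1, by ring⟩
  set Z := |(y (m + 1 + 1 + 1) - y (m + 1 + 1)) - (y (m + 1 + 1) - y (m + 1))| with hZ
  set E := |x (n + 1 + 1) - x (n + 1)| with hE
  have he : 0 ≤ e := (abs_nonneg _).trans (h1 0)
  have hxE : 0.525 * E ≤ 0.0241 * Z + e := by
    have g := abs_le.1 (h2 n)
    have z0 := abs_le.1 (hm n)
    have z1 := abs_le.1 (hm (n + 1))
    have e0 := abs_le.1 (hn n)
    have e2 := abs_le.1 (hn (n + 1 + 1))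
    rcases abs_cases (x (n + 1 + 1) - x (n + 1)) with ⟨h3, -⟩ | ⟨h3, -⟩ <;> rw [← hE] at h3 <;>
      linarith [g.1, g.2, z0.1, z0.2, z1.1, z1.2, e0.1, e0.2, e2.1, e2.2]
  have hyZ : 4.6 * Z ≤ 1.063 * E + 2 * e := by
    have g := abs_le.1 (h1 m)
    have g' := abs_le.1 (h1 (m + 1))
    have z0 := abs_le.1 (hm m)
    have z2 := abs_le.1 (hm (m + 1 + 1))
    have e0 := abs_le.1 (hn m)
    have e1 := abs_le.1 (hn (m + 1))
    have e2 := abs_le.1 (hn (m + 1 + 1))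
    have e3 := abs_le.1 (hn (m + 1 + 1 + 1))
    rcases abs_cases ((y (m + 1 + 1 + 1) - y (m + 1 + 1)) - (y (m + 1 + 1) - y (m + 1))) with
      ⟨h3, -⟩ | ⟨h3, -⟩ <;> rw [← hZ] at h3 <;>
      linarith [g.1, g.2, g'.1, g'.2, z0.1, z0.2, z2.1, z2.2, e0.1, e0.2, e1.1, e1.2, e2.1, e2.2,
        e3.1, e3.2]
  have hZe : Z ≤ e := by linarith
  have hEe : E ≤ 2 * e := by linarith
  have hd := abs_step_le (f := y) fun k => (hm k).trans hZe
  refine ⟨?_, ?_⟩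
  · have h3 := abs_sub_le_of_step hd 0 k
    rw [hy, sub_zero] at h3
    linarith
  · have g := abs_le.1 (h1 k)
    have d0 := abs_le.1 (hd k)
    have d1 := abs_le.1 (hd (k + 1))
    have d2 := abs_le.1 (hd (k + 1 + 1))
    have e0 := abs_le.1 ((hn k).trans hEe)
    have e1 := abs_le.1 ((hn (k + 1)).trans hEe)
    have e2 := abs_le.1 ((hn (k + 1 + 1)).trans hEe)
    rw [abs_le]
    constructor <;>
      linarith [g.1, g.2, d0.1, d0.2, d1.1, d1.2, d2.1, d2.2, e0.1, e0.2, e1.1, e1.2, e2.1, e2.2]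

theorem solve_chain_loops {a b t t' p q p₁ q₁ S : ℝ} (hp : |p| ≤ S) (hq : |q| ≤ S) (hp₁ : |p₁| ≤ S)
    (hq₁ : |q₁| ≤ S)
    (h1 : |-3.464164867073 * a - 2.598123650305 * b - 0.844076125708 * t + 3.956985597163 * p +
      2.949379045922 * q| ≤ S / 10 ^ 9)
    (h2 : |1.999890440434 * a - 1.499917830325 * b - 0.536223362052 * t + 0.585034173228 * p -
      0.548783421284 * q| ≤ S / 10 ^ 9)
    (h3 : |-2.598123650305 * a - 3.464164867073 * b - 0.844076125708 * t' + 2.949379045922 * p₁ +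
      3.956985597163 * q₁| ≤ S / 10 ^ 9)
    (h4 : |1.499917830325 * a - 1.999890440434 * b + 0.536223362052 * t' + 0.548783421284 * p₁ -
      0.585034173228 * q₁| ≤ S / 10 ^ 9) :
    |a - (0.459752514422 * p + 0.577436285135 * q - 0.020704197995 * p₁ - 0.016484601561 * q₁)| ≤
      S / 10 ^ 9 ∧
    |b - (-0.016484601561 * p - 0.020704197995 * q + 0.577436285135 * p₁ + 0.459752514422 * q₁)| ≤
      S / 10 ^ 9 ∧
    |t - (2.851823489639 * p + 1.188087886761 * q - 1.692416205302 * p₁ - 1.347495171098 * q₁)| ≤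
      3 * S / 10 ^ 9 ∧
    |t' - (-1.347495171098 * p - 1.692416205302 * q + 1.188087886761 * p₁ + 2.851823489639 * q₁)| ≤
      3 * S / 10 ^ 9 := by
  simp only [abs_le] at *
  refine ⟨⟨?_, ?_⟩, ⟨?_, ?_⟩, ⟨?_, ?_⟩, ⟨?_, ?_⟩⟩ <;> linarith

theorem solve_outer_loop {t t' r r' p q p₁ q₁ p₂ q₂ S : ℝ} (hp : |p| ≤ S) (hq : |q| ≤ S)
    (hp₁ : |p₁| ≤ S) (hq₁ : |q₁| ≤ S) (hp₂ : |p₂| ≤ S) (hq₂ : |q₂| ≤ S)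
    (ht' : |t' - (-1.347495171098 * p - 1.692416205302 * q + 1.188087886761 * p₁ +
      2.851823489639 * q₁)| ≤ 3 * S / 10 ^ 9)
    (ht : |t - (2.851823489639 * p₁ + 1.188087886761 * q₁ - 1.692416205302 * p₂ -
      1.347495171098 * q₂)| ≤ 3 * S / 10 ^ 9)
    (h1 : |-0.060909236871 * t' + 0.060909236871 * t + 0.635744899563 * p₁ - 0.635744899563 * q₁ -
      0.931101180154 * r + 0.931101180154 * r'| ≤ S / 10 ^ 9)
    (h2 : |-0.998143308781 * t' - 0.998143308781 * t - 0.77189923091 * p₁ - 0.77189923091 * q₁ +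
      1.770042539691 * r + 1.770042539691 * r'| ≤ S / 10 ^ 9) :
    |r - (-0.335858370663 * p - 0.421828709585 * q + 1.752928879549 * p₁ + 0.961305175058 * q₁ -
      0.532540393482 * p₂ - 0.424006580877 * q₂)| ≤ 4 * S / 10 ^ 9 ∧
    |r' - (-0.424006580877 * p - 0.532540393482 * q + 0.961305175058 * p₁ + 1.752928879549 * q₁ -
      0.421828709585 * p₂ - 0.335858370663 * q₂)| ≤ 4 * S / 10 ^ 9 := by
  simp only [abs_le] at *
  refine ⟨⟨?_, ?_⟩, ⟨?_, ?_⟩⟩ <;> linarith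

theorem solve_inner_loop {a b t t' r r' r₁ r₁' p q p₁ q₁ p₂ q₂ p₃ q₃ S : ℝ} (hp : |p| ≤ S)
    (hq : |q| ≤ S) (hp₁ : |p₁| ≤ S) (hq₁ : |q₁| ≤ S) (hp₂ : |p₂| ≤ S) (hq₂ : |q₂| ≤ S)
    (hp₃ : |p₃| ≤ S) (hq₃ : |q₃| ≤ S)
    (ha : |a - (0.459752514422 * p₁ + 0.577436285135 * q₁ - 0.020704197995 * p₂ -
      0.016484601561 * q₂)| ≤ S / 10 ^ 9)
    (hb : |b - (-0.016484601561 * p₁ - 0.020704197995 * q₁ + 0.577436285135 * p₂ +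
      0.459752514422 * q₂)| ≤ S / 10 ^ 9)
    (ht : |t - (2.851823489639 * p₁ + 1.188087886761 * q₁ - 1.692416205302 * p₂ -
      1.347495171098 * q₂)| ≤ 3 * S / 10 ^ 9)
    (ht' : |t' - (-1.347495171098 * p₁ - 1.692416205302 * q₁ + 1.188087886761 * p₂ +
      2.851823489639 * q₂)| ≤ 3 * S / 10 ^ 9)
    (hr : |r - (-0.335858370663 * p - 0.421828709585 * q + 1.752928879549 * p₁ +
      0.961305175058 * q₁ - 0.532540393482 * p₂ - 0.424006580877 * q₂)| ≤ 4 * S / 10 ^ 9)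
    (hr' : |r' - (-0.424006580877 * p - 0.532540393482 * q + 0.961305175058 * p₁ +
      1.752928879549 * q₁ - 0.421828709585 * p₂ - 0.335858370663 * q₂)| ≤ 4 * S / 10 ^ 9)
    (hr₁ : |r₁ - (-0.335858370663 * p₁ - 0.421828709585 * q₁ + 1.752928879549 * p₂ +
      0.961305175058 * q₂ - 0.532540393482 * p₃ - 0.424006580877 * q₃)| ≤ 4 * S / 10 ^ 9)
    (hr₁' : |r₁' - (-0.424006580877 * p₁ - 0.532540393482 * q₁ + 0.961305175058 * p₂ +
      1.752928879549 * q₂ - 0.421828709585 * p₃ - 0.335858370663 * q₃)| ≤ 4 * S / 10 ^ 9)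
    (h1 : |-0.866009589934 * a + 0.866009589934 * b - 0.886421116494 * t + 0.886421116494 * t' -
      0.998322442735 * r - 0.99978466755 * r' + 0.99978466755 * r₁ + 0.998322442735 * r₁'| ≤
      S / 10 ^ 9)
    (h2 : |-0.500027389391 * a - 0.500027389391 * b + 0.462879686565 * t + 0.462879686565 * t' +
      0.057899052951 * r - 0.020751350124 * r' - 0.020751350124 * r₁ + 0.057899052951 * r₁'| ≤
      S / 10 ^ 9) :
    |0.856378507768 * ((p + q) - (p₃ + q₃)) - 7.170961147153 * ((p₁ + q₁) - (p₂ + q₂)) -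
      0.097168280254 * ((p - q) + (p₃ - q₃)) - 0.433997248977 * ((p₁ - q₁) + (p₂ - q₂))| ≤
      3 * S / 10 ^ 8 ∧
    |0.012009861602 * ((p₁ + q₁) + (p₂ + q₂) - (p + q) - (p₃ + q₃)) +
      0.526631538622 * ((p₁ - q₁) - (p₂ - q₂)) + 0.00136268903 * ((p - q) - (p₃ - q₃))| ≤
      3 * S / 10 ^ 8 := by
  simp only [abs_le] at *
  refine ⟨⟨?_, ?_⟩, ⟨?_, ?_⟩⟩ <;> linarith

/-- The loop equations of the ring, in approximate form, have only a small solution. -/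
theorem abs_le_of_loop_equations {a b t t' p q r r' : ZMod 169 → ℝ} {S : ℝ}
    (hp : ∀ k, |p k| ≤ S) (hq : ∀ k, |q k| ≤ S)
    (h1 : ∀ k, |-3.464164867073 * a k - 2.598123650305 * b k - 0.844076125708 * t k +
      3.956985597163 * p k + 2.949379045922 * q k| ≤ S / 10 ^ 9)
    (h2 : ∀ k, |1.999890440434 * a k - 1.499917830325 * b k - 0.536223362052 * t k +
      0.585034173228 * p k - 0.548783421284 * q k| ≤ S / 10 ^ 9)
    (h3 : ∀ k, |-2.598123650305 * a k - 3.464164867073 * b k - 0.844076125708 * t' k +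
      2.949379045922 * p (k + 1) + 3.956985597163 * q (k + 1)| ≤ S / 10 ^ 9)
    (h4 : ∀ k, |1.499917830325 * a k - 1.999890440434 * b k + 0.536223362052 * t' k +
      0.548783421284 * p (k + 1) - 0.585034173228 * q (k + 1)| ≤ S / 10 ^ 9)
    (h5 : ∀ k, |-0.060909236871 * t' k + 0.060909236871 * t (k + 1) +
      0.635744899563 * p (k + 1) - 0.635744899563 * q (k + 1) - 0.931101180154 * r (k + 1) +
      0.931101180154 * r' (k + 1)| ≤ S / 10 ^ 9)
    (h6 : ∀ k, |-0.998143308781 * t' k - 0.998143308781 * t (k + 1) -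
      0.77189923091 * p (k + 1) - 0.77189923091 * q (k + 1) + 1.770042539691 * r (k + 1) +
      1.770042539691 * r' (k + 1)| ≤ S / 10 ^ 9)
    (h7 : ∀ k, |-0.866009589934 * a k + 0.866009589934 * b k - 0.886421116494 * t k +
      0.886421116494 * t' k - 0.998322442735 * r k - 0.99978466755 * r' k +
      0.99978466755 * r (k + 1) + 0.998322442735 * r' (k + 1)| ≤ S / 10 ^ 9)
    (h8 : ∀ k, |-0.500027389391 * a k - 0.500027389391 * b k + 0.462879686565 * t k +
      0.462879686565 * t' k + 0.057899052951 * r k - 0.020751350124 * r' k -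
      0.020751350124 * r (k + 1) + 0.057899052951 * r' (k + 1)| ≤ S / 10 ^ 9)
    (h0 : p 0 + q 0 = 0) (k : ZMod 169) :
    |a k| ≤ S / 2 ∧ |b k| ≤ S / 2 ∧ |t k| ≤ S / 2 ∧ |t' k| ≤ S / 2 ∧ |p k| ≤ S / 2 ∧
      |q k| ≤ S / 2 ∧ |r k| ≤ S / 2 ∧ |r' k| ≤ S / 2 := by
  have g1 := fun k => solve_chain_loops (hp k) (hq k) (hp (k + 1)) (hq (k + 1)) (h1 k) (h2 k) (h3 k)
    (h4 k)
  have g2 := fun k => solve_outer_loop (hp k) (hq k) (hp (k + 1)) (hq (k + 1)) (hp (k + 1 + 1))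
    (hq (k + 1 + 1)) (g1 k).2.2.2 (g1 (k + 1)).2.2.1 (h5 k) (h6 k)
  have g3 := fun k => solve_inner_loop (hp k) (hq k) (hp (k + 1)) (hq (k + 1)) (hp (k + 1 + 1))
    (hq (k + 1 + 1)) (hp (k + 1 + 1 + 1)) (hq (k + 1 + 1 + 1)) (g1 (k + 1)).1 (g1 (k + 1)).2.1
    (g1 (k + 1)).2.2.1 (g1 (k + 1)).2.2.2 (g2 k).1 (g2 k).2 (g2 (k + 1)).1 (g2 (k + 1)).2
    (h7 (k + 1)) (h8 (k + 1))
  have g4 := abs_le_of_recurrence (y := fun k => p k + q k) (x := fun k => p k - q k)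
    (fun k => (g3 k).1) (fun k => (g3 k).2) h0
  have hS : 0 ≤ S := (abs_nonneg _).trans (hp 0)
  have hpq : ∀ k, |p k| ≤ S / 1000 ∧ |q k| ≤ S / 1000 := by
    intro k
    have h9 := abs_le.1 (g4 k).1
    have h10 := abs_le.1 (g4 k).2
    constructor <;> rw [abs_le] <;> constructor <;> linarith [h9.1, h9.2, h10.1, h10.2]
  obtain ⟨k, rfl⟩ : ∃ j, k = j + 1 := ⟨k - 1, by ring⟩
  obtain ⟨ga, gb, gt, gt'⟩ := g1 (k + 1)
  obtain ⟨gr, gr'⟩ := g2 k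
  obtain ⟨p0, q0⟩ := hpq k
  obtain ⟨p1, q1⟩ := hpq (k + 1)
  obtain ⟨p2, q2⟩ := hpq (k + 1 + 1)
  clear h1 h2 h3 h4 h5 h6 h7 h8 g1 g2 g3 g4 hpq hp hq
  rw [abs_le] at ga gb gt gt' gr gr' p0 q0 p1 q1 p2 q2
  simp only [abs_le]
  refine ⟨⟨?_, ?_⟩, ⟨?_, ?_⟩, ⟨?_, ?_⟩, ⟨?_, ?_⟩, ⟨?_, ?_⟩, ⟨?_, ?_⟩, ⟨?_, ?_⟩, ⟨?_, ?_⟩⟩ <;> linarith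

/-- The angular velocities of the triangles of the ring in an infinitesimal motion. -/
def IsAngularVelocity (d : Fin ringOrder → ℂ) (ω : ZMod 169 → Fin 38 → ℝ) : Prop :=
  ∀ k i j j', d (ringVertex k (corner i j)) - d (ringVertex k (corner i j')) =
    Complex.I * ω k i * (ringPos (ringVertex k (corner i j)) - ringPos (ringVertex k (corner i j')))

/-- The vertices `a` and `b` are different corners of the triangle number `i` of `G₂`. -/
def IsSide (i : Fin 38) (a b : Fin 66) : Prop := ∃ j j', j ≠ j' ∧ corner i j = a ∧ corner i j' = b

instance (i : Fin 38) (a b : Fin 66) : Decidable (IsSide i a b) := by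
  unfold IsSide
  infer_instance

/-- The edge from `x` to `y` turns with the angular velocity `w`. -/
def Turns (d : Fin ringOrder → ℂ) (w : ℝ) (x y : Fin ringOrder) : Prop :=
  ‖ringPos x - ringPos y‖ = 1 ∧ d x - d y = Complex.I * w * (ringPos x - ringPos y)

section velocity

variable {d : Fin ringOrder → ℂ} {ω : ZMod 169 → Fin 38 → ℝ}

theorem IsAngularVelocity.turns (h : IsAngularVelocity d ω) (k : ZMod 169) {i : Fin 38}
    {a b : Fin 66} (hi : IsSide i a b) : Turns d (ω k i) (ringVertex k a) (ringVertex k b) := by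
  obtain ⟨j, j', hj, rfl, rfl⟩ := hi
  exact ⟨norm_ringPos_sub (ringGraph_adj ((adj_iff_corner _ _).2 ⟨i, j, j', hj, rfl, rfl⟩)),
    h k i j j'⟩

theorem Turns.rhombus {w₁ w₂ w₃ w₄ : ℝ} {x y z v : Fin ringOrder} (h1 : Turns d w₁ x y)
    (h2 : Turns d w₂ y z) (h3 : Turns d w₃ z v) (h4 : Turns d w₄ v x) (hxz : x ≠ z) (hyv : y ≠ v) :
    w₁ = w₃ ∧ w₂ = w₄ :=
  angular_velocity_rhombus h1.1 h2.1 h3.1 h4.1 (fun h => hxz (ringPos_injective h))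
    (fun h => hyv (ringPos_injective h)) h1.2 h2.2 h3.2 h4.2

theorem IsAngularVelocity.rhombus (h : IsAngularVelocity d ω) (k : ZMod 169) {a b c e : Fin 66}
    {i₁ i₂ i₃ i₄ : Fin 38} (h1 : IsSide i₁ a b) (h2 : IsSide i₂ b c) (h3 : IsSide i₃ c e)
    (h4 : IsSide i₄ e a) (hac : a ≠ c) (hbe : b ≠ e) : ω k i₁ = ω k i₃ ∧ ω k i₂ = ω k i₄ :=
  (h.turns k h1).rhombus (h.turns k h2) (h.turns k h3) (h.turns k h4)
    ((ringVertex_injective k).ne hac) ((ringVertex_injective k).ne hbe)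

/-- A rhombus with two sides in one copy of `G₂` and two sides in the next one. -/
theorem IsAngularVelocity.rhombus_across (h : IsAngularVelocity d ω) (k : ZMod 169)
    {a b c e : Fin 66} {i₁ i₂ i₃ i₄ : Fin 38} (h1 : IsSide i₁ a b) (h2 : IsSide i₂ b c)
    (h3 : IsSide i₃ (mirror c) e) (h4 : IsSide i₄ e (mirror a)) (hac : a ≠ c)
    (ha : a ∈ leftLabels) (hc : c ∈ leftLabels) (hb : b ∉ leftLabels) :
    ω (k + 1) i₁ = ω k i₃ ∧ ω (k + 1) i₂ = ω k i₄ := by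
  have g3 := h.turns k h3
  have g4 := h.turns k h4
  rw [← ringVertex_add_one hc] at g3
  rw [← ringVertex_add_one ha] at g4
  refine (h.turns (k + 1) h1).rhombus (h.turns (k + 1) h2) g3 g4
    ((ringVertex_injective _).ne hac) fun hbe => ?_
  rcases ringVertex_eq_iff.1 hbe with ⟨h5, -⟩ | ⟨-, h5, -⟩ | ⟨h5, -⟩
  · exact ne_add_one k h5.symm
  · exact hb h5
  · exact ne_add_one_add_one k h5

/-- The triangles of `G₂` fall into eight classes, up to a shift to the next copy, such that
triangles of a class have the same angular velocity. -/
def triangleClass (i : Fin 38) : Fin 38 × ZMod 169 :=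
  [(0, 0), (1, 0), (2, 0), (1, 0), (0, 0), (0, 0), (1, 0), (1, 0), (0, 0), (0, 0), (1, 0), (1, 0),
    (0, 0), (0, 0), (1, 0), (15, 0), (16, 0), (2, 0), (16, 0), (2, 0), (16, 0), (2, 0), (25, 0),
    (23, 0), (23, 0), (25, 0), (25, 1), (16, 1), (28, 0), (2, 1), (16, 1), (2, 1), (16, 1), (2, 1),
    (16, 1), (23, 1), (25, 1), (23, 1)].getD i (0, 0)

theorem IsAngularVelocity.eq_class (h : IsAngularVelocity d ω) (k : ZMod 169) (i : Fin 38) :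
    ω k i = ω (k + (triangleClass i).2) (triangleClass i).1 := by
  have b1 := fun k => h.rhombus k (i₁ := 0) (i₂ := 1) (i₃ := 4) (i₄ := 3) (a := 2) (b := 0) (c := 3)
    (e := 37) (by decide) (by decide) (by decide) (by decide) (by decide) (by decide)
  have b2 := fun k => h.rhombus k (i₁ := 1) (i₂ := 5) (i₃ := 6) (i₄ := 4) (a := 3) (b := 4) (c := 5)
    (e := 39) (by decide) (by decide) (by decide) (by decide) (by decide) (by decide)
  have b3 := fun k => h.rhombus k (i₁ := 5) (i₂ := 7) (i₃ := 8) (i₄ := 6) (a := 5) (b := 6) (c := 7)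
    (e := 40) (by decide) (by decide) (by decide) (by decide) (by decide) (by decide)
  have b4 := fun k => h.rhombus k (i₁ := 7) (i₂ := 9) (i₃ := 10) (i₄ := 8) (a := 7) (b := 8) (c := 9)
    (e := 41) (by decide) (by decide) (by decide) (by decide) (by decide) (by decide)
  have b5 := fun k => h.rhombus k (i₁ := 9) (i₂ := 11) (i₃ := 12) (i₄ := 10) (a := 9) (b := 10)
    (c := 11) (e := 42) (by decide) (by decide) (by decide) (by decide) (by decide) (by decide)
  have b6 := fun k => h.rhombus k (i₁ := 11) (i₂ := 13) (i₃ := 14) (i₄ := 12) (a := 11) (b := 12)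
    (c := 13) (e := 43) (by decide) (by decide) (by decide) (by decide) (by decide) (by decide)
  have b7 := fun k => h.rhombus k (i₁ := 22) (i₂ := 24) (i₃ := 25) (i₄ := 23) (a := 30) (b := 31)
    (c := 34) (e := 33) (by decide) (by decide) (by decide) (by decide) (by decide) (by decide)
  have b8 := fun k => h.rhombus k (i₁ := 35) (i₂ := 26) (i₃ := 37) (i₄ := 36) (a := 60) (b := 61)
    (c := 64) (e := 63) (by decide) (by decide) (by decide) (by decide) (by decide) (by decide)
  have c1 := fun k => h.rhombus_across k (i₁ := 2) (i₂ := 16) (i₃ := 29) (i₄ := 27) (a := 16)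
    (b := 15) (c := 17) (e := 45) (by decide) (by decide) (by decide) (by decide) (by decide)
    (by decide) (by decide) (by decide)
  have c2 := fun k => h.rhombus_across k (i₁ := 16) (i₂ := 17) (i₃ := 30) (i₄ := 29) (a := 17)
    (b := 18) (c := 19) (e := 48) (by decide) (by decide) (by decide) (by decide) (by decide)
    (by decide) (by decide) (by decide)
  have c3 := fun k => h.rhombus_across k (i₁ := 17) (i₂ := 18) (i₃ := 31) (i₄ := 30) (a := 19)
    (b := 20) (c := 21) (e := 50) (by decide) (by decide) (by decide) (by decide) (by decide)
    (by decide) (by decide) (by decide)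
  have c4 := fun k => h.rhombus_across k (i₁ := 18) (i₂ := 19) (i₃ := 32) (i₄ := 31) (a := 21)
    (b := 22) (c := 23) (e := 52) (by decide) (by decide) (by decide) (by decide) (by decide)
    (by decide) (by decide) (by decide)
  have c5 := fun k => h.rhombus_across k (i₁ := 19) (i₂ := 20) (i₃ := 33) (i₄ := 32) (a := 23)
    (b := 24) (c := 25) (e := 54) (by decide) (by decide) (by decide) (by decide) (by decide)
    (by decide) (by decide) (by decide)
  have c6 := fun k => h.rhombus_across k (i₁ := 20) (i₂ := 21) (i₃ := 34) (i₄ := 33) (a := 25)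
    (b := 26) (c := 27) (e := 56) (by decide) (by decide) (by decide) (by decide) (by decide)
    (by decide) (by decide) (by decide)
  have c7 := fun k => h.rhombus_across k (i₁ := 23) (i₂ := 25) (i₃ := 37) (i₄ := 36) (a := 32)
    (b := 33) (c := 35) (e := 63) (by decide) (by decide) (by decide) (by decide) (by decide)
    (by decide) (by decide) (by decide)
  obtain ⟨j, rfl⟩ : ∃ j, k = j + 1 := ⟨k - 1, by ring⟩
  fin_cases i <;> simp only [triangleClass, List.getD_cons_zero, List.getD_cons_succ, add_zero] <;>
    grind

theorem loop_equation (h : IsAngularVelocity d ω) (k : ZMod 169) {n : ℕ} {x : ℕ → Fin 66}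
    {T : ℕ → Fin 38} (hx : x n = x 0) (hT : ∀ i < n, IsSide (T i) (x i) (x (i + 1))) :
    ∑ i ∈ Finset.range n, (ω k (T i) : ℂ) * (sectorPos (x (i + 1)) - sectorPos (x i)) = 0 := by
  have h1 := Finset.sum_range_sub (fun i => d (ringVertex k (x i))) n
  rw [hx, sub_self] at h1
  have h2 : ∀ i ∈ Finset.range n, d (ringVertex k (x (i + 1))) - d (ringVertex k (x i)) =
      Complex.I * turn k * (ω k (T i) * (sectorPos (x (i + 1)) - sectorPos (x i))) := by
    intro i hi
    have h3 := (h.turns k (hT i (Finset.mem_range.1 hi))).2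
    rw [ringPos_ringVertex, ringPos_ringVertex] at h3
    linear_combination -h3
  rw [Finset.sum_congr rfl h2, ← Finset.mul_sum] at h1
  exact (mul_eq_zero.1 h1).resolve_left (mul_ne_zero Complex.I_ne_zero (turn_ne_zero k))

end velocity

theorem abs_sum_le_of_sum_eq_zero {n : ℕ} {w : ℕ → ℝ} {z : ℕ → ℂ} {D : ℕ → ℤ × ℤ} {S e : ℝ}
    (hw : ∀ i < n, |w i| ≤ S) (hz : ∀ i < n, ‖z i - ⟨(D i).1, (D i).2⟩‖ ≤ e)
    (h : ∑ i ∈ Finset.range n, (w i : ℂ) * z i = 0) :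
    |∑ i ∈ Finset.range n, w i * (D i).1| ≤ n * (S * e) ∧
      |∑ i ∈ Finset.range n, w i * (D i).2| ≤ n * (S * e) := by
  have h1 : ‖∑ i ∈ Finset.range n, (w i : ℂ) * (⟨(D i).1, (D i).2⟩ - z i)‖ ≤ n * (S * e) := by
    refine (norm_sum_le_of_le _ (f := fun i => (w i : ℂ) * (⟨(D i).1, (D i).2⟩ - z i))
      (n := fun _ => S * e) fun i hi => ?_).trans ?_
    · rw [norm_mul, Complex.norm_real, norm_sub_rev]
      have hi' := Finset.mem_range.1 hi
      exact mul_le_mul (hw i hi') (hz i hi') (norm_nonneg _) ((abs_nonneg _).trans (hw i hi'))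
    · simp
  simp only [mul_sub, Finset.sum_sub_distrib, h, sub_zero] at h1
  refine ⟨?_, ?_⟩
  · refine le_trans (le_of_eq ?_) ((Complex.abs_re_le_norm _).trans h1)
    simp
  · refine le_trans (le_of_eq ?_) ((Complex.abs_im_le_norm _).trans h1)
    simp

/-- The vector `D`, in units of `10⁻¹²`, approximates the vector from `a` to `b`. -/
def ApproxEdge (a b : Fin 66) (D : ℤ × ℤ) : Prop :=
  |(sectorCoord b).1 - (sectorCoord a).1 - D.1 * 10 ^ 8| ≤ 10 ^ 8 ∧
    |(sectorCoord b).2 - (sectorCoord a).2 - D.2 * 10 ^ 8| ≤ 10 ^ 8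

instance (a b : Fin 66) (D : ℤ × ℤ) : Decidable (ApproxEdge a b D) := by
  unfold ApproxEdge
  infer_instance

/-- The vector `D`, in units of `10⁻¹²`, approximates the turned vector from `a` to `b`. -/
def ApproxTurnedEdge (a b : Fin 66) (D : ℤ × ℤ) : Prop :=
  |(turnedCoord a b).1 - D.1 * 10 ^ 28| ≤ 10 ^ 28 ∧ |(turnedCoord a b).2 - D.2 * 10 ^ 28| ≤ 10 ^ 28

instance (a b : Fin 66) (D : ℤ × ℤ) : Decidable (ApproxTurnedEdge a b D) := by
  unfold ApproxTurnedEdge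
  infer_instance

theorem ApproxEdge.norm_sub_le {a b : Fin 66} {D : ℤ × ℤ} (h : ApproxEdge a b D) :
    ‖10 ^ 12 * (sectorPos b - sectorPos a) - ⟨D.1, D.2⟩‖ ≤ 25 := by
  have h1 := norm_sub_sub_ofCoord_le b a
  obtain ⟨h2, h3⟩ := h
  have h2' : |((sectorCoord b).1 - (sectorCoord a).1 - D.1 * 10 ^ 8 : ℝ)| ≤ 10 ^ 8 := by
    exact_mod_cast h2
  have h3' : |((sectorCoord b).2 - (sectorCoord a).2 - D.2 * 10 ^ 8 : ℝ)| ≤ 10 ^ 8 := by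
    exact_mod_cast h3
  have e : 10 ^ 12 * (sectorPos b - sectorPos a) - ⟨D.1, D.2⟩ =
      10 ^ 12 * ((sectorPos b - sectorPos a) -
        (ofCoord (sectorCoord b) - ofCoord (sectorCoord a))) +
      ⟨((sectorCoord b).1 - (sectorCoord a).1 - D.1 * 10 ^ 8) / 10 ^ 8,
        ((sectorCoord b).2 - (sectorCoord a).2 - D.2 * 10 ^ 8) / 10 ^ 8⟩ := by
    have e' : (10 : ℂ) ^ 12 * (ofCoord (sectorCoord b) - ofCoord (sectorCoord a)) =
        ⟨((sectorCoord b).1 - (sectorCoord a).1) / 10 ^ 8,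
          ((sectorCoord b).2 - (sectorCoord a).2) / 10 ^ 8⟩ := by
      have e10 : (10 : ℂ) ^ 12 = ((10 ^ 12 : ℝ) : ℂ) := by push_cast; rfl
      rw [e10]
      apply Complex.ext
      · rw [Complex.re_ofReal_mul]; simp only [ofCoord, Complex.sub_re]; ring
      · rw [Complex.im_ofReal_mul]; simp only [ofCoord, Complex.sub_im]; ring
    rw [mul_sub (10 ^ 12 : ℂ) (sectorPos b - sectorPos a), e']
    apply Complex.ext
    · simp only [Complex.add_re, Complex.sub_re]; ring
    · simp only [Complex.add_im, Complex.sub_im]; ring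
  rw [e]
  refine (norm_add_le _ _).trans ?_
  have h4 : ‖(⟨((sectorCoord b).1 - (sectorCoord a).1 - D.1 * 10 ^ 8) / 10 ^ 8,
        ((sectorCoord b).2 - (sectorCoord a).2 - D.2 * 10 ^ 8) / 10 ^ 8⟩ : ℂ)‖ ≤ 1 + 1 := by
    refine norm_le_of_abs_le ?_ ?_
    · rw [abs_div, div_le_one (by positivity)]
      refine h2'.trans (le_abs_self _)
    · rw [abs_div, div_le_one (by positivity)]
      refine h3'.trans (le_abs_self _)
  rw [norm_mul, norm_pow, Complex.norm_ofNat]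
  linarith

theorem ApproxTurnedEdge.norm_sub_le {a b : Fin 66} {D : ℤ × ℤ} (h : ApproxTurnedEdge a b D) :
    ‖10 ^ 12 * turnedEdge a b - ⟨D.1, D.2⟩‖ ≤ 25 := by
  have h1 := norm_turnedEdge_sub_le a b
  obtain ⟨h2, h3⟩ := h
  have h2' : |((turnedCoord a b).1 - D.1 * 10 ^ 28 : ℝ)| ≤ 10 ^ 28 := by exact_mod_cast h2
  have h3' : |((turnedCoord a b).2 - D.2 * 10 ^ 28 : ℝ)| ≤ 10 ^ 28 := by exact_mod_cast h3
  have e : 10 ^ 12 * turnedEdge a b - ⟨D.1, D.2⟩ =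
      10 ^ 12 * (turnedEdge a b -
        ⟨(turnedCoord a b).1 / 10 ^ 40, (turnedCoord a b).2 / 10 ^ 40⟩) +
      ⟨((turnedCoord a b).1 - D.1 * 10 ^ 28) / 10 ^ 28,
        ((turnedCoord a b).2 - D.2 * 10 ^ 28) / 10 ^ 28⟩ := by
    have e' : (10 : ℂ) ^ 12 * ⟨(turnedCoord a b).1 / 10 ^ 40, (turnedCoord a b).2 / 10 ^ 40⟩ =
        ⟨(turnedCoord a b).1 / 10 ^ 28, (turnedCoord a b).2 / 10 ^ 28⟩ := by
      have e10 : (10 : ℂ) ^ 12 = ((10 ^ 12 : ℝ) : ℂ) := by push_cast; rfl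
      rw [e10]
      apply Complex.ext
      · rw [Complex.re_ofReal_mul]; ring
      · rw [Complex.im_ofReal_mul]; ring
    rw [mul_sub, e']
    apply Complex.ext
    · simp only [Complex.add_re, Complex.sub_re]; ring
    · simp only [Complex.add_im, Complex.sub_im]; ring
  rw [e]
  refine (norm_add_le _ _).trans ?_
  have h4 : ‖(⟨((turnedCoord a b).1 - D.1 * 10 ^ 28) / 10 ^ 28,
        ((turnedCoord a b).2 - D.2 * 10 ^ 28) / 10 ^ 28⟩ : ℂ)‖ ≤ 1 + 1 := by
    refine norm_le_of_abs_le ?_ ?_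
    · rw [abs_div, div_le_one (by positivity)]
      refine h2'.trans (le_abs_self _)
    · rw [abs_div, div_le_one (by positivity)]
      refine h3'.trans (le_abs_self _)
  rw [norm_mul, norm_pow, Complex.norm_ofNat]
  linarith

section velocity

variable {d : Fin ringOrder → ℂ} {ω : ZMod 169 → Fin 38 → ℝ} {S : ℝ}

theorem abs_loop_le (h : IsAngularVelocity d ω) (hS : ∀ k i, |ω k i| ≤ S) (k : ZMod 169) {n : ℕ}
    (x : ℕ → Fin 66) (T : ℕ → Fin 38) (D : ℕ → ℤ × ℤ) (hx : x n = x 0)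
    (hT : ∀ i < n, IsSide (T i) (x i) (x (i + 1)))
    (hD : ∀ i < n, ApproxEdge (x i) (x (i + 1)) (D i)) :
    |∑ i ∈ Finset.range n, ω k (T i) * (D i).1| ≤ n * (S * 25) ∧
      |∑ i ∈ Finset.range n, ω k (T i) * (D i).2| ≤ n * (S * 25) := by
  refine abs_sum_le_of_sum_eq_zero (z := fun i => 10 ^ 12 * (sectorPos (x (i + 1)) - sectorPos (x i)))
    (fun i _ => hS k (T i)) (fun i hi => (hD i hi).norm_sub_le) ?_
  have h1 := loop_equation h k hx hT
  have h2 := congrArg (fun z => 10 ^ 12 * z) h1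
  simp only [mul_zero, Finset.mul_sum] at h2
  rw [← h2]
  exact Finset.sum_congr rfl fun i _ => by ring

theorem outer_loop_equation (h : IsAngularVelocity d ω) (k : ZMod 169) :
    (ω (k + 1) 21 * turnedEdge 27 28 - ω k 34 * (starRingEnd ℂ) (turnedEdge 27 28)) +
      (ω (k + 1) 15 * turnedEdge 28 29 - ω k 28 * (starRingEnd ℂ) (turnedEdge 28 29)) +
      (ω (k + 1) 22 * turnedEdge 29 30 - ω k 35 * (starRingEnd ℂ) (turnedEdge 29 30)) +
      (ω (k + 1) 23 * turnedEdge 30 32 - ω k 36 * (starRingEnd ℂ) (turnedEdge 30 32)) = 0 := by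
  have s1 := (h.turns (k + 1) (i := 21) (a := 28) (b := 27) (by decide)).2
  have s2 := (h.turns (k + 1) (i := 15) (a := 29) (b := 28) (by decide)).2
  have s3 := (h.turns (k + 1) (i := 22) (a := 30) (b := 29) (by decide)).2
  have s4 := (h.turns (k + 1) (i := 23) (a := 32) (b := 30) (by decide)).2
  have r1 := (h.turns k (i := 34) (a := mirror 28) (b := mirror 27) (by decide)).2
  have r2 := (h.turns k (i := 28) (a := mirror 29) (b := mirror 28) (by decide)).2
  have r3 := (h.turns k (i := 35) (a := mirror 30) (b := mirror 29) (by decide)).2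
  have r4 := (h.turns k (i := 36) (a := mirror 32) (b := mirror 30) (by decide)).2
  rw [← ringVertex_add_one (show (27 : Fin 66) ∈ leftLabels by decide)] at r1
  rw [← ringVertex_add_one (show (32 : Fin 66) ∈ leftLabels by decide)] at r4
  have e : ∀ a b, ringPos (ringVertex (k + 1) b) - ringPos (ringVertex (k + 1) a) =
      turn k * halfTurn * turnedEdge a b := by
    intro a b
    rw [ringPos_ringVertex, ringPos_ringVertex, turn_add, turn_one, fullTurn, turnedEdge]
    ring
  have e' : ∀ a b, ringPos (ringVertex k (mirror b)) - ringPos (ringVertex k (mirror a)) =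
      turn k * halfTurn * (starRingEnd ℂ) (turnedEdge a b) := by
    intro a b
    rw [ringPos_ringVertex, ringPos_ringVertex, sectorPos_mirror, sectorPos_mirror, turnedEdge,
      map_mul, map_sub]
    linear_combination -turn k * ((starRingEnd ℂ) (sectorPos b) - (starRingEnd ℂ) (sectorPos a)) *
      halfTurn_mul_conj
  have f1 := e' 27 28
  have f4 := e' 30 32
  rw [← ringVertex_add_one (show (27 : Fin 66) ∈ leftLabels by decide)] at f1
  rw [← ringVertex_add_one (show (32 : Fin 66) ∈ leftLabels by decide)] at f4
  rw [e] at s1 s2 s3 s4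
  rw [e'] at r2 r3
  rw [f1] at r1
  rw [f4] at r4
  have hu : halfTurn ≠ 0 := left_ne_zero_of_mul_eq_one halfTurn_mul_conj
  apply mul_left_cancel₀ (mul_ne_zero Complex.I_ne_zero (mul_ne_zero (turn_ne_zero k) hu))
  linear_combination r1 + r2 + r3 + r4 - s1 - s2 - s3 - s4

theorem abs_outer_loop_le (h : IsAngularVelocity d ω) (hS : ∀ k i, |ω k i| ≤ S) (k : ZMod 169) :
    |(ω (k + 1) 21 - ω k 34) * -635744899563 + (ω (k + 1) 15 - ω k 28) * -60909236871 +
      (ω (k + 1) 22 - ω k 35) * -465550590077 + (ω (k + 1) 23 - ω k 36) * 465550590077| ≤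
      S * 200 ∧
    |(ω (k + 1) 21 + ω k 34) * 771899230910 + (ω (k + 1) 15 + ω k 28) * 998143308781 +
      (ω (k + 1) 22 + ω k 35) * -885021269845 + (ω (k + 1) 23 + ω k 36) * -885021269845| ≤
      S * 200 := by
  set D : ℕ → ℤ × ℤ := fun i => [(-635744899563, 771899230910), (-60909236871, 998143308781),
    (-465550590077, -885021269845), (465550590077, -885021269845)].getD i (0, 0) with hD
  set y : ℕ → Fin 66 := fun i => [27, 28, 29, 30, 32].getD i 0 with hy
  set T : ℕ → Fin 38 := fun i => [21, 15, 22, 23].getD i 0 with hT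
  set T' : ℕ → Fin 38 := fun i => [34, 28, 35, 36].getD i 0 with hT'
  have happrox : ∀ i < 4, ApproxTurnedEdge (y i) (y (i + 1)) (D i) := by decide +kernel
  have key := abs_sum_le_of_sum_eq_zero (n := 8) (S := S) (e := 25)
    (w := fun i => if i < 4 then ω (k + 1) (T i) else -ω k (T' (i - 4)))
    (z := fun i => if i < 4 then 10 ^ 12 * turnedEdge (y i) (y (i + 1)) else
      10 ^ 12 * (starRingEnd ℂ) (turnedEdge (y (i - 4)) (y (i - 4 + 1))))
    (D := fun i => if i < 4 then D i else ((D (i - 4)).1, -(D (i - 4)).2)) (by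
      intro i _
      split_ifs
      · exact hS _ _
      · rw [abs_neg]; exact hS _ _) (by
      intro i hi
      split_ifs with hi4
      · exact (happrox i hi4).norm_sub_le
      · have h1 := (happrox (i - 4) (by omega)).norm_sub_le
        rw [← Complex.norm_conj] at h1
        convert h1 using 2
        rw [map_sub, map_mul, map_pow, Complex.conj_ofNat]
        congr 1
        apply Complex.ext <;> simp) (by
      simp only [Finset.sum_range_succ, Finset.sum_range_zero]
      norm_num [hy, hT, hT']
      linear_combination 10 ^ 12 * outer_loop_equation h k)
  simp only [Finset.sum_range_succ, Finset.sum_range_zero] at key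
  norm_num [hD, hT, hT'] at key
  obtain ⟨k1, k2⟩ := key
  rw [abs_le] at k1 k2
  constructor <;> rw [abs_le] <;> constructor <;> linarith [k1.1, k1.2, k2.1, k2.2]

end velocity

section velocity

variable {d : Fin ringOrder → ℂ} {ω : ZMod 169 → Fin 38 → ℝ}

theorem IsAngularVelocity.eq_zero (h : IsAngularVelocity d ω) (h0 : ω 0 2 + ω 0 16 = 0)
    (k : ZMod 169) (i : Fin 38) : ω k i = 0 := by
  obtain ⟨⟨k₀, i₀⟩, hmax⟩ := Finite.exists_max fun x : ZMod 169 × Fin 38 => |ω x.1 x.2|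
  set S := |ω k₀ i₀| with hSdef
  have hS : ∀ k i, |ω k i| ≤ S := fun k i => hmax (k, i)
  have hS' : ∀ k i, -S ≤ ω k i ∧ ω k i ≤ S := fun k i => abs_le.1 (hS k i)
  have loop1 := fun k => abs_loop_le h hS k (n := 15)
    (fun i => [1, 0, 4, 6, 8, 10, 12, 14, 28, 26, 24, 22, 20, 18, 15, 1].getD i 0)
    (fun i => [0, 1, 5, 7, 9, 11, 13, 15, 21, 20, 19, 18, 17, 16, 2].getD i 0)
    (fun i => [(-866041216768, 499972610108), (-866041216768, -499972610108),
      (-866041216768, 499972610108), (-866041216768, -499972610108), (-866041216768, 499972610108),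
      (-866041216768, -499972610108), (-866041216768, 499972610108), (-844076125708, -536223362052),
      (989246399291, 146258543307), (983126348641, -182927807095), (989246399291, 146258543307),
      (983126348641, -182927807095), (989246399291, 146258543307), (983126348641, -182927807095),
      (989246399291, 146258543307)].getD i (0, 0)) rfl (by decide +kernel) (by decide +kernel)
  have loop2 := fun k => abs_loop_le h hS k (n := 15)
    (fun i => [38, 37, 39, 40, 41, 42, 43, 44, 58, 56, 54, 52, 50, 48, 45, 38].getD i 0)
    (fun i => [3, 4, 6, 8, 10, 12, 14, 28, 34, 33, 32, 31, 30, 29, 27].getD i 0)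
    (fun i => [(-866041216768, -499972610108), (-866041216768, 499972610108),
      (-866041216768, -499972610108), (-866041216768, 499972610108), (-866041216768, -499972610108),
      (-866041216768, 499972610108), (-866041216768, -499972610108), (-844076125708, 536223362052),
      (989246399291, -146258543307), (983126348641, 182927807095), (989246399291, -146258543307),
      (983126348641, 182927807095), (989246399291, -146258543307), (983126348641, 182927807095),
      (989246399291, -146258543307)].getD i (0, 0)) rfl (by decide +kernel) (by decide +kernel)
  have loop3 := fun k => abs_loop_le h hS k (n := 8)
    (fun i => [13, 14, 29, 31, 36, 61, 59, 44, 13].getD i 0)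
    (fun i => [13, 15, 22, 24, 26, 35, 28, 14].getD i 0)
    (fun i => [(-866009589934, -500027389391), (-886421116494, 462879686565),
      (-999784667550, -20751350124), (-998322442735, 57899052951), (998322442735, 57899052951),
      (999784667550, -20751350124), (886421116494, 462879686565),
      (866009589934, -500027389391)].getD i (0, 0)) rfl (by decide +kernel) (by decide +kernel)
  have loop4 := fun k => abs_outer_loop_le h hS k
  simp only [Finset.sum_range_succ, Finset.sum_range_zero, List.getD_cons_zero,
    List.getD_cons_succ] at loop1 loop2 loop3
  norm_num at loop1 loop2 loop3
  have hshift0 : ∀ (k : ZMod 169) {i j : Fin 38}, triangleClass i = (j, 0) → ω k i = ω k j := by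
    intro k i j hij
    rw [h.eq_class k i, hij, add_zero]
  have hshift1 : ∀ (k : ZMod 169) {i j : Fin 38}, triangleClass i = (j, 1) →
      ω k i = ω (k + 1) j := by
    intro k i j hij
    rw [h.eq_class k i, hij]
  have c3 : ∀ k, ω k 3 = ω k 1 := fun k => hshift0 k rfl
  have c4 : ∀ k, ω k 4 = ω k 0 := fun k => hshift0 k rfl
  have c5 : ∀ k, ω k 5 = ω k 0 := fun k => hshift0 k rfl
  have c6 : ∀ k, ω k 6 = ω k 1 := fun k => hshift0 k rfl
  have c7 : ∀ k, ω k 7 = ω k 1 := fun k => hshift0 k rfl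
  have c8 : ∀ k, ω k 8 = ω k 0 := fun k => hshift0 k rfl
  have c9 : ∀ k, ω k 9 = ω k 0 := fun k => hshift0 k rfl
  have c10 : ∀ k, ω k 10 = ω k 1 := fun k => hshift0 k rfl
  have c11 : ∀ k, ω k 11 = ω k 1 := fun k => hshift0 k rfl
  have c12 : ∀ k, ω k 12 = ω k 0 := fun k => hshift0 k rfl
  have c13 : ∀ k, ω k 13 = ω k 0 := fun k => hshift0 k rfl
  have c14 : ∀ k, ω k 14 = ω k 1 := fun k => hshift0 k rfl
  have c17 : ∀ k, ω k 17 = ω k 2 := fun k => hshift0 k rfl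
  have c18 : ∀ k, ω k 18 = ω k 16 := fun k => hshift0 k rfl
  have c19 : ∀ k, ω k 19 = ω k 2 := fun k => hshift0 k rfl
  have c20 : ∀ k, ω k 20 = ω k 16 := fun k => hshift0 k rfl
  have c21 : ∀ k, ω k 21 = ω k 2 := fun k => hshift0 k rfl
  have c22 : ∀ k, ω k 22 = ω k 25 := fun k => hshift0 k rfl
  have c24 : ∀ k, ω k 24 = ω k 23 := fun k => hshift0 k rfl
  have c26 : ∀ k, ω k 26 = ω (k + 1) 25 := fun k => hshift1 k rfl
  have c27 : ∀ k, ω k 27 = ω (k + 1) 16 := fun k => hshift1 k rfl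
  have c29 : ∀ k, ω k 29 = ω (k + 1) 2 := fun k => hshift1 k rfl
  have c30 : ∀ k, ω k 30 = ω (k + 1) 16 := fun k => hshift1 k rfl
  have c31 : ∀ k, ω k 31 = ω (k + 1) 2 := fun k => hshift1 k rfl
  have c32 : ∀ k, ω k 32 = ω (k + 1) 16 := fun k => hshift1 k rfl
  have c33 : ∀ k, ω k 33 = ω (k + 1) 2 := fun k => hshift1 k rfl
  have c34 : ∀ k, ω k 34 = ω (k + 1) 16 := fun k => hshift1 k rfl
  have c35 : ∀ k, ω k 35 = ω (k + 1) 23 := fun k => hshift1 k rfl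
  have c36 : ∀ k, ω k 36 = ω (k + 1) 25 := fun k => hshift1 k rfl
  simp only [c3, c4, c5, c6, c7, c8, c9, c10, c11, c12, c13, c14, c17, c18, c19, c20, c21, c22, c24,
    c26, c27, c29, c30, c31, c32, c33, c34, c35, c36]
    at loop1 loop2 loop3 loop4
  have key := abs_le_of_loop_equations (a := fun k => ω k 0) (b := fun k => ω k 1)
    (t := fun k => ω k 15) (t' := fun k => ω k 28) (p := fun k => ω k 2) (q := fun k => ω k 16)
    (r := fun k => ω k 23) (r' := fun k => ω k 25) (fun k => hS k 2) (fun k => hS k 16)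
    ?_ ?_ ?_ ?_ ?_ ?_ ?_ ?_ h0
  · have hall : ∀ k i, |ω k i| ≤ S / 2 := by
      intro k i
      rw [h.eq_class k i]
      generalize k + (triangleClass i).2 = k
      have hmem : ∀ i, (triangleClass i).1 = 0 ∨ (triangleClass i).1 = 1 ∨
          (triangleClass i).1 = 15 ∨ (triangleClass i).1 = 28 ∨ (triangleClass i).1 = 2 ∨
          (triangleClass i).1 = 16 ∨ (triangleClass i).1 = 23 ∨ (triangleClass i).1 = 25 := by
        decide +kernel
      obtain ⟨k1, k2, k3, k4, k5, k6, k7, k8⟩ := key k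
      rcases hmem i with e | e | e | e | e | e | e | e <;> rw [e] <;> assumption
    have hS0 : S ≤ 0 := by linarith [hall k₀ i₀]
    exact abs_nonpos_iff.1 ((hS k i).trans hS0)
  all_goals
    intro k
    have l1 := abs_le.1 (loop1 k).1
    have l1' := abs_le.1 (loop1 k).2
    have l2 := abs_le.1 (loop2 k).1
    have l2' := abs_le.1 (loop2 k).2
    have l3 := abs_le.1 (loop3 k).1
    have l3' := abs_le.1 (loop3 k).2
    have l4 := abs_le.1 (loop4 k).1
    have l4' := abs_le.1 (loop4 k).2
    have s0 := hS' k 0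
    have s1 := hS' k 1
    have s2 := hS' k 15
    have s3 := hS' k 28
    have s4 := hS' k 2
    have s5 := hS' k 16
    have s6 := hS' k 23
    have s7 := hS' k 25
    have s8 := hS' (k + 1) 2
    have s9 := hS' (k + 1) 16
    have s10 := hS' (k + 1) 23
    have s11 := hS' (k + 1) 25
    have s12 := hS' (k + 1) 15
    rw [abs_le]
    clear loop1 loop2 loop3 loop4
  · constructor <;> linarith [l1.1, l1.2]
  · constructor <;> linarith [l1'.1, l1'.2]
  · constructor <;> linarith [l2.1, l2.2]
  · constructor <;> linarith [l2'.1, l2'.2]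
  · constructor <;> linarith [l4.1, l4.2]
  · constructor <;> linarith [l4'.1, l4'.2]
  · constructor <;> linarith [l3.1, l3.2]
  · constructor <;> linarith [l3'.1, l3'.2]

/-- The angular velocities of the triangles in an infinitesimal motion are equal. -/
theorem IsAngularVelocity.eq_const (h : IsAngularVelocity d ω) : ∃ w, ∀ k i, ω k i = w := by
  refine ⟨(ω 0 2 + ω 0 16) / 2, fun k i => ?_⟩
  set w := (ω 0 2 + ω 0 16) / 2 with hw
  have h1 : IsAngularVelocity (fun v => d v - Complex.I * w * ringPos v) fun k i => ω k i - w := by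
    intro k i j j'
    have := h k i j j'
    push_cast
    linear_combination this
  linarith [h1.eq_zero (by rw [hw]; ring) k i]

theorem exists_isAngularVelocity
    (h : ∀ x y, ringGraph.Adj x y → inner ℝ (ringPos x - ringPos y) (d x - d y) = (0 : ℝ)) :
    ∃ ω, IsAngularVelocity d ω := by
  have key : ∀ k i, ∃ w : ℝ, ∀ j, d (ringVertex k (corner i 0)) - d (ringVertex k (corner i j)) =
      Complex.I * w * (ringPos (ringVertex k (corner i 0)) - ringPos (ringVertex k (corner i j))) := by
    intro k i
    have adj : ∀ j j', j ≠ j' →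
        ringGraph.Adj (ringVertex k (corner i j)) (ringVertex k (corner i j')) :=
      fun j j' hj => ringGraph_adj ((adj_iff_corner _ _).2 ⟨i, j, j', hj, rfl, rfl⟩)
    have a01 := adj 0 1 (by decide)
    have a02 := adj 0 2 (by decide)
    have a12 := adj 1 2 (by decide)
    obtain ⟨w, h1, h2⟩ := exists_angular_velocity (norm_ringPos_sub a01) (norm_ringPos_sub a02)
      (norm_ringPos_sub a12) (h _ _ a01) (h _ _ a02) (h _ _ a12)
    refine ⟨w, fun j => ?_⟩
    fin_cases j
    · simp
    · exact h1
    · exact h2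
  choose ω hω using key
  refine ⟨ω, fun k i j j' => ?_⟩
  linear_combination hω k i j' - hω k i j

end velocity

theorem ring_isRigid : IsRigid ringGraph ringPos := by
  refine isRigid_of_infinitesimal ⟨ringVertex 0 0, ringVertex 0 1, fun h => ?_⟩ fun d hd => ?_
  · exact absurd (ringVertex_injective 0 (ringPos_injective h)) (by decide)
  · obtain ⟨ω, hω⟩ := exists_isAngularVelocity hd
    obtain ⟨w, hw⟩ := hω.eq_const
    have hadj : ∀ x y, ringGraph.Adj x y →
        d x - Complex.I * w * ringPos x = d y - Complex.I * w * ringPos y := by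
      intro x y hxy
      obtain ⟨k, a, b, hab, rfl, rfl⟩ := ringGraph_adj_iff.1 hxy
      obtain ⟨i, j, j', -, rfl, rfl⟩ := (adj_iff_corner _ _).1 hab
      have := hω k i j j'
      rw [hw] at this
      linear_combination this
    have hreach : ∀ x y, ringGraph.Reachable x y →
        d x - Complex.I * w * ringPos x = d y - Complex.I * w * ringPos y := by
      rintro x y ⟨W⟩
      induction W with
      | nil => rfl
      | cons hxy _ ih => exact (hadj _ _ hxy).trans ih
    refine ⟨d (ringVertex 0 0) - Complex.I * w * ringPos (ringVertex 0 0), w, fun v => ?_⟩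
    linear_combination hreach v (ringVertex 0 0) (ring_connected.preconnected _ _)

theorem ring_isRingOfG₂ : IsRingOfG₂ 169 ringGraph ringPos ringTriangles 0 := by
  refine ⟨ringCopy, ringShift, fun v => ?_, mem_ringTriangles_iff_exists_copy, ?_, ?_, ?_, 1,
    norm_one, ringCopy_isSymmetry⟩
  · rw [ringPos_ringShift, fullTurn_eq_exp, rotateAbout]
    push_cast
    ring
  · rw [ringCopy_apply, ringShift_ringVertex]
    exact ringVertex_add_one (by decide) 0
  · rw [ringCopy_apply, ringShift_ringVertex]
    exact ringVertex_add_one (by decide) 0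
  · have h : (fun a => ringPos (ringCopy a)) = sectorPos := funext ringPos_ringCopy
    rw [h]
    exact isFlexible_sectorPos

theorem mainTheorem1 :
    (∃ m, IsLeast unitTriangleCounts m ∧ m ≤ 6422) ∧
    ∃ (N : ℕ) (G : SimpleGraph (Fin N)) (p : Fin N → ℂ) (𝒯 : Finset (Finset (Fin N))) (c : ℂ),
      IsUnitTriangleGraph G p 𝒯 ∧ 𝒯.card = 6422 ∧ G.Connected ∧ IsRigid G p ∧
      (∀ u : ℂ, ‖u‖ = 1 → (IsSymmetry G p (rotateAbout c u) ↔ u ^ 169 = 1)) ∧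
      IsRingOfG₂ 169 G p 𝒯 c := by
  have h : 6422 ∈ unitTriangleCounts :=
    ⟨ringOrder, ringGraph, ringPos, ringTriangles, ring_isUnitTriangleGraph, card_ringTriangles⟩
  exact ⟨⟨sInf unitTriangleCounts, ⟨Nat.sInf_mem ⟨_, h⟩, fun _ hn => Nat.sInf_le hn⟩, Nat.sInf_le h⟩,
    ringOrder, ringGraph, ringPos, ringTriangles, 0, ring_isUnitTriangleGraph, card_ringTriangles,
    ring_connected, ring_isRigid, fun _ hu => ring_isSymmetry_iff hu, ring_isRingOfG₂⟩
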